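/- Let $d\ge 1$. Let $\mathcal F$ be the Fourier transform of $L^2(\mathbb R^d)$, $\mathcal F f(\xi)=\int f(x)e^{-2\pi i x\cdot\xi}\,dx$. For $b\in\mathbb R$, $a>0$, $R\in SO(d)$ let $\pi(b,a,R)=U(b)V(a,R)$ on $L^2(\mathbb R^d)$, where $V(a,R)f(x)=a^{-d/4}f(a^{-1/2}R^{-1}x)$ and $U(b)=e^{i\frac{b}{2\pi}\Delta}$, i.e. $\mathcal F U(b)\mathcal F^{-1}g(\xi)=e^{-2\pi i b|\xi|^2}g(\xi)$. Let $\mathcal H_i\subset L^2(S^{d-1})$ $(i\in\mathbb N=\{0,1,2,\dots\})$ be the space of spherical harmonics of degree $i$ (restrictions to the sphere of complex harmonic homogeneous polynomials of degree $i$), $P_i$ the orthogonal projection of $L^2(S^{d-1})$ onto $\mathcal H_i$, and $\rho(R)g(s)=g(R^{-1}s)$. For $f\in L^2(\mathbb R^d)$ let $(Sf)_i\in L^2(\mathbb R_+,\mathcal H_i)$ be given by $(Sf)_i(\omega)=P_i\big[s\mapsto \tfrac{\omega^{(d-2)/4}}{\sqrt2}\,\mathcal F f(\sqrt\omega\,s)\big]$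 for a.e. $\omega>0$. Let $F=\{R_1,\dots,R_L\}$ be a finite subgroup of $SO(d)$ of cardinality $L$, and let $\chi:F\to\mathcal U(\mathcal H_\chi)$, $\chi\in\widehat F$, be representatives of the equivalence classes of irreducible unitary representations of $F$, $d_\chi=\dim\mathcal H_\chi$. For each $i$ fix a unitary identification $\mathcal H_i=\bigoplus_{\chi\in\widehat F}\mathcal H_\chi\otimes\mathbb C^{m_{i,\chi}}$ under which $\rho|_F$ restricted to $\mathcal H_i$ becomes $\bigoplus_\chi \chi\otimes I_{m_{i,\chi}}$; let $(\epsilon_\mu)$ be the canonical basis of $\mathbb C^{m_{i,\chi}}$. For each $\chi$ let $w^\chi_1,\dots,w^\chi_{d_\chi}$ be an orthogonal basis of $\mathcal H_\chi$ with $\|w^\chi_\delta\|^2=d_\chi$. For all $i,\chi$ and $\mu=1,\dots,m_{i,\chi}$ choose an index $\delta_{i,\chi,\mu}\in\{1,\dots,d_\chi\}$, put $v_{i,\chi,\mu}=w^\chi_{\delta_{i,\chi,\mu}}\otimes\epsilon_\mu\in\mathcal H_i$, and choose $\varphi_{i,\chi,\mu}\in L^2(\mathbb R_+)$, extended by $0$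 to $\mathbb R$, such that: (a) $\sum_{i}\sum_{\chi}\sum_{\mu=1}^{m_{i,\chi}} d_\chi\|\varphi_{i,\chi,\mu}\|_2^2<+\infty$; (b) for all $i,\chi,\mu$, for a.e. $\omega>0$, $\sum_{j\in\mathbb Z}|\varphi_{i,\chi,\mu}(2^j\omega)|^2=\frac1L$, and for every odd integer $n$, for a.e. $\omega>0$, $\sum_{j=0}^{\infty}\varphi_{i,\chi,\mu}(2^j\omega)\overline{\varphi_{i,\chi,\mu}(2^j(\omega+n))}=0$; (c) for all $\chi$ and all $(i,\mu)\ne(i',\mu')$ with $w^\chi_{\delta_{i,\chi,\mu}}=w^\chi_{\delta_{i',\chi,\mu'}}$, for a.e. $\omega>0$, $\sum_{j\in\mathbb Z}\varphi_{i,\chi,\mu}(2^j\omega)\overline{\varphi_{i',\chi,\mu'}(2^j\omega)}=0$, and for every odd integer $n$, for a.e. $\omega>0$, $\sum_{j=0}^{\infty}\varphi_{i,\chi,\mu}(2^j\omega)\overline{\varphi_{i',\chi,\mu'}(2^j(\omega+n))}=0$. Then there is exactly one $\eta\in L^2(\mathbb R^d)$ with $(S\eta)_i=\sum_{\chi\in\widehat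 F}\sum_{\mu=1}^{m_{i,\chi}}\varphi_{i,\chi,\mu}\otimes v_{i,\chi,\mu}$ for all $i\in\mathbb N$, and the family $\{\pi(2^jk,2^j,R_\ell)\eta : j,k\in\mathbb Z,\ \ell=1,\dots,L\}$ is a Parseval frame for $L^2(\mathbb R^d)$, i.e. $\sum_{j,k,\ell}|\langle f,\pi(2^jk,2^j,R_\ell)\eta\rangle|^2=\|f\|^2$ for all $f\in L^2(\mathbb R^d)$. -/

import Mathlib

open MeasureTheory Set
open scoped FourierTransform ENNReal ComplexConjugate

noncomputable section

namespace Schrodingerlet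

/-- Euclidean space `ℝ^d` (also used for its dual). -/
abbrev Space (d : ℕ) : Type := EuclideanSpace ℝ (Fin d)

/-- The Hilbert space `L²(ℝ^d)`. -/
abbrev L2Space (d : ℕ) : Type := Lp ℂ 2 (volume : Measure (Space d))

/-- The unit sphere `S^{d-1}` of `ℝ^d`. -/
abbrev Sphere (d : ℕ) : Type := Metric.sphere (0 : Space d) 1

/-- The surface measure of `S^{d-1}`. -/
abbrev surface (d : ℕ) : Measure (Sphere d) := (volume : Measure (Space d)).toSphere

/-- The Hilbert space `L²(S^{d-1})`. -/
abbrev L2Sphere (d : ℕ) : Type := Lp ℂ 2 (surface d)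

/-- The Hilbert space `L²(ℝ_+)`. -/
abbrev L2Pos : Type := Lp ℂ 2 (volume.restrict (Ioi (0 : ℝ)))

/-- The group `SO(d)`. -/
abbrev SO (d : ℕ) : Type := Matrix.specialOrthogonalGroup (Fin d) ℝ

/-- The linear isometry `x ↦ R x` of `ℝ^d` given by `R ∈ SO(d)`. -/
def rotation {d : ℕ} (R : SO d) : Space d ≃ₗᵢ[ℝ] Space d :=
  Unitary.linearIsometryEquiv
    ⟨Matrix.toEuclideanCLM (n := Fin d) (𝕜 := ℝ) R.1,
      Unitary.map_mem _ (Matrix.mem_specialOrthogonalGroup_iff.1 R.2).1⟩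

/-- `rotation R` is multiplication by the matrix `R`. -/
theorem rotation_apply {d : ℕ} (R : SO d) (x : Space d) :
    (rotation R x).ofLp = R.1.mulVec x.ofLp := rfl

/-! ### The representation on `L²(ℝ^d)` -/

theorem memLp_phase {d : ℕ} (b : ℝ) (g : L2Space d) :
    MemLp (fun ξ : Space d =>
      Complex.exp (-(2 * Real.pi * b * ‖ξ‖ ^ 2 : ℝ) * Complex.I) * g ξ) 2 volume := by
  refine (Lp.memLp g).of_le ?_ (Filter.Eventually.of_forall fun ξ => ?_)
  · refine AEStronglyMeasurable.mul ?_ (Lp.aestronglyMeasurable g)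
    exact Continuous.aestronglyMeasurable (by fun_prop)
  · have h : ‖Complex.exp (-(2 * Real.pi * b * ‖ξ‖ ^ 2 : ℝ) * Complex.I)‖ = 1 := by
      rw [← Complex.ofReal_neg, Complex.norm_exp_ofReal_mul_I]
    rw [norm_mul, h, one_mul]

/-- The free evolution `U(b) = e^{i (b / 2π) Δ}` on `L²(ℝ^d)`, i.e. the operator which is
multiplication by `e^{-2π i b |ξ|²}` on the Fourier side. -/
def evolution {d : ℕ} (b : ℝ) (f : L2Space d) : L2Space d :=
  𝓕⁻ ((memLp_phase b (𝓕 f)).toLp _)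

theorem memLp_dilate {d : ℕ} {c : ℝ} (hc : 0 < c) (R : SO d) (f : L2Space d) :
    MemLp (fun x : Space d => f (c • (rotation R).symm x)) 2 volume := by
  have hm : Measurable fun x : Space d => c • (rotation R).symm x := by fun_prop
  have hmap : Measure.map (fun x : Space d => c • (rotation R).symm x) volume =
      ENNReal.ofReal |(c ^ Module.finrank ℝ (Space d))⁻¹| • (volume : Measure (Space d)) := by
    have h1 : Measure.map (fun x : Space d => c • (rotation R).symm x) volume =
        Measure.map (fun x : Space d => c • x)
          (Measure.map (rotation R).symm (volume : Measure (Space d))) :=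
      (Measure.map_map (by fun_prop) (by fun_prop)).symm
    rw [h1, (rotation R).symm.measurePreserving.map_eq,
      Measure.map_addHaar_smul volume hc.ne']
  have h : MemLp (⇑f) 2 (Measure.map (fun x : Space d => c • (rotation R).symm x) volume) := by
    rw [hmap]
    exact (Lp.memLp f).smul_measure ENNReal.ofReal_ne_top
  exact h.comp_of_map hm.aemeasurable

/-- Dilations and rotations: `V(a,R) f(x) = a^{-d/4} f(a^{-1/2} R⁻¹ x)`. -/
def dilation {d : ℕ} (a : ℝ) (ha : 0 < a) (R : SO d) (f : L2Space d) : L2Space d :=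
  ((a ^ (-(d : ℝ) / 4) : ℝ) : ℂ) •
    (memLp_dilate (Real.rpow_pos_of_pos ha (-1 / 2)) R f).toLp _

/-- The Schrödinger representation `π(b,a,R) = U(b) V(a,R)`. -/
def schrodingerRep {d : ℕ} (b a : ℝ) (ha : 0 < a) (R : SO d) (f : L2Space d) : L2Space d :=
  evolution b (dilation a ha R f)

/-! ### Spherical harmonics -/

/-- The action `s ↦ R⁻¹ s` on the sphere. -/
def sphereAct {d : ℕ} (R : SO d) (s : Sphere d) : Sphere d :=
  ⟨(rotation R).symm s, by
    have hs := s.2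
    rw [mem_sphere_zero_iff_norm] at hs ⊢
    rw [LinearIsometryEquiv.norm_map, hs]⟩

open scoped Pointwise in
theorem measurePreserving_sphereAct {d : ℕ} (R : SO d) :
    MeasurePreserving (sphereAct R) (surface d) (surface d) := by
  have hc : Continuous (sphereAct R) :=
    Continuous.subtype_mk ((rotation R).symm.continuous.comp continuous_subtype_val) _
  refine ⟨hc.measurable, Measure.ext fun s hs => ?_⟩
  rw [Measure.map_apply hc.measurable hs, Measure.toSphere_apply' _ hs,
    Measure.toSphere_apply' _ (hc.measurable hs)]
  congr 1
  have himg : Ioo (0 : ℝ) 1 • ((↑) '' (sphereAct R ⁻¹' s) : Set (Space d)) =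
      (rotation R).symm ⁻¹' (Ioo (0 : ℝ) 1 • ((↑) '' s : Set (Space d))) := by
    ext x
    simp only [Set.mem_smul, mem_image, mem_preimage]
    constructor
    · rintro ⟨r, hr, _, ⟨y, hy, rfl⟩, rfl⟩
      exact ⟨r, hr, _, ⟨sphereAct R y, hy, rfl⟩, by simp [sphereAct]⟩
    · rintro ⟨r, hr, _, ⟨y, hy, rfl⟩, h⟩
      have hy1 : ‖rotation R (y : Space d)‖ = 1 := by
        rw [LinearIsometryEquiv.norm_map]; exact mem_sphere_zero_iff_norm.1 y.2
      refine ⟨r, hr, _, ⟨⟨rotation R y, mem_sphere_zero_iff_norm.2 hy1⟩, ?_, rfl⟩, ?_⟩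
      · have : sphereAct R ⟨rotation R y, mem_sphere_zero_iff_norm.2 hy1⟩ = y :=
          Subtype.ext (by simp [sphereAct])
        rwa [this]
      · apply (rotation R).symm.injective
        rw [← h]
        simp
  rw [himg]
  exact (rotation R).symm.measurePreserving.measure_preimage_emb
    (rotation R).symm.toHomeomorph.measurableEmbedding _

/-- The regular representation `ρ(R) φ(s) = φ(R⁻¹ s)` of `SO(d)` on `L²(S^{d-1})`. -/
def regularRep {d : ℕ} (R : SO d) (g : L2Sphere d) : L2Sphere d :=
  Lp.compMeasurePreserving (sphereAct R) (measurePreserving_sphereAct R) g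

/-- Complex polynomials in `d` variables, homogeneous of degree `i` and harmonic. -/
def harmonicPolynomials (d i : ℕ) : Submodule ℂ (MvPolynomial (Fin d) ℂ) :=
  MvPolynomial.homogeneousSubmodule (Fin d) ℂ i ⊓
    LinearMap.ker (∑ k : Fin d, (MvPolynomial.pderiv k).toLinearMap ∘ₗ
      (MvPolynomial.pderiv (R := ℂ) k).toLinearMap)

/-- A polynomial as a continuous function on the sphere. -/
def polyOnSphere (d : ℕ) : MvPolynomial (Fin d) ℂ →ₗ[ℂ] C(Sphere d, ℂ) where
  toFun p := ⟨fun s => MvPolynomial.eval (fun k => ((s : Space d) k : ℂ)) p,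
    (MvPolynomial.continuous_eval p).comp (by fun_prop)⟩
  map_add' p q := by ext; simp
  map_smul' c p := by ext; simp [MvPolynomial.smul_eval]

/-- The space `H_i` of spherical harmonics of degree `i`, as a subspace of `L²(S^{d-1})`. -/
def sphericalHarmonics (d i : ℕ) : Submodule ℂ (L2Sphere d) :=
  (harmonicPolynomials d i).map
    ((ContinuousMap.toLp 2 (surface d) ℂ).toLinearMap ∘ₗ polyOnSphere d)

instance finiteDimensional_sphericalHarmonics (d i : ℕ) :
    FiniteDimensional ℂ (sphericalHarmonics d i) := by
  have h1 : FiniteDimensional ℂ (MvPolynomial.homogeneousSubmodule (Fin d) ℂ i) :=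
    Module.Finite.of_fg (MvPolynomial.homogeneousSubmodule_fg (Fin d) ℂ i)
  have h2 : FiniteDimensional ℂ (harmonicPolynomials d i) :=
    Submodule.finiteDimensional_of_le inf_le_left
  unfold sphericalHarmonics
  infer_instance

/-! ### The unitary operator `S` -/

/-- `(J g)(ω, s) = ω^{(d-2)/4} / √2 * g(√ω s)`. -/
def polar {d : ℕ} (g : L2Space d) (ω : ℝ) (s : Sphere d) : ℂ :=
  ((ω ^ (((d : ℝ) - 2) / 4) / Real.sqrt 2 : ℝ) : ℂ) * g (Real.sqrt ω • (s : Space d))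

open Classical in
/-- The class in `L²(S^{d-1})` of a square-integrable function (and `0` otherwise). -/
def sphereClass {d : ℕ} (u : Sphere d → ℂ) : L2Sphere d :=
  if h : MemLp u 2 (surface d) then h.toLp u else 0

/-- The component `(S f)_i = (Id ⊗ P_i) J 𝓕 f` of `S f`, as a function `ℝ_+ → H_i`
(well defined almost everywhere, since almost every slice `(J 𝓕 f)(ω, ·)` is in `L²(S^{d-1})`). -/
def radialComponent {d : ℕ} (f : L2Space d) (i : ℕ) (ω : ℝ) : sphericalHarmonics d i :=
  (sphericalHarmonics d i).orthogonalProjectionOnto (sphereClass (polar (𝓕 f) ω))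

/-! ### Irreducible representations of a group -/

/-- `τ` is a system of representatives of the equivalence classes of irreducible unitary
representations (on finite-dimensional Hilbert spaces) of the group `G`. -/
structure IsUnitaryDual {G X : Type*} [Group G] {H : X → Type*}
    [∀ χ, NormedAddCommGroup (H χ)] [∀ χ, InnerProductSpace ℂ (H χ)]
    (τ : ∀ χ, Representation ℂ G (H χ)) : Prop where
  unitary : ∀ χ g v, ‖τ χ g v‖ = ‖v‖
  irreducible : ∀ χ, (τ χ).IsIrreducible
  inequivalent : ∀ χ χ', χ ≠ χ' → IsEmpty ((τ χ).Equiv (τ χ'))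
  exhaustive : ∀ (n : ℕ) (σ : Representation ℂ G (EuclideanSpace ℂ (Fin n))),
    (∀ g v, ‖σ g v‖ = ‖v‖) → σ.IsIrreducible → ∃ χ, Nonempty (σ.Equiv (τ χ))

/-- The Hilbert space `⨁_χ H_χ ⊗ ℂ^{m_χ}`, an element being the family of its components in
the summands `H_χ ⊗ ℂ ε_μ ≃ H_χ`. -/
abbrev Isotypic {X : Type*} (H : X → Type*) (m : X → ℕ) : Type _ :=
  PiLp 2 (fun p : (Σ χ : X, Fin (m χ)) => H p.1)

open Classical in
/-- The vector `w ⊗ ε_μ` of `H_χ ⊗ ℂ^{m_χ}`. -/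
def Isotypic.tensor {X : Type*} {H : X → Type*} [∀ χ, NormedAddCommGroup (H χ)] {m : X → ℕ}
    (χ : X) (μ : Fin (m χ)) (w : H χ) : Isotypic H m :=
  PiLp.single (β := fun p : (Σ χ : X, Fin (m χ)) => H p.1) 2 ⟨χ, μ⟩ w

/-- The action `⨁_χ τ_χ(g) ⊗ I` of a group element on `⨁_χ H_χ ⊗ ℂ^{m_χ}`. -/
def Isotypic.act {G X : Type*} [Group G] {H : X → Type*}
    [∀ χ, NormedAddCommGroup (H χ)] [∀ χ, InnerProductSpace ℂ (H χ)]
    (τ : ∀ χ, Representation ℂ G (H χ)) {m : X → ℕ} (g : G) (x : Isotypic H m) : Isotypic H m :=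
  WithLp.toLp 2 (fun p => τ p.1 g (x p))

/-- The extension by zero to `ℝ` of `φ ∈ L²(ℝ_+)`. -/
def zeroExt (φ : L2Pos) (ω : ℝ) : ℂ := (Ioi (0 : ℝ)).indicator φ ω

/-- A family `ψ` is a Parseval frame if `∑ |⟨f, ψ_i⟩|² = ‖f‖²` for all `f`. -/
def IsParsevalFrame {ι E : Type*} [NormedAddCommGroup E] [InnerProductSpace ℂ E]
    (ψ : ι → E) : Prop :=
  ∀ f : E, HasSum (fun i => ‖inner ℂ f (ψ i)‖ ^ 2) (‖f‖ ^ 2)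

end Schrodingerlet

end

noncomputable section

namespace Schrodingerlet

/-! In the Fourier variable `ξ = √ω s` the evolution multiplies by a phase depending on `ω` alone,
the dilation rescales `ω`, and the rotation moves `s`. Hence on the slices `ω ↦ J 𝓕 f (ω, ·)` the
operator `π(2^j k, 2^j, R)` is a one-dimensional dyadic wavelet operator, seen on the frequency
side, tensored with the regular representation on the sphere (`sphereClass_fourier_schrodingerRep`).
The sphere splits orthogonally into copies of the irreducibles `H χ`, indexed by `p = (i, χ, μ)`
(`sphereDecomposition_harmonicEmbedding`).

By `isParsevalFrame_of_total` it suffices to prove the polarized Parseval identity on a total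
family. The family used is `1_A ⊗ y_p(e)`, with `A` inside some `[2^{-M}, 2^M]` and `e ∈ H χ`. The
coefficient of such a function against the orbit of `η` is a product `⟨e, χ(R) w⟩ · waveletCoeff A
φ_p j k` (`SphereDecomposition.inner_schrodingerRep`), so the sum over `(j, k, R)` is a wavelet sum
times a group sum.

The group sum is governed by Schur orthogonality. It vanishes for inequivalent `χ` and for
orthogonal vectors `w`, and for `p = p'` it is `L ⟨e, e'⟩` because `‖w‖² = d_χ`. The wavelet sum is
`κ |A ∩ B|` (`CalderonPair.hasSum_waveletCoeff`), with `κ = 1/L` on the diagonal and `κ = 0` under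
condition (c). So the two factors multiply to the inner product of the test functions.

For the wavelet sum, Fourier series in `k` give `∑_{j,m} ∫ 1_A(y) 1_B(y + 2^{-j} m) φ(2^j y) conj
ψ(2^j y + m) dy`. The terms with `m = 0` give `κ |A ∩ B|`. For `m ≠ 0` write `m = 2^l q` with `q`
odd and `j = j' + l`: the cutoffs depend only on `(j', q)`, and the sum over `l` is the one which
the odd-integer condition makes zero. This rearrangement needs absolute convergence, which comes
from the cutoffs to dyadic blocks.

Existence of `η` is convergence of the orthogonal series of the pieces `φ_p ⊗ y_p(w_p)`, which is
condition (a); uniqueness is totality of the spherical harmonics. -/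

/-! ### Fourier series and periodization -/

/-- Parseval's identity for Fourier coefficients on `(0, 1]`, in bilinear form. -/
theorem hasSum_fourierCoeffOn_mul_conj {u v : ℝ → ℂ}
    (hu : MemLp u 2 (volume.restrict (Ioc 0 1))) (hv : MemLp v 2 (volume.restrict (Ioc 0 1))) :
    HasSum (fun k : ℤ => fourierCoeffOn zero_lt_one u k * conj (fourierCoeffOn zero_lt_one v k))
      (∫ x in Ioc (0 : ℝ) 1, u x * conj (v x)) := by
  have h01 : Fact ((0 : ℝ) < 1 - 0) := ⟨by norm_num⟩
  have e1 : (0 : ℝ) + (1 - 0) = 1 := by norm_num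
  rw [← e1] at hu hv
  have h1 := hu.memLp_liftIoc.haarAddCircle
  have h2 := hv.memLp_liftIoc.haarAddCircle
  have := (fourierBasis (T := (1 : ℝ) - 0)).hasSum_inner_mul_inner h2.toLp h1.toLp
  have hint : inner ℂ (h2.toLp) (h1.toLp) = ∫ x in Ioc (0 : ℝ) 1, u x * conj (v x) := by
    rw [L2.inner_def]
    have e2 : ∫ x in Ioc (0 : ℝ) 1, u x * conj (v x) =
        ∫ x in (0 : ℝ)..(0 + (1 - 0)), u x * conj (v x) := by
      rw [intervalIntegral.integral_of_le (by norm_num), e1]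
    rw [e2, ← AddCircle.integral_liftIoc_eq_intervalIntegral, AddCircle.integral_haarAddCircle,
      show ((1 : ℝ) - 0)⁻¹ = 1 by norm_num, one_smul]
    refine integral_congr_ae ?_
    have hac : (volume : Measure (AddCircle ((1 : ℝ) - 0))) ≪ AddCircle.haarAddCircle := by
      rw [AddCircle.volume_eq_smul_haarAddCircle]
      exact Measure.smul_absolutelyContinuous
    filter_upwards [hac.ae_eq h1.coeFn_toLp, hac.ae_eq h2.coeFn_toLp] with x hx1 hx2
    rw [hx1, hx2, RCLike.inner_apply]
    rfl
  rw [hint] at this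
  have heq : ∀ k : ℤ, fourierCoeffOn zero_lt_one u k * conj (fourierCoeffOn zero_lt_one v k) =
      inner ℂ h2.toLp (fourierBasis k) * inner ℂ (fourierBasis k) h1.toLp := by
    intro k
    rw [← inner_conj_symm (h2.toLp) (fourierBasis k), ← HilbertBasis.repr_apply_apply,
      ← HilbertBasis.repr_apply_apply, fourierBasis_repr, fourierBasis_repr, mul_comm,
      fourierCoeff_congr_ae h1.coeFn_toLp, fourierCoeff_congr_ae h2.coeFn_toLp]
    rfl
  simp_rw [heq]
  exact this

/-- The integers whose translates of `(0, 1]` meet `[-N, N]`. -/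
def shiftRange (N : ℕ) : Finset ℤ := Finset.Icc (-(N + 1) : ℤ) (N + 1)

theorem lt_abs_add_of_notMem_shiftRange {N : ℕ} {x : ℝ} (hx : x ∈ Ioc (0 : ℝ) 1) {m : ℤ}
    (hm : m ∉ shiftRange N) : (N : ℝ) < |x + m| := by
  rw [shiftRange, Finset.mem_Icc, not_and_or, not_le, not_le] at hm
  rw [lt_abs]
  rcases hm with hm | hm
  · right
    have : (m : ℝ) + 1 ≤ -(N + 1) := by exact_mod_cast hm
    linarith [hx.2]
  · left
    have : ((N : ℝ) + 1) + 1 ≤ m := by exact_mod_cast hm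
    linarith [hx.1]

/-- The integral of a function supported in `[-N, N]` as a sum of integrals over `(0, 1]`. -/
theorem integral_eq_sum_Ioc {g : ℝ → ℂ} (hg : Integrable g) {N : ℕ}
    (hs : ∀ x, (N : ℝ) < |x| → g x = 0) :
    ∫ x, g x = ∑ m ∈ shiftRange N, ∫ x in Ioc (0 : ℝ) 1, g (x + m) := by
  have h := hg.hasSum_intervalIntegral_comp_add_int
  refine h.unique ?_
  simp_rw [intervalIntegral.integral_of_le zero_le_one]
  refine hasSum_sum_of_ne_finset_zero fun m hm => ?_
  refine setIntegral_eq_zero_of_forall_eq_zero fun x hx => ?_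
  exact hs _ (lt_abs_add_of_notMem_shiftRange hx hm)

/-- The periodization of a function (used for functions with bounded support). -/
def periodize (u : ℝ → ℂ) (x : ℝ) : ℂ := ∑' m : ℤ, u (x + m)

theorem periodize_add_int (u : ℝ → ℂ) (x : ℝ) (m : ℤ) : periodize u (x + m) = periodize u x := by
  unfold periodize
  rw [← (Equiv.addLeft m).tsum_eq (fun n : ℤ => u (x + n))]
  simp [add_assoc]

theorem periodize_eq_sum {u : ℝ → ℂ} {N : ℕ} (hs : ∀ x, (N : ℝ) < |x| → u x = 0) {x : ℝ}
    (hx : x ∈ Ioc (0 : ℝ) 1) : periodize u x = ∑ m ∈ shiftRange N, u (x + m) :=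
  tsum_eq_sum fun _ hm => hs _ (lt_abs_add_of_notMem_shiftRange hx hm)

theorem memLp_comp_add {u : ℝ → ℂ} (hu : MemLp u 2 volume) (c : ℝ) :
    MemLp (fun x => u (x + c)) 2 volume :=
  hu.comp_measurePreserving (measurePreserving_add_right volume c)

theorem memLp_periodize {u : ℝ → ℂ} (hu : MemLp u 2 volume) {N : ℕ}
    (hs : ∀ x, (N : ℝ) < |x| → u x = 0) :
    MemLp (periodize u) 2 (volume.restrict (Ioc 0 1)) := by
  have h1 : MemLp (fun x => ∑ m ∈ shiftRange N, u (x + m)) 2 (volume.restrict (Ioc 0 1)) :=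
    memLp_finsetSum _ fun m _ => (memLp_comp_add hu m).restrict _
  refine h1.ae_eq ?_
  filter_upwards [ae_restrict_mem measurableSet_Ioc] with x hx
  exact (periodize_eq_sum hs hx).symm

theorem integrable_of_bounded_support {u : ℝ → ℂ} (hu : MemLp u 2 volume) {N : ℕ}
    (hs : ∀ x, (N : ℝ) < |x| → u x = 0) : Integrable u := by
  have h1 : IntegrableOn u (Icc (-N : ℝ) N) :=
    (hu.restrict (Icc (-N : ℝ) N)).integrable one_le_two
  refine (integrableOn_iff_integrable_of_support_subset ?_).1 h1
  intro x hx
  by_contra h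
  exact hx (hs x (by rw [← not_le, abs_le]; exact h))

/-- The character `x ↦ e^{-2πikx}`. -/
def expChar (k : ℤ) (x : ℝ) : ℂ := Complex.exp (-(2 * Real.pi * k * x : ℝ) * Complex.I)

theorem norm_expChar (k : ℤ) (x : ℝ) : ‖expChar k x‖ = 1 := by
  rw [expChar, ← Complex.ofReal_neg, Complex.norm_exp_ofReal_mul_I]

theorem continuous_expChar (k : ℤ) : Continuous (expChar k) := by
  unfold expChar; fun_prop

theorem expChar_add_int (k : ℤ) (x : ℝ) (m : ℤ) : expChar k (x + m) = expChar k x := by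
  unfold expChar
  rw [Complex.exp_eq_exp_iff_exists_int]
  exact ⟨-(k * m), by push_cast; ring⟩

theorem integrable_mul_expChar {u : ℝ → ℂ} (hu : Integrable u) (k : ℤ) :
    Integrable fun x => u x * expChar k x :=
  hu.mul_bdd (c := 1) (continuous_expChar k).aestronglyMeasurable
    (Filter.Eventually.of_forall fun x => (norm_expChar k x).le)

/-- Unfolding: the character is 1-periodic, so integrating it against the periodization over one
period is integrating it against `u` over the line. -/
theorem fourierCoeffOn_periodize {u : ℝ → ℂ} (hu : MemLp u 2 volume) {N : ℕ}
    (hs : ∀ x, (N : ℝ) < |x| → u x = 0) (k : ℤ) :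
    fourierCoeffOn zero_lt_one (periodize u) k = ∫ x, u x * expChar k x := by
  have hi := integrable_of_bounded_support hu hs
  have hik := integrable_mul_expChar hi k
  rw [integral_eq_sum_Ioc hik (N := N) (fun x hx => by rw [hs x hx, zero_mul]),
    fourierCoeffOn_eq_integral, intervalIntegral.integral_of_le zero_le_one,
    ← integral_finsetSum (shiftRange N) (f := fun m x => u (x + m) * expChar k (x + m))
      fun m _ => (hik.comp_add_right (m : ℝ)).integrableOn]
  simp only [sub_zero, div_one, one_smul]
  refine setIntegral_congr_fun measurableSet_Ioc fun x hx => ?_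
  simp only [periodize_eq_sum hs hx, smul_eq_mul, Finset.mul_sum, expChar_add_int]
  refine Finset.sum_congr rfl fun m _ => ?_
  rw [mul_comm, expChar, fourier_coe_apply]
  congr 2
  push_cast
  ring

/-- Parseval's identity for the sequence of values at the integers of the Fourier transforms
of functions with bounded support. -/
theorem hasSum_integral_mul_expChar {u v : ℝ → ℂ} (hu : MemLp u 2 volume) (hv : MemLp v 2 volume)
    {N : ℕ} (hus : ∀ x, (N : ℝ) < |x| → u x = 0) (hvs : ∀ x, (N : ℝ) < |x| → v x = 0) :
    HasSum (fun k : ℤ => (∫ x, u x * expChar k x) * conj (∫ x, v x * expChar k x))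
      (∑' m : ℤ, ∫ x, u x * conj (v (x + m))) := by
  have h := hasSum_fourierCoeffOn_mul_conj (memLp_periodize hu hus) (memLp_periodize hv hvs)
  simp_rw [fourierCoeffOn_periodize hu hus, fourierCoeffOn_periodize hv hvs] at h
  suffices hsum : ∑' m : ℤ, ∫ x, u x * conj (v (x + m)) =
      ∫ x in Ioc (0 : ℝ) 1, periodize u x * conj (periodize v x) by
    rw [hsum]; exact h
  have hint : ∀ m : ℤ, Integrable fun x => u x * conj (v (x + m)) := fun m =>
    hu.integrable_mul (memLp_comp_add hv m).star
  -- Two points of `[-N, N]` differ by at most `2N`, so only finitely many shifts contribute.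
  have hzero : ∀ m ∉ Finset.Icc (-(2 * N) : ℤ) (2 * N), ∀ x, u x * conj (v (x + m)) = 0 := by
    intro m hm x
    by_cases hx : (N : ℝ) < |x|
    · rw [hus x hx, zero_mul]
    · rw [hvs, map_zero, mul_zero]
      rw [Finset.mem_Icc, ← abs_le, not_le] at hm
      have h2 : (2 * N : ℝ) < |(m : ℝ)| := by exact_mod_cast hm
      have h3 := abs_sub_abs_le_abs_sub (m : ℝ) (-x)
      rw [abs_neg, sub_neg_eq_add, add_comm (m : ℝ)] at h3
      linarith [not_lt.1 hx]
  have hper : ∀ x, u x * conj (periodize v x) =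
      ∑ m ∈ Finset.Icc (-(2 * N) : ℤ) (2 * N), u x * conj (v (x + m)) := by
    intro x
    by_cases hx : u x = 0
    · simp [hx]
    · rw [periodize, tsum_eq_sum (s := Finset.Icc (-(2 * N) : ℤ) (2 * N)), map_sum, Finset.mul_sum]
      intro m hm
      have := hzero m hm x
      simpa [hx] using this
  rw [tsum_eq_sum (s := Finset.Icc (-(2 * N) : ℤ) (2 * N))
    (fun m hm => by simp [hzero m hm]), ← integral_finsetSum _ fun m _ => hint m]
  simp_rw [← hper]
  have hw : Integrable fun x => u x * conj (periodize v x) := by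
    simp_rw [hper]
    exact integrable_finsetSum _ fun m _ => hint m
  -- Only `u` is folded onto `(0, 1]`; the periodization of `v` is already invariant under the
  -- shifts.
  rw [integral_eq_sum_Ioc hw (N := N) (fun x hx => by rw [hus x hx, zero_mul]),
    ← integral_finsetSum (shiftRange N) (f := fun m x => u (x + m) * conj (periodize v (x + m)))
      fun m _ => (hw.comp_add_right (m : ℝ)).integrableOn]
  refine setIntegral_congr_fun measurableSet_Ioc fun x hx => ?_
  simp only [periodize_add_int, periodize_eq_sum hus hx, Finset.sum_mul]

/-! ### Absolute convergence of the dyadic correlations -/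

/-- The interval `[2^{-M}, 2^M]`. -/
def dyadicBlock (M : ℕ) : Set ℝ := Icc ((2 : ℝ) ^ (-(M : ℤ))) (2 ^ (M : ℤ))

theorem measurableSet_dyadicBlock (M : ℕ) : MeasurableSet (dyadicBlock M) := measurableSet_Icc

theorem pos_of_mem_dyadicBlock {M : ℕ} {x : ℝ} (hx : x ∈ dyadicBlock M) : 0 < x :=
  (zpow_pos two_pos _).trans_le hx.1

theorem two_zpow_pos (j : ℤ) : (0 : ℝ) < 2 ^ j := zpow_pos two_pos j

theorem lintegral_comp_mul_left {f : ℝ → ℝ≥0∞} (hf : Measurable f) {a : ℝ} (ha : 0 < a) :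
    ∫⁻ x, f (a * x) = ENNReal.ofReal a⁻¹ * ∫⁻ x, f x := by
  rw [← lintegral_map hf (measurable_const_mul a), Real.map_volume_mul_left ha.ne',
    lintegral_smul_measure, abs_of_pos (inv_pos.2 ha), smul_eq_mul]

/-- Two points of the block are at distance at most `2^M`, so `|m| ≤ 2^{j+M}`, and there are at most
`2 · 2^{j+M}` such nonzero integers. Leaving out `m = 0` is essential: as `j → -∞` it would still
count once, while the bound tends to zero. -/
theorem tsum_ne_zero_indicator_le (M : ℕ) (j : ℤ) (y : ℝ) (hy : y ∈ dyadicBlock M) :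
    ∑' m : ℤ, (if m = 0 then 0 else
      (dyadicBlock M).indicator (1 : ℝ → ℝ≥0∞) (y + 2 ^ (-j) * m)) ≤
      2 ^ (M + 1) * ENNReal.ofReal (2 ^ j) := by
  have key : ∀ m : ℤ, y + 2 ^ (-j) * m ∈ dyadicBlock M → |(m : ℝ)| ≤ 2 ^ (j + M) := by
    intro m hm
    have h1 : |(2 : ℝ) ^ (-j) * m| ≤ 2 ^ (M : ℤ) := by
      have := pos_of_mem_dyadicBlock hm
      have := pos_of_mem_dyadicBlock hy
      rw [abs_le]; constructor <;> linarith [hm.2, hy.2]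
    rw [abs_mul, abs_of_pos (two_zpow_pos _), zpow_neg, inv_mul_le_iff₀ (two_zpow_pos _)] at h1
    rwa [zpow_add₀ two_ne_zero]
  have hpow : (2 : ℝ≥0∞) ^ (M + 1) * ENNReal.ofReal (2 ^ j) =
      ENNReal.ofReal (2 * 2 ^ (j + M)) := by
    rw [← ENNReal.ofReal_ofNat 2, ← ENNReal.ofReal_pow zero_le_two,
      ← ENNReal.ofReal_mul (by positivity), zpow_add₀ two_ne_zero, zpow_natCast, pow_succ]
    ring_nf
  rw [hpow]
  -- For `j + M < 0` no nonzero integer satisfies `|m| ≤ 2^{j+M}`.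
  rcases lt_or_ge (j + M) 0 with hneg | hpos
  · have : ∀ m : ℤ, (if m = 0 then 0 else
      (dyadicBlock M).indicator (1 : ℝ → ℝ≥0∞) (y + 2 ^ (-j) * m)) = 0 := by
      intro m
      split_ifs with hm
      · rfl
      · refine indicator_of_notMem (fun h => ?_) _
        have h1 := key m h
        have h2 : (1 : ℝ) ≤ |(m : ℝ)| := by exact_mod_cast Int.one_le_abs hm
        have h3 : (2 : ℝ) ^ (j + M) < 1 := zpow_lt_one_of_neg₀ one_lt_two hneg
        linarith
    simp [this, -zpow_neg]
  · obtain ⟨n, hn⟩ := Int.eq_ofNat_of_zero_le hpos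
    have h2 : ∀ m : ℤ, (if m = 0 then 0 else
        (dyadicBlock M).indicator (1 : ℝ → ℝ≥0∞) (y + 2 ^ (-j) * m)) ≤
        if m ∈ (Finset.Icc (-2 ^ n : ℤ) (2 ^ n)).erase 0 then 1 else 0 := by
      intro m
      by_cases hm : m = 0
      · simp [hm]
      by_cases hmem : y + 2 ^ (-j) * m ∈ dyadicBlock M
      · have h1 := key m hmem
        rw [hn, zpow_natCast] at h1
        have h3 : |m| ≤ 2 ^ n := by exact_mod_cast h1
        rw [if_pos (Finset.mem_erase.2 ⟨hm, Finset.mem_Icc.2 (abs_le.1 h3)⟩), if_neg hm]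
        simp [hmem, -zpow_neg]
      · simp [hm, hmem, -zpow_neg]
    refine (ENNReal.tsum_le_tsum h2).trans ?_
    rw [tsum_eq_sum (s := (Finset.Icc (-2 ^ n : ℤ) (2 ^ n)).erase 0)
      (fun m hm => if_neg hm), Finset.sum_congr rfl (fun m hm => if_pos hm)]
    rw [Finset.sum_const, Finset.card_erase_of_mem (by simp), Int.card_Icc]
    have : ((2 : ℤ) ^ n + 1 - -2 ^ n).toNat - 1 = 2 * 2 ^ n := by
      have : (2 : ℤ) ^ n + 1 - -2 ^ n = ((2 * 2 ^ n + 1 : ℕ) : ℤ) := by push_cast; ring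
      rw [this, Int.toNat_natCast]; simp
    rw [this, hn, zpow_natCast, nsmul_eq_mul, mul_one]
    rw [ENNReal.ofReal_mul zero_le_two, ENNReal.ofReal_pow zero_le_two]
    simp

/-- If `2^n ≤ x < 2^{n+1}`, then `2^{-j} x` can lie in the block only for `n - M ≤ j ≤ n + M + 1`.
-/
theorem tsum_indicator_dilate_le (M : ℕ) (x : ℝ) :
    ∑' j : ℤ, (dyadicBlock M).indicator (1 : ℝ → ℝ≥0∞) (2 ^ (-j) * x) ≤ 2 * M + 2 := by
  rcases le_or_gt x 0 with hx | hx
  · have : ∀ j : ℤ, (dyadicBlock M).indicator (1 : ℝ → ℝ≥0∞) (2 ^ (-j) * x) = 0 := fun j =>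
      indicator_of_notMem (fun h => by
        have h1 := pos_of_mem_dyadicBlock h
        have := mul_nonpos_of_nonneg_of_nonpos (two_zpow_pos (-j)).le hx
        linarith) _
    simp [this, -zpow_neg]
  obtain ⟨n, hn1, hn2⟩ := exists_mem_Ico_zpow hx one_lt_two
  have h2 : ∀ j : ℤ, (dyadicBlock M).indicator (1 : ℝ → ℝ≥0∞) (2 ^ (-j) * x) ≤
      if j ∈ Finset.Icc (n - M) (n + M + 1) then 1 else 0 := by
    intro j
    by_cases hmem : 2 ^ (-j) * x ∈ dyadicBlock M
    · have h1 : n - M ≤ j ∧ j ≤ n + M + 1 := by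
        constructor
        · have h3 : (2 : ℝ) ^ (-j + n) ≤ 2 ^ (M : ℤ) := by
            rw [zpow_add₀ two_ne_zero]
            exact (mul_le_mul_of_nonneg_left hn1 (two_zpow_pos _).le).trans hmem.2
          have := (zpow_le_zpow_iff_right₀ (one_lt_two (α := ℝ))).1 h3
          omega
        · have h3 : (2 : ℝ) ^ (-(M : ℤ)) < 2 ^ (-j + (n + 1)) := by
            rw [zpow_add₀ two_ne_zero]
            exact hmem.1.trans_lt (mul_lt_mul_of_pos_left hn2 (two_zpow_pos _))
          have := (zpow_lt_zpow_iff_right₀ (one_lt_two (α := ℝ))).1 h3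
          omega
      rw [if_pos (Finset.mem_Icc.2 h1)]
      simp [hmem, -zpow_neg]
    · simp [hmem, -zpow_neg]
  refine (ENNReal.tsum_le_tsum h2).trans ?_
  rw [tsum_eq_sum (s := Finset.Icc (n - M : ℤ) (n + M + 1)) (fun m hm => if_neg hm),
    Finset.sum_congr rfl (fun m hm => if_pos hm), Finset.sum_const, Int.card_Icc]
  have : (n + M + 1 + 1 - (n - M)).toNat = 2 * M + 2 := by omega
  rw [this]
  simp

/-- Counting the shifts at scale `j` costs a factor `2^j`, which is exactly the Jacobian of `x = 2^j
y`. What remains is `∑_j ∫ 1(2^{-j} x) f(x) dx`, and each `x` meets at most `2M + 2` scales. -/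
theorem lintegral_shift_block_lt_top (M : ℕ) {f : ℝ → ℝ≥0∞} (hf : Measurable f)
    (hfin : ∫⁻ x, f x ≠ ∞) :
    ∑' j : ℤ, ∑' m : ℤ, (if m = 0 then 0 else
      ∫⁻ y, (dyadicBlock M).indicator (1 : ℝ → ℝ≥0∞) y *
        (dyadicBlock M).indicator (1 : ℝ → ℝ≥0∞) (y + 2 ^ (-j) * m) * f (2 ^ j * y)) ≠ ∞ := by
  set b : ℝ → ℝ≥0∞ := (dyadicBlock M).indicator 1 with hb
  have hbm : Measurable b := measurable_one.indicator (measurableSet_dyadicBlock M)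
  have h1 : ∀ j : ℤ, ∑' m : ℤ, (if m = 0 then 0 else
      ∫⁻ y, b y * b (y + 2 ^ (-j) * m) * f (2 ^ j * y)) ≤
      2 ^ (M + 1) * ∫⁻ x, b (2 ^ (-j) * x) * f x := by
    intro j
    have e1 : ∀ m : ℤ, (if m = 0 then 0 else
        ∫⁻ y, b y * b (y + 2 ^ (-j) * m) * f (2 ^ j * y)) =
        ∫⁻ y, (b y * f (2 ^ j * y)) * (if m = 0 then 0 else b (y + 2 ^ (-j) * m)) := by
      intro m
      split_ifs
      · simp
      · refine lintegral_congr fun y => ?_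
        ring
    simp_rw [e1]
    rw [← lintegral_tsum fun m => by
      refine Measurable.aemeasurable (Measurable.mul (by fun_prop) ?_)
      split_ifs
      · exact measurable_const
      · fun_prop]
    simp_rw [ENNReal.tsum_mul_left]
    -- Here the factor `2^j` from the count of shifts is absorbed.
    have e2 : ∫⁻ x, b (2 ^ (-j) * x) * f x =
        ENNReal.ofReal (2 ^ j) * ∫⁻ y, b y * f (2 ^ j * y) := by
      have := lintegral_comp_mul_left (f := fun y => b y * f (2 ^ j * y)) (by fun_prop)
        (two_zpow_pos (-j))
      rw [← zpow_neg, neg_neg] at this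
      rw [← this]
      refine lintegral_congr fun y => ?_
      rw [← mul_assoc, ← zpow_add₀ two_ne_zero]
      simp
    rw [e2, ← mul_assoc, ← lintegral_const_mul _ (by fun_prop)]
    refine lintegral_mono fun y => ?_
    by_cases hy : y ∈ dyadicBlock M
    · rw [mul_comm]
      exact mul_le_mul_left (tsum_ne_zero_indicator_le M j y hy) _
    · simp [hb, hy]
  refine ne_top_of_le_ne_top ?_ (ENNReal.tsum_le_tsum h1)
  rw [ENNReal.tsum_mul_left, ← lintegral_tsum fun j => by fun_prop]
  simp_rw [ENNReal.tsum_mul_right]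
  refine ENNReal.mul_ne_top (by finiteness) ?_
  refine ne_top_of_le_ne_top ?_ (lintegral_mono fun x =>
    mul_le_mul_left (tsum_indicator_dilate_le M x) _)
  rw [lintegral_const_mul _ hf]
  exact ENNReal.mul_ne_top (by finiteness) hfin

theorem hasSum_of_eq {ι : Type*} {f : ι → ℂ} {a b : ℂ} (h : HasSum f a) (e : a = b) :
    HasSum f b := e ▸ h

theorem ENNReal_mul_le_sq_add_sq (a b : ℝ≥0∞) : a * b ≤ a ^ 2 + b ^ 2 := by
  rcases le_total a b with h | h
  · exact (mul_le_mul_left h b).trans (by rw [sq b]; exact le_add_self)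
  · exact (mul_le_mul_right h a).trans (by rw [sq a]; exact le_self_add)

/-- The correlation of two dilated functions, cut off by two sets. -/
def crossKernel (A B : Set ℝ) (φ ψ : ℝ → ℂ) (j m : ℤ) (y : ℝ) : ℂ :=
  A.indicator 1 y * B.indicator 1 (y + 2 ^ (-j) * m) * (φ (2 ^ j * y) * conj (ψ (2 ^ j * y + m)))

theorem measurable_crossKernel {A B : Set ℝ} (hA : MeasurableSet A) (hB : MeasurableSet B)
    {φ ψ : ℝ → ℂ} (hφ : Measurable φ) (hψ : Measurable ψ) (j m : ℤ) :
    Measurable (crossKernel A B φ ψ j m) := by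
  have h1 : Measurable (A.indicator (1 : ℝ → ℂ)) := measurable_one.indicator hA
  have h2 : Measurable (B.indicator (1 : ℝ → ℂ)) := measurable_one.indicator hB
  have h3 : Measurable fun y => conj (ψ (2 ^ j * y + m)) :=
    Complex.continuous_conj.measurable.comp (by fun_prop)
  unfold crossKernel
  fun_prop

theorem enorm_crossKernel_le {M : ℕ} {A B : Set ℝ} (hA : A ⊆ dyadicBlock M)
    (hB : B ⊆ dyadicBlock M) (φ ψ : ℝ → ℂ) (j m : ℤ) (y : ℝ) :
    ‖crossKernel A B φ ψ j m y‖ₑ ≤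
      (dyadicBlock M).indicator 1 y * (dyadicBlock M).indicator 1 (y + 2 ^ (-j) * m) *
        ‖φ (2 ^ j * y)‖ₑ ^ 2 +
      (dyadicBlock M).indicator 1 y * (dyadicBlock M).indicator 1 (y + 2 ^ (-j) * m) *
        ‖ψ (2 ^ j * y + m)‖ₑ ^ 2 := by
  have key : ∀ {C : Set ℝ}, C ⊆ dyadicBlock M → ∀ x,
      ‖C.indicator (1 : ℝ → ℂ) x‖ₑ ≤ (dyadicBlock M).indicator (1 : ℝ → ℝ≥0∞) x := by
    intro C hC x
    by_cases hx : x ∈ C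
    · simp [hx, hC hx]
    · simp [hx]
  rw [← mul_add, crossKernel, enorm_mul, enorm_mul, enorm_mul]
  refine mul_le_mul' (mul_le_mul' (key hA _) (key hB _)) ?_
  rw [RCLike.enorm_conj]
  exact ENNReal_mul_le_sq_add_sq _ _

/-- The kernel is dominated by a term with `|φ|²` and one with `|ψ|²`. The second takes the form of
the first after the translation `y ↦ y + 2^{-j} m` and the reflection `m ↦ -m`, so one shift
estimate serves for both. -/
theorem tsum_lintegral_crossKernel_ne_zero {M : ℕ} {A B : Set ℝ} (hA : A ⊆ dyadicBlock M)
    (hB : B ⊆ dyadicBlock M) {φ ψ : ℝ → ℂ} (hφ : Measurable φ) (hψ : Measurable ψ)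
    (hφ2 : ∫⁻ x, ‖φ x‖ₑ ^ 2 ≠ ∞) (hψ2 : ∫⁻ x, ‖ψ x‖ₑ ^ 2 ≠ ∞) :
    ∑' j : ℤ, ∑' m : ℤ, (if m = 0 then 0 else ∫⁻ y, ‖crossKernel A B φ ψ j m y‖ₑ) ≠ ∞ := by
  set b : ℝ → ℝ≥0∞ := (dyadicBlock M).indicator 1 with hb
  have hbm : Measurable b := measurable_one.indicator (measurableSet_dyadicBlock M)
  have h1 := lintegral_shift_block_lt_top M (f := fun x => ‖φ x‖ₑ ^ 2) (by fun_prop) hφ2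
  have h2 := lintegral_shift_block_lt_top M (f := fun x => ‖ψ x‖ₑ ^ 2) (by fun_prop) hψ2
  rw [← hb] at h1 h2
  have hle : ∀ j m : ℤ, (if m = 0 then 0 else ∫⁻ y, ‖crossKernel A B φ ψ j m y‖ₑ) ≤
      (if m = 0 then 0 else ∫⁻ y, b y * b (y + 2 ^ (-j) * m) * ‖φ (2 ^ j * y)‖ₑ ^ 2) +
      (if -m = 0 then 0 else
        ∫⁻ y, b y * b (y + 2 ^ (-j) * (-m : ℤ)) * ‖ψ (2 ^ j * y)‖ₑ ^ 2) := by
    intro j m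
    by_cases hm : m = 0
    · simp [hm]
    rw [if_neg hm, if_neg hm, if_neg (by simpa using hm)]
    have e : ∫⁻ y, b y * b (y + 2 ^ (-j) * (-m : ℤ)) * ‖ψ (2 ^ j * y)‖ₑ ^ 2 =
        ∫⁻ y, b y * b (y + 2 ^ (-j) * m) * ‖ψ (2 ^ j * y + m)‖ₑ ^ 2 := by
      rw [← lintegral_add_right_eq_self _ (2 ^ (-j) * (m : ℝ))]
      refine lintegral_congr fun y => ?_
      have e1 : y + 2 ^ (-j) * (m : ℝ) + 2 ^ (-j) * (-m : ℤ) = y := by push_cast; ring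
      have e2 : (2 : ℝ) ^ j * (y + 2 ^ (-j) * m) = 2 ^ j * y + m := by
        rw [mul_add, ← mul_assoc, ← zpow_add₀ two_ne_zero]; simp
      rw [e1, e2, mul_comm (b y)]
    rw [e, ← lintegral_add_left (by fun_prop)]
    exact lintegral_mono fun y => enorm_crossKernel_le hA hB φ ψ j m y
  refine ne_top_of_le_ne_top ?_ (ENNReal.tsum_le_tsum fun j => ENNReal.tsum_le_tsum (hle j))
  simp_rw [ENNReal.tsum_add]
  refine ENNReal.add_ne_top.2 ⟨h1, ?_⟩
  convert h2 using 3 with j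
  exact (Equiv.neg ℤ).tsum_eq (fun m : ℤ => if m = 0 then 0 else
    ∫⁻ y, b y * b (y + 2 ^ (-j) * m) * ‖ψ (2 ^ j * y)‖ₑ ^ 2)

/-- Counting gives nothing for `m = 0`. There the sum over scales is the Calderón sum, constant
almost everywhere, integrated over a block of finite measure. -/
theorem tsum_lintegral_dilate_block {M : ℕ} {φ : ℝ → ℂ} (hφ : Measurable φ) {C : ℝ}
    (hC : ∀ᵐ ω ∂(volume.restrict (Ioi (0 : ℝ))), HasSum (fun j : ℤ => ‖φ (2 ^ j * ω)‖ ^ 2) C) :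
    ∑' j : ℤ, ∫⁻ y, (dyadicBlock M).indicator (1 : ℝ → ℝ≥0∞) y * ‖φ (2 ^ j * y)‖ₑ ^ 2 ≠ ∞ := by
  have hbm : Measurable ((dyadicBlock M).indicator (1 : ℝ → ℝ≥0∞)) :=
    measurable_one.indicator (measurableSet_dyadicBlock M)
  rw [← lintegral_tsum fun j => by fun_prop]
  have hle : ∫⁻ y, ∑' j : ℤ, (dyadicBlock M).indicator (1 : ℝ → ℝ≥0∞) y * ‖φ (2 ^ j * y)‖ₑ ^ 2 ≤
      ∫⁻ y, (dyadicBlock M).indicator (fun _ => ENNReal.ofReal C) y := by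
    refine lintegral_mono_ae ?_
    rw [ae_restrict_iff' measurableSet_Ioi] at hC
    filter_upwards [hC] with y hy
    rw [ENNReal.tsum_mul_left]
    by_cases hmem : y ∈ dyadicBlock M
    · have h := hy (pos_of_mem_dyadicBlock hmem)
      rw [indicator_of_mem hmem, indicator_of_mem hmem, ← h.tsum_eq,
        ENNReal.ofReal_tsum_of_nonneg (fun _ => by positivity) h.summable]
      simp [ENNReal.ofReal_pow, ofReal_norm]
    · simp [hmem]
  refine ne_top_of_le_ne_top ?_ hle
  rw [lintegral_indicator (measurableSet_dyadicBlock M), setLIntegral_const]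
  refine ENNReal.mul_ne_top ENNReal.ofReal_ne_top ?_
  rw [dyadicBlock]
  simp

theorem tsum_lintegral_crossKernel {M : ℕ} {A B : Set ℝ} (hA : A ⊆ dyadicBlock M)
    (hB : B ⊆ dyadicBlock M) {φ ψ : ℝ → ℂ} (hφ : Measurable φ) (hψ : Measurable ψ)
    (hφ2 : ∫⁻ x, ‖φ x‖ₑ ^ 2 ≠ ∞) (hψ2 : ∫⁻ x, ‖ψ x‖ₑ ^ 2 ≠ ∞) {C : ℝ}
    (hφC : ∀ᵐ ω ∂(volume.restrict (Ioi (0 : ℝ))), HasSum (fun j : ℤ => ‖φ (2 ^ j * ω)‖ ^ 2) C)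
    (hψC : ∀ᵐ ω ∂(volume.restrict (Ioi (0 : ℝ))), HasSum (fun j : ℤ => ‖ψ (2 ^ j * ω)‖ ^ 2) C) :
    ∑' p : ℤ × ℤ, ∫⁻ y, ‖crossKernel A B φ ψ p.1 p.2 y‖ₑ ≠ ∞ := by
  have hbm : Measurable ((dyadicBlock M).indicator (1 : ℝ → ℝ≥0∞)) :=
    measurable_one.indicator (measurableSet_dyadicBlock M)
  rw [ENNReal.tsum_prod (f := fun j m => ∫⁻ y, ‖crossKernel A B φ ψ j m y‖ₑ)]
  have hle : ∀ j m : ℤ, ∫⁻ y, ‖crossKernel A B φ ψ j m y‖ₑ ≤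
      (if m = 0 then
        (∫⁻ y, (dyadicBlock M).indicator (1 : ℝ → ℝ≥0∞) y * ‖φ (2 ^ j * y)‖ₑ ^ 2) +
        ∫⁻ y, (dyadicBlock M).indicator (1 : ℝ → ℝ≥0∞) y * ‖ψ (2 ^ j * y)‖ₑ ^ 2 else 0) +
      (if m = 0 then 0 else ∫⁻ y, ‖crossKernel A B φ ψ j m y‖ₑ) := by
    intro j m
    by_cases hm : m = 0
    · rw [if_pos hm, if_pos hm, add_zero, ← lintegral_add_left (by fun_prop)]
      refine lintegral_mono fun y => ?_
      refine (enorm_crossKernel_le hA hB φ ψ j m y).trans (le_of_eq ?_)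
      by_cases hy : y ∈ dyadicBlock M <;> simp [hm, hy]
    · simp [hm]
  refine ne_top_of_le_ne_top ?_ (ENNReal.tsum_le_tsum fun j => ENNReal.tsum_le_tsum (hle j))
  simp_rw [ENNReal.tsum_add, tsum_ite_eq]
  rw [ENNReal.tsum_add]
  exact ENNReal.add_ne_top.2 ⟨ENNReal.add_ne_top.2 ⟨tsum_lintegral_dilate_block hφ hφC,
    tsum_lintegral_dilate_block hψ hψC⟩,
    tsum_lintegral_crossKernel_ne_zero hA hB hφ hψ hφ2 hψ2⟩

theorem integrable_and_summable_of_tsum_lintegral {ι α : Type*} [MeasurableSpace α]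
    {μ : Measure α} {F : ι → α → ℂ} (hF : ∀ i, AEStronglyMeasurable (F i) μ)
    (hfin : ∑' i, ∫⁻ y, ‖F i y‖ₑ ∂μ ≠ ∞) :
    (∀ i, Integrable (F i) μ) ∧ Summable fun i => ∫ y, ‖F i y‖ ∂μ := by
  refine ⟨fun i => ⟨hF i, lt_top_iff_ne_top.2 (ENNReal.ne_top_of_tsum_ne_top hfin i)⟩, ?_⟩
  simp_rw [fun i => integral_norm_eq_lintegral_enorm (hF i)]
  exact ENNReal.summable_toReal hfin

/-! ### Rearrangement along powers of two times odd integers -/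

/-- A nonzero integer is uniquely a power of two times an odd integer; here the pairs `(j, m)` with
`m ≠ 0` are parametrized by `(j', q, l) ↦ (j' + l, 2 ^ l q)`, `q` odd. -/
def oddShift (x : (ℤ × {q : ℤ // Odd q}) × ℕ) : ℤ × ℤ :=
  (x.1.1 + x.2, 2 ^ x.2 * x.1.2)

theorem two_pow_mul_odd_injective {q q' : ℤ} (hq : Odd q) (hq' : Odd q') {l l' : ℕ}
    (h : (2 : ℤ) ^ l * q = 2 ^ l' * q') : l = l' := by
  wlog hl : l ≤ l' generalizing l l' q q'
  · exact (this hq' hq h.symm (le_of_not_ge hl)).symm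
  obtain ⟨k, rfl⟩ := Nat.exists_eq_add_of_le hl
  rw [pow_add, mul_assoc] at h
  have h1 : q = 2 ^ k * q' := mul_left_cancel₀ (by positivity) h
  rcases Nat.eq_zero_or_pos k with rfl | hk
  · simp
  · exfalso
    have h2 : Even ((2 : ℤ) ^ k * q') := ((even_two (α := ℤ)).pow_of_ne_zero hk.ne').mul_right _
    rw [← h1] at h2
    exact (Int.not_even_iff_odd.2 hq) h2

theorem oddShift_injective : Function.Injective oddShift := by
  rintro ⟨⟨j, q, hq⟩, l⟩ ⟨⟨j', q', hq'⟩, l'⟩ h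
  simp only [oddShift, Prod.mk.injEq] at h
  have hl := two_pow_mul_odd_injective hq hq' h.2
  subst hl
  have h2 : q = q' := mul_left_cancel₀ (by positivity) h.2
  have h1 : j = j' := by linarith [h.1]
  simp [h1, h2]

theorem isCompl_range_oddShift :
    IsCompl (range fun j : ℤ => (j, (0 : ℤ))) (range oddShift) := by
  rw [isCompl_iff, disjoint_left, codisjoint_iff_le_sup]
  constructor
  · rintro _ ⟨j, rfl⟩ ⟨⟨⟨j', q, hq⟩, l⟩, h⟩
    simp only [oddShift, Prod.mk.injEq, mul_eq_zero] at h
    rcases h.2 with h | h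
    · exact absurd h (by positivity)
    · subst h; simp at hq
  · rintro ⟨j, m⟩ -
    by_cases hm : m = 0
    · left; exact ⟨j, by simp [hm]⟩
    · right
      obtain ⟨l, q, hq, hlq⟩ := Nat.exists_eq_two_pow_mul_odd (Int.natAbs_ne_zero.2 hm)
      have hmeq : m = 2 ^ l * (m.sign * q) := by
        conv_lhs => rw [← Int.sign_mul_natAbs m, hlq]
        push_cast; ring
      have hsign : Odd m.sign := by
        rcases lt_or_gt_of_ne hm with h | h
        · rw [Int.sign_eq_neg_one_of_neg h]; decide
        · rw [Int.sign_eq_one_of_pos h]; decide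
      refine ⟨((j - l, ⟨m.sign * q, hsign.mul (by exact_mod_cast hq)⟩), l), ?_⟩
      simp only [oddShift, Prod.mk.injEq]
      exact ⟨by ring, hmeq.symm⟩

theorem ae_comp_mul_left {P : ℝ → Prop} (hP : ∀ᵐ ω ∂(volume.restrict (Ioi (0 : ℝ))), P ω)
    {a : ℝ} (ha : 0 < a) : ∀ᵐ ω, 0 < ω → P (a * ω) := by
  rw [ae_restrict_iff' measurableSet_Ioi] at hP
  have hq : Measure.QuasiMeasurePreserving (fun x : ℝ => a * x) volume volume :=
    ⟨measurable_const_mul a, by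
      rw [Real.map_volume_mul_left ha.ne']
      exact Measure.smul_absolutelyContinuous⟩
  filter_upwards [hq.ae hP] with ω h hω
  exact h (mul_pos ha hω)

/-- The correlations of two wavelets satisfying the Calderón conditions add up. -/
theorem hasSum_integral_crossKernel {M : ℕ} {A B : Set ℝ} (hAm : MeasurableSet A)
    (hBm : MeasurableSet B) (hA : A ⊆ dyadicBlock M)
    (hB : B ⊆ dyadicBlock M) {φ ψ : ℝ → ℂ} (hφ : Measurable φ) (hψ : Measurable ψ)
    (hφ2 : ∫⁻ x, ‖φ x‖ₑ ^ 2 ≠ ∞) (hψ2 : ∫⁻ x, ‖ψ x‖ₑ ^ 2 ≠ ∞) {C : ℝ}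
    (hφC : ∀ᵐ ω ∂(volume.restrict (Ioi (0 : ℝ))), HasSum (fun j : ℤ => ‖φ (2 ^ j * ω)‖ ^ 2) C)
    (hψC : ∀ᵐ ω ∂(volume.restrict (Ioi (0 : ℝ))), HasSum (fun j : ℤ => ‖ψ (2 ^ j * ω)‖ ^ 2) C)
    {κ : ℂ} (hκ : ∀ᵐ ω ∂(volume.restrict (Ioi (0 : ℝ))),
      HasSum (fun j : ℤ => φ (2 ^ j * ω) * conj (ψ (2 ^ j * ω))) κ)
    (hodd : ∀ n : ℤ, Odd n → ∀ᵐ ω ∂(volume.restrict (Ioi (0 : ℝ))),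
      HasSum (fun l : ℕ => φ (2 ^ l * ω) * conj (ψ (2 ^ l * (ω + n)))) 0) :
    HasSum (fun p : ℤ × ℤ => ∫ y, crossKernel A B φ ψ p.1 p.2 y)
      (κ * volume.real (A ∩ B)) := by
  have hmeas : ∀ p : ℤ × ℤ, AEStronglyMeasurable (crossKernel A B φ ψ p.1 p.2) volume :=
    fun p => (measurable_crossKernel hAm hBm hφ hψ p.1 p.2).aestronglyMeasurable
  obtain ⟨hint, hsum⟩ := integrable_and_summable_of_tsum_lintegral hmeas
    (tsum_lintegral_crossKernel hA hB hφ hψ hφ2 hψ2 hφC hψC)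
  have hsumG : Summable fun p : ℤ × ℤ => ∫ y, crossKernel A B φ ψ p.1 p.2 y :=
    hsum.of_norm_bounded fun p => norm_integral_le_integral_norm _
  have hinj0 : Function.Injective fun j : ℤ => (j, (0 : ℤ)) := fun a b h => (Prod.mk.inj h).1
  rw [← add_zero (κ * _)]
  refine HasSum.add_isCompl isCompl_range_oddShift ?_ ?_
  · refine (hinj0.hasSum_range_iff
      (f := fun p : ℤ × ℤ => ∫ y, crossKernel A B φ ψ p.1 p.2 y)).2 ?_
    have h := hasSum_integral_of_summable_integral_norm (fun j : ℤ => hint (j, 0))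
      (hsum.comp_injective hinj0)
    refine hasSum_of_eq h ?_
    -- With `m = 0` both cutoffs are evaluated at `y`, leaving the diagonal Calderón sum on `A ∩ B`.
    have : ∀ᵐ y, ∑' j : ℤ, crossKernel A B φ ψ j 0 y = (A ∩ B).indicator (fun _ => κ) y := by
      rw [ae_restrict_iff' measurableSet_Ioi] at hκ
      filter_upwards [hκ] with y hy
      by_cases hyA : y ∈ A
      · by_cases hyB : y ∈ B
        · have := hy (pos_of_mem_dyadicBlock (hA hyA))
          rw [indicator_of_mem (mem_inter hyA hyB), ← this.tsum_eq]
          simp [crossKernel, hyA, hyB]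
        · simp [crossKernel, hyA, hyB]
      · simp [crossKernel, hyA]
    rw [integral_congr_ae this, integral_indicator (hAm.inter hBm), setIntegral_const,
      mul_comm, Complex.real_smul]
  · refine (oddShift_injective.hasSum_range_iff
      (f := fun p : ℤ × ℤ => ∫ y, crossKernel A B φ ψ p.1 p.2 y)).2 ?_
    have hs := hsumG.comp_injective oddShift_injective
    have h0 : ∀ b : ℤ × {q : ℤ // Odd q}, HasSum (fun l : ℕ =>
        ((fun p : ℤ × ℤ => ∫ y, crossKernel A B φ ψ p.1 p.2 y) ∘ oddShift) (b, l)) 0 := by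
      rintro ⟨j, q, hq⟩
      have hinj : Function.Injective fun l : ℕ => oddShift ((j, ⟨q, hq⟩), l) :=
        fun a b h => (Prod.mk.inj (oddShift_injective h)).2
      have h := hasSum_integral_of_summable_integral_norm
        (fun l : ℕ => hint (oddShift ((j, ⟨q, hq⟩), l))) (hsum.comp_injective hinj)
      refine hasSum_of_eq h ?_
      refine integral_eq_zero_of_ae ?_
      -- The odd-integer condition is used at the point `2^j y` with `n = q`.
      filter_upwards [ae_comp_mul_left (hodd q hq) (two_zpow_pos j)] with y hy
      by_cases hyA : y ∈ A
      · have h1 := hy (pos_of_mem_dyadicBlock (hA hyA))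
        have h2 := h1.mul_left (A.indicator 1 y * B.indicator 1 (y + 2 ^ (-j) * (q : ℝ)))
        rw [mul_zero] at h2
        refine Eq.trans (tsum_congr fun l => ?_) h2.tsum_eq
        -- The translation in the second cutoff does not depend on `l`, so both cutoffs factor out
        -- of the sum over `l`.
        have e1 : (2 : ℝ) ^ (-(j + l : ℤ)) * ((2 ^ l * q : ℤ) : ℝ) = 2 ^ (-j) * q := by
          rw [neg_add, zpow_add₀ two_ne_zero, zpow_neg 2 (l : ℤ), zpow_natCast]
          push_cast
          field_simp
        have e2 : (2 : ℝ) ^ (j + l : ℤ) * y = 2 ^ l * (2 ^ j * y) := by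
          rw [zpow_add₀ two_ne_zero, zpow_natCast]; ring
        have e3 : (2 : ℝ) ^ l * (2 ^ j * y) + ((2 ^ l * q : ℤ) : ℝ) =
            2 ^ l * (2 ^ j * y + q) := by
          push_cast; ring
        simp only [crossKernel, oddShift, e1, e2, e3]
      · simp [crossKernel, hyA]
    -- The family is already summable and each sum over `l` is zero, so its total is zero.
    have := hs.hasSum.prod_fiberwise h0
    rw [← this.unique hasSum_zero]
    exact hs.hasSum

/-! ### Wavelet coefficients and the reproducing formula -/

/-- The inner product of the indicator of `A` with the wavelet
`y ↦ 2^{j/2} φ(2^j y) e^{-2πi 2^j k y}`. -/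
def waveletCoeff (A : Set ℝ) (φ : ℝ → ℂ) (j k : ℤ) : ℂ :=
  ∫ y in A, (Real.sqrt (2 ^ j) : ℂ) * φ (2 ^ j * y) * expChar k (2 ^ j * y)

/-- The rescaled cut-off of `φ` whose Fourier coefficients are the wavelet coefficients. -/
def scaledCutoff (A : Set ℝ) (φ : ℝ → ℂ) (j : ℤ) (x : ℝ) : ℂ :=
  ((Real.sqrt (2 ^ j))⁻¹ : ℂ) * (A.indicator 1 (2 ^ (-j) * x) * φ x)

theorem integral_comp_two_zpow_mul (F : ℝ → ℂ) (j : ℤ) :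
    ∫ x, F x = ((2 : ℝ) ^ j : ℝ) * ∫ y, F (2 ^ j * y) := by
  rw [Measure.integral_comp_mul_left, abs_of_pos (inv_pos.2 (two_zpow_pos j)), Complex.real_smul,
    ← mul_assoc, ← Complex.ofReal_mul, mul_inv_cancel₀ (two_zpow_pos j).ne', Complex.ofReal_one,
    one_mul]

theorem two_zpow_neg_mul_cancel (j : ℤ) (y : ℝ) : (2 : ℝ) ^ (-j) * (2 ^ j * y) = y := by
  rw [← mul_assoc, ← zpow_add₀ two_ne_zero]; simp

theorem sqrt_mul_sqrt_two_zpow (j : ℤ) :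
    (Real.sqrt (2 ^ j) : ℂ) * (Real.sqrt (2 ^ j) : ℂ) = ((2 : ℝ) ^ j : ℝ) := by
  rw [← Complex.ofReal_mul, Real.mul_self_sqrt (two_zpow_pos j).le]

theorem sqrt_two_zpow_ne_zero (j : ℤ) : (Real.sqrt (2 ^ j) : ℂ) ≠ 0 :=
  Complex.ofReal_ne_zero.2 (Real.sqrt_pos.2 (two_zpow_pos j)).ne'

theorem waveletCoeff_eq_integral {A : Set ℝ} (hA : MeasurableSet A) (φ : ℝ → ℂ) (j k : ℤ) :
    waveletCoeff A φ j k = ∫ x, scaledCutoff A φ j x * expChar k x := by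
  rw [integral_comp_two_zpow_mul _ j, ← integral_const_mul, waveletCoeff,
    ← integral_indicator hA]
  refine integral_congr_ae (Filter.Eventually.of_forall fun y => ?_)
  simp only [scaledCutoff, two_zpow_neg_mul_cancel]
  by_cases hy : y ∈ A
  · rw [indicator_of_mem hy, indicator_of_mem hy, ← sqrt_mul_sqrt_two_zpow]
    have := sqrt_two_zpow_ne_zero j
    simp only [Pi.one_apply]
    field_simp
  · simp [hy]

theorem memLp_scaledCutoff {A : Set ℝ} (hA : MeasurableSet A) {φ : ℝ → ℂ}
    (hφ : MemLp φ 2 volume) (j : ℤ) : MemLp (scaledCutoff A φ j) 2 volume := by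
  refine MemLp.const_mul ?_ _
  have hm : MeasurableSet ((fun x : ℝ => 2 ^ (-j) * x) ⁻¹' A) := measurable_const_mul _ hA
  refine (hφ.indicator hm).ae_eq (Filter.Eventually.of_forall fun x => ?_)
  by_cases hx : 2 ^ (-j) * x ∈ A
  · simp [indicator, hx, -zpow_neg]
  · simp [indicator, hx, -zpow_neg]

theorem scaledCutoff_eq_zero {M : ℕ} {A : Set ℝ} (hA : A ⊆ dyadicBlock M) (φ : ℝ → ℂ) {j : ℤ}
    {N : ℕ} (hN : (2 : ℝ) ^ (j + M) ≤ N) {x : ℝ} (hx : (N : ℝ) < |x|) :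
    scaledCutoff A φ j x = 0 := by
  rw [scaledCutoff, indicator_of_notMem, zero_mul, mul_zero]
  intro h
  have h1 := hA h
  have h2 := pos_of_mem_dyadicBlock h1
  have h3 : 0 < x := (pos_iff_pos_of_mul_pos h2).1 (two_zpow_pos _)
  rw [abs_of_pos h3] at hx
  have h4 := h1.2
  rw [zpow_neg, inv_mul_le_iff₀ (two_zpow_pos _), ← zpow_add₀ two_ne_zero] at h4
  linarith

theorem integral_scaledCutoff_mul_conj (A B : Set ℝ) (φ ψ : ℝ → ℂ) (j m : ℤ) :
    ∫ x, scaledCutoff A φ j x * conj (scaledCutoff B ψ j (x + m)) =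
      ∫ y, crossKernel A B φ ψ j m y := by
  rw [integral_comp_two_zpow_mul _ j, ← integral_const_mul]
  refine integral_congr_ae (Filter.Eventually.of_forall fun y => ?_)
  have e : (2 : ℝ) ^ (-j) * (2 ^ j * y + m) = y + 2 ^ (-j) * m := by
    rw [mul_add, two_zpow_neg_mul_cancel]
  have hc : conj (B.indicator (1 : ℝ → ℂ) (y + 2 ^ (-j) * m)) =
      B.indicator (1 : ℝ → ℂ) (y + 2 ^ (-j) * m) := by
    by_cases h : y + 2 ^ (-j) * m ∈ B
    · rw [indicator_of_mem h]; simp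
    · rw [indicator_of_notMem h]; simp
  simp only [scaledCutoff, two_zpow_neg_mul_cancel, e, map_mul, hc, crossKernel, map_inv₀,
    Complex.conj_ofReal]
  rw [← sqrt_mul_sqrt_two_zpow]
  have := sqrt_two_zpow_ne_zero j
  field_simp

theorem memLp_two_of_lintegral {φ : ℝ → ℂ} (hφ : Measurable φ) (hφ2 : ∫⁻ x, ‖φ x‖ₑ ^ 2 ≠ ∞) :
    MemLp φ 2 volume := by
  refine ⟨hφ.aestronglyMeasurable, ?_⟩
  rw [eLpNorm_lt_top_iff_lintegral_rpow_enorm_lt_top two_ne_zero ENNReal.ofNat_ne_top]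
  simpa [lt_top_iff_ne_top] using hφ2

/-- At a fixed scale this is Parseval for Fourier series, applied to cutoffs supported in `[-N, N]`
with `N ≥ 2^{j+M}`. The bound `N` may depend on `j`, since no uniformity in the scale is needed
here. -/
theorem hasSum_waveletCoeff_fiber {M : ℕ} {A B : Set ℝ} (hAm : MeasurableSet A)
    (hBm : MeasurableSet B) (hA : A ⊆ dyadicBlock M) (hB : B ⊆ dyadicBlock M) {φ ψ : ℝ → ℂ}
    (hφ : MemLp φ 2 volume) (hψ : MemLp ψ 2 volume) (j : ℤ) :
    HasSum (fun k : ℤ => waveletCoeff A φ j k * conj (waveletCoeff B ψ j k))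
      (∑' m : ℤ, ∫ y, crossKernel A B φ ψ j m y) := by
  obtain ⟨N, hN⟩ := exists_nat_ge ((2 : ℝ) ^ (j + M))
  simp_rw [waveletCoeff_eq_integral hAm, waveletCoeff_eq_integral hBm,
    ← integral_scaledCutoff_mul_conj]
  exact hasSum_integral_mul_expChar (memLp_scaledCutoff hAm hφ j) (memLp_scaledCutoff hBm hψ j)
    (fun x hx => scaledCutoff_eq_zero hA φ hN hx) (fun x hx => scaledCutoff_eq_zero hB ψ hN hx)

/-- The conditions on a pair of square-integrable functions which give the reproducing formula for
the corresponding wavelet systems. -/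
structure CalderonPair (φ ψ : ℝ → ℂ) (κ : ℂ) : Prop where
  diag : ∀ᵐ ω ∂(volume.restrict (Ioi (0 : ℝ))),
    HasSum (fun j : ℤ => φ (2 ^ j * ω) * conj (ψ (2 ^ j * ω))) κ
  odd : ∀ n : ℤ, Odd n → ∀ᵐ ω ∂(volume.restrict (Ioi (0 : ℝ))),
    HasSum (fun l : ℕ => φ (2 ^ l * ω) * conj (ψ (2 ^ l * (ω + n)))) 0

theorem CalderonPair.hasSum_sq {φ : ℝ → ℂ} {C : ℝ} (h : CalderonPair φ φ C) :
    ∀ᵐ ω ∂(volume.restrict (Ioi (0 : ℝ))), HasSum (fun j : ℤ => ‖φ (2 ^ j * ω)‖ ^ 2) C := by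
  filter_upwards [h.diag] with ω hω
  rw [← Complex.hasSum_ofReal]
  convert hω using 2 with j
  rw [Complex.mul_conj, Complex.normSq_eq_norm_sq]

/-- The terms are nonnegative, so iterated summability suffices: Parseval sums over `k`, and
absolute convergence of the correlations sums over `j`. -/
theorem CalderonPair.summable_sq_waveletCoeff {φ : ℝ → ℂ} {C : ℝ} (h : CalderonPair φ φ C)
    (hφ : Measurable φ) (hφ2 : ∫⁻ x, ‖φ x‖ₑ ^ 2 ≠ ∞) {M : ℕ} {A : Set ℝ} (hAm : MeasurableSet A)
    (hA : A ⊆ dyadicBlock M) :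
    Summable fun p : ℤ × ℤ => ‖waveletCoeff A φ p.1 p.2‖ ^ 2 := by
  have hL := memLp_two_of_lintegral hφ hφ2
  have h1 := hasSum_integral_crossKernel hAm hAm hA hA hφ hφ hφ2 hφ2 h.hasSum_sq h.hasSum_sq
    h.diag h.odd
  have h2 : ∀ j, HasSum (fun k : ℤ => ((‖waveletCoeff A φ j k‖ ^ 2 : ℝ) : ℂ))
      (∑' m : ℤ, ∫ y, crossKernel A A φ φ j m y) := by
    intro j
    convert hasSum_waveletCoeff_fiber hAm hAm hA hA hL hL j using 2 with k
    rw [Complex.mul_conj, Complex.normSq_eq_norm_sq]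
  refine (summable_prod_of_nonneg fun p => by positivity).2 ⟨fun j => ?_, ?_⟩
  · exact Complex.summable_ofReal.1 (h2 j).summable
  · refine Complex.summable_ofReal.1 ?_
    simp_rw [Complex.ofReal_tsum, fun j => (h2 j).tsum_eq]
    exact h1.summable.prod

/-- Summability of the products of wavelet coefficients. -/
theorem CalderonPair.summable_waveletCoeff {φ ψ : ℝ → ℂ} {C : ℝ}
    (h1 : CalderonPair φ φ C) (h2 : CalderonPair ψ ψ C)
    (hφ : Measurable φ) (hφ2 : ∫⁻ x, ‖φ x‖ₑ ^ 2 ≠ ∞)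
    (hψ : Measurable ψ) (hψ2 : ∫⁻ x, ‖ψ x‖ₑ ^ 2 ≠ ∞) {M : ℕ} {A B : Set ℝ}
    (hAm : MeasurableSet A) (hBm : MeasurableSet B)
    (hA : A ⊆ dyadicBlock M) (hB : B ⊆ dyadicBlock M) :
    Summable fun p : ℤ × ℤ =>
      waveletCoeff A φ p.1 p.2 * conj (waveletCoeff B ψ p.1 p.2) := by
  refine Summable.of_norm_bounded
    ((h1.summable_sq_waveletCoeff hφ hφ2 hAm hA).add
      (h2.summable_sq_waveletCoeff hψ hψ2 hBm hB)) fun p => ?_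
  rw [norm_mul, RCLike.norm_conj]
  nlinarith [sq_nonneg (‖waveletCoeff A φ p.1 p.2‖ - ‖waveletCoeff B ψ p.1 p.2‖),
    sq_nonneg (‖waveletCoeff A φ p.1 p.2‖), sq_nonneg (‖waveletCoeff B ψ p.1 p.2‖)]

/-- The reproducing formula for wavelet coefficients. -/
theorem CalderonPair.hasSum_waveletCoeff {φ ψ : ℝ → ℂ} {κ : ℂ} {C : ℝ} (h : CalderonPair φ ψ κ)
    (h1 : CalderonPair φ φ C) (h2 : CalderonPair ψ ψ C)
    (hφ : Measurable φ) (hφ2 : ∫⁻ x, ‖φ x‖ₑ ^ 2 ≠ ∞)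
    (hψ : Measurable ψ) (hψ2 : ∫⁻ x, ‖ψ x‖ₑ ^ 2 ≠ ∞) {M : ℕ} {A B : Set ℝ}
    (hAm : MeasurableSet A) (hBm : MeasurableSet B)
    (hA : A ⊆ dyadicBlock M) (hB : B ⊆ dyadicBlock M) :
    HasSum (fun p : ℤ × ℤ => waveletCoeff A φ p.1 p.2 * conj (waveletCoeff B ψ p.1 p.2))
      (κ * volume.real (A ∩ B)) := by
  have hs := CalderonPair.summable_waveletCoeff h1 h2 hφ hφ2 hψ hψ2 hAm hBm hA hB
  have hL1 := memLp_two_of_lintegral hφ hφ2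
  have hL2 := memLp_two_of_lintegral hψ hψ2
  -- The families indexed by `(j, k)` and `(j, m)` are both summable and have the same sum at each
  -- scale `j`, hence the same total.
  have e1 := hs.hasSum.prod_fiberwise fun j => hasSum_waveletCoeff_fiber hAm hBm hA hB hL1 hL2 j
  have e2 := hasSum_integral_crossKernel hAm hBm hA hB hφ hψ hφ2 hψ2 h1.hasSum_sq h2.hasSum_sq
    h.diag h.odd
  have e3 := e2.prod_fiberwise fun j => (e2.summable.prod_factor j).hasSum
  rw [← e1.unique e3]
  exact hs.hasSum

/-! ### Polar coordinates and the operator `J` -/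

theorem lintegral_polar {d : ℕ} (hd : 1 ≤ d) {F : Space d → ℝ≥0∞} (hF : Measurable F) :
    ∫⁻ x, F x = ∫⁻ r in Ioi (0 : ℝ), ENNReal.ofReal (r ^ (d - 1)) *
      ∫⁻ s, F (r • (s : Space d)) ∂(surface d) := by
  have : Nonempty (Fin d) := ⟨⟨0, hd⟩⟩
  have hpres := (volume : Measure (Space d)).measurePreserving_homeomorphUnitSphereProd
  have hc : MeasurableSet ({0}ᶜ : Set (Space d)) := (measurableSet_singleton _).compl
  have h1 : ∫⁻ x, F x = ∫⁻ x : ({0}ᶜ : Set (Space d)), F x ∂(volume.comap Subtype.val) := by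
    rw [lintegral_subtype_comap hc, restrict_compl_singleton]
  have hm : Measurable fun p : Sphere d × Ioi (0 : ℝ) => F ((p.2 : ℝ) • (p.1 : Space d)) := by
    fun_prop
  rw [h1]
  have h2 : ∀ x : ({0}ᶜ : Set (Space d)), F x =
      (fun p : Sphere d × Ioi (0 : ℝ) => F ((p.2 : ℝ) • (p.1 : Space d)))
        (homeomorphUnitSphereProd (Space d) x) := by
    intro x
    simp only [homeomorphUnitSphereProd_apply_snd_coe, homeomorphUnitSphereProd_apply_fst_coe]
    rw [smul_inv_smul₀ (norm_ne_zero_iff.2 x.2)]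
  simp_rw [h2]
  rw [hpres.lintegral_comp hm, lintegral_prod_symm' _ hm, finrank_euclideanSpace_fin]
  simp only
  have hm2 : Measurable fun r : Ioi (0 : ℝ) => ∫⁻ s, F ((r : ℝ) • (s : Space d)) ∂(surface d) :=
    hm.lintegral_prod_left'
  rw [Measure.volumeIoiPow, lintegral_withDensity_eq_lintegral_mul _ (by fun_prop) hm2]
  simp only [Pi.mul_apply]
  rw [lintegral_subtype_comap measurableSet_Ioi (fun r : ℝ => ENNReal.ofReal (r ^ (d - 1)) *
    ∫⁻ s, F (r • (s : Space d)) ∂(surface d))]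

/-- The factor in the polar coordinates `(ω, s) ↦ √ω s`. -/
def polarWeight (d : ℕ) (ω : ℝ) : ℝ := ω ^ (((d : ℝ) - 2) / 4) / Real.sqrt 2

theorem measurable_polarWeight (d : ℕ) : Measurable (polarWeight d) := by
  unfold polarWeight; fun_prop

theorem polarWeight_pos (d : ℕ) {ω : ℝ} (hω : 0 < ω) : 0 < polarWeight d ω :=
  div_pos (Real.rpow_pos_of_pos hω _) (Real.sqrt_pos.2 two_pos)

/-- The weight in `J` is the square root of the Jacobian of `(ω, s) ↦ √ω s`: one factor comes from
`r = √ω`, the other from `r^{d-1}`. This makes `J` isometric. -/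
theorem polarWeight_sq {d : ℕ} (hd : 1 ≤ d) {ω : ℝ} (hω : 0 < ω) :
    polarWeight d ω ^ 2 = 1 / (2 * Real.sqrt ω) * Real.sqrt ω ^ (d - 1) := by
  rw [polarWeight, div_pow, Real.sq_sqrt zero_le_two, ← Real.rpow_natCast, ← Real.rpow_mul hω.le,
    Real.sqrt_eq_rpow, ← Real.rpow_natCast (ω ^ _), ← Real.rpow_mul hω.le, Nat.cast_sub hd]
  have : ((d : ℝ) - 2) / 4 * (2 : ℕ) = 1 / 2 * ((d : ℝ) - (1 : ℕ)) - 1 / 2 := by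
    push_cast; ring
  rw [this, Real.rpow_sub hω]
  field_simp

theorem lintegral_comp_sqrt (F : ℝ → ℝ≥0∞) :
    ∫⁻ r in Ioi (0 : ℝ), F r =
      ∫⁻ ω in Ioi (0 : ℝ), ENNReal.ofReal (1 / (2 * Real.sqrt ω)) * F (Real.sqrt ω) := by
  have himg : Real.sqrt '' Ioi 0 = Ioi 0 := by
    ext x
    constructor
    · rintro ⟨y, hy, rfl⟩
      exact Real.sqrt_pos.2 hy
    · intro hx
      exact ⟨x ^ 2, mem_Ioi.2 (pow_pos (mem_Ioi.1 hx) 2), Real.sqrt_sq (le_of_lt hx)⟩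
  have h := lintegral_image_eq_lintegral_abs_deriv_mul (s := Ioi 0) (f := Real.sqrt)
    (f' := fun ω => 1 / (2 * Real.sqrt ω)) measurableSet_Ioi
    (fun x hx => (Real.hasDerivAt_sqrt (ne_of_gt hx)).hasDerivWithinAt)
    (fun x hx y hy h => (Real.sqrt_inj (le_of_lt hx) (le_of_lt hy)).1 h) F
  rw [himg] at h
  rw [h]
  refine setLIntegral_congr_fun measurableSet_Ioi fun ω hω => ?_
  rw [abs_of_pos (div_pos one_pos (mul_pos two_pos (Real.sqrt_pos.2 hω)))]

/-- The measure `dω ds` on `ℝ_+ × S^{d-1}`. -/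
abbrev polarMeasure (d : ℕ) : Measure (ℝ × Sphere d) :=
  (volume.restrict (Ioi (0 : ℝ))).prod (surface d)

/-- The polar coordinates `(ω, s) ↦ √ω s`. -/
def polarMap (d : ℕ) (p : ℝ × Sphere d) : Space d := Real.sqrt p.1 • (p.2 : Space d)

theorem measurable_polarMap (d : ℕ) : Measurable (polarMap d) := by
  unfold polarMap; fun_prop

theorem lintegral_polarMap {d : ℕ} (hd : 1 ≤ d) {F : Space d → ℝ≥0∞} (hF : Measurable F) :
    ∫⁻ x, F x =
      ∫⁻ p, ENNReal.ofReal (polarWeight d p.1 ^ 2) * F (polarMap d p) ∂(polarMeasure d) := by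
  have hw := measurable_polarWeight d
  have hm := measurable_polarMap d
  rw [lintegral_polar hd hF, lintegral_comp_sqrt, lintegral_prod _ (by fun_prop)]
  refine setLIntegral_congr_fun measurableSet_Ioi fun ω hω => ?_
  simp only
  rw [lintegral_const_mul _ (by fun_prop), polarWeight_sq hd hω,
    ENNReal.ofReal_mul (by positivity), mul_assoc]
  rfl

/-- The density of Lebesgue measure in polar coordinates. -/
def polarDensity (d : ℕ) (p : ℝ × Sphere d) : ℝ≥0∞ := ENNReal.ofReal (polarWeight d p.1 ^ 2)

theorem measurable_polarDensity (d : ℕ) : Measurable (polarDensity d) := by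
  have := measurable_polarWeight d
  unfold polarDensity; fun_prop

theorem measurePreserving_polarMap {d : ℕ} (hd : 1 ≤ d) :
    MeasurePreserving (polarMap d) ((polarMeasure d).withDensity (polarDensity d)) volume := by
  refine ⟨measurable_polarMap d, Measure.ext fun s hs => ?_⟩
  rw [Measure.map_apply (measurable_polarMap d) hs, ← lintegral_indicator_one
    (measurable_polarMap d hs), ← lintegral_indicator_one hs,
    lintegral_polarMap hd (measurable_one.indicator hs),
    lintegral_withDensity_eq_lintegral_mul _ (measurable_polarDensity d)
      (measurable_one.indicator (measurable_polarMap d hs))]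
  rfl

theorem ae_polarMeasure_pos (d : ℕ) : ∀ᵐ p ∂(polarMeasure d), 0 < p.1 :=
  Measure.quasiMeasurePreserving_fst.ae (ae_restrict_mem measurableSet_Ioi)

/-- The density is positive almost everywhere, so almost-everywhere statements on `ℝ^d` pull back to
`dω ds` itself. -/
theorem polarMeasure_absolutelyContinuous (d : ℕ) :
    polarMeasure d ≪ (polarMeasure d).withDensity (polarDensity d) := by
  refine withDensity_absolutelyContinuous' (measurable_polarDensity d).aemeasurable ?_
  filter_upwards [ae_polarMeasure_pos d] with p hp
  exact (ENNReal.ofReal_pos.2 (pow_pos (polarWeight_pos d hp) 2)).ne'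

theorem quasiMeasurePreserving_polarMap {d : ℕ} (hd : 1 ≤ d) :
    Measure.QuasiMeasurePreserving (polarMap d) (polarMeasure d) volume :=
  (measurePreserving_polarMap hd).quasiMeasurePreserving.mono_left
    (polarMeasure_absolutelyContinuous d)

theorem aestronglyMeasurable_polar {d : ℕ} (hd : 1 ≤ d) (g : L2Space d) :
    AEStronglyMeasurable (fun p : ℝ × Sphere d => polar g p.1 p.2) (polarMeasure d) := by
  have h1 := (Lp.aestronglyMeasurable g).comp_quasiMeasurePreserving
    (quasiMeasurePreserving_polarMap hd)
  have h2 : AEStronglyMeasurable (fun p : ℝ × Sphere d => (polarWeight d p.1 : ℂ))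
      (polarMeasure d) := by
    have := measurable_polarWeight d
    exact Measurable.aestronglyMeasurable (by fun_prop)
  exact h2.mul h1

theorem lintegral_polarMap_ae {d : ℕ} (hd : 1 ≤ d) {F : Space d → ℝ≥0∞} (hF : AEMeasurable F) :
    ∫⁻ x, F x =
      ∫⁻ p, ENNReal.ofReal (polarWeight d p.1 ^ 2) * F (polarMap d p) ∂(polarMeasure d) := by
  rw [lintegral_congr_ae hF.ae_eq_mk, lintegral_polarMap hd hF.measurable_mk]
  refine lintegral_congr_ae ?_
  filter_upwards [(quasiMeasurePreserving_polarMap hd).ae hF.ae_eq_mk] with p hp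
  rw [hp]

theorem lintegral_enorm_polar {d : ℕ} (hd : 1 ≤ d) (g : L2Space d) :
    ∫⁻ p, ‖polar g p.1 p.2‖ₑ ^ 2 ∂(polarMeasure d) = ∫⁻ x, ‖g x‖ₑ ^ 2 := by
  rw [lintegral_polarMap_ae hd ((Lp.aestronglyMeasurable g).enorm.pow_const 2)]
  refine lintegral_congr_ae ?_
  filter_upwards [ae_polarMeasure_pos d] with p hp
  have : ‖polar g p.1 p.2‖ₑ = ENNReal.ofReal (polarWeight d p.1) * ‖g (polarMap d p)‖ₑ := by
    rw [polar, enorm_mul, ← ofReal_norm, Complex.norm_real, Real.norm_eq_abs]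
    congr 2
    exact abs_of_pos (polarWeight_pos d hp)
  rw [this, mul_pow, ENNReal.ofReal_pow (polarWeight_pos d hp).le]

theorem memLp_two_iff_lintegral {α : Type*} [MeasurableSpace α] {μ : Measure α} {f : α → ℂ} :
    MemLp f 2 μ ↔ AEStronglyMeasurable f μ ∧ ∫⁻ x, ‖f x‖ₑ ^ 2 ∂μ < ∞ := by
  rw [MemLp, eLpNorm_lt_top_iff_lintegral_rpow_enorm_lt_top two_ne_zero ENNReal.ofNat_ne_top]
  simp

theorem enorm_sq_eq_lintegral {α : Type*} [MeasurableSpace α] {μ : Measure α} (f : Lp ℂ 2 μ) :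
    ‖f‖ₑ ^ 2 = ∫⁻ x, ‖f x‖ₑ ^ 2 ∂μ := by
  rw [Lp.enorm_def, eLpNorm_eq_lintegral_rpow_enorm_toReal two_ne_zero ENNReal.ofNat_ne_top]
  rw [← ENNReal.rpow_natCast, ← ENNReal.rpow_mul]
  simp

theorem memLp_polar {d : ℕ} (hd : 1 ≤ d) (g : L2Space d) :
    MemLp (fun p : ℝ × Sphere d => polar g p.1 p.2) 2 (polarMeasure d) := by
  refine memLp_two_iff_lintegral.2 ⟨aestronglyMeasurable_polar hd g, ?_⟩
  rw [lintegral_enorm_polar hd]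
  exact (memLp_two_iff_lintegral.1 (Lp.memLp g)).2

/-- The operator `J` preserves inner products. -/
theorem integral_conj_polar_mul_polar {d : ℕ} (hd : 1 ≤ d) (f g : L2Space d) :
    ∫ p, conj (polar f p.1 p.2) * polar g p.1 p.2 ∂(polarMeasure d) = inner ℂ f g := by
  have hpres := measurePreserving_polarMap hd
  have hm : AEStronglyMeasurable (fun x => inner ℂ (f x) (g x)) volume :=
    (L2.integrable_inner f g).aestronglyMeasurable
  have hlt : ∀ᵐ p ∂(polarMeasure d), polarDensity d p < ∞ :=
    Filter.Eventually.of_forall fun p => ENNReal.ofReal_lt_top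
  have hmap : ∫ x, inner ℂ (f x) (g x) = ∫ p, inner ℂ (f (polarMap d p)) (g (polarMap d p))
      ∂((polarMeasure d).withDensity (polarDensity d)) := by
    rw [← integral_map (f := fun x => inner ℂ (f x) (g x)) hpres.aemeasurable
      (by rwa [hpres.map_eq]), hpres.map_eq]
  rw [L2.inner_def, hmap,
    integral_withDensity_eq_integral_toReal_smul (measurable_polarDensity d) hlt]
  refine integral_congr_ae (Filter.Eventually.of_forall fun p => ?_)
  simp only [polarDensity, RCLike.inner_apply, polar, map_mul, Complex.conj_ofReal]
  rw [ENNReal.toReal_ofReal (sq_nonneg _), Complex.real_smul, polarMap]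
  simp only [polarWeight]
  push_cast
  ring

theorem ae_memLp_polar {d : ℕ} (hd : 1 ≤ d) (g : L2Space d) :
    ∀ᵐ ω ∂(volume.restrict (Ioi (0 : ℝ))), MemLp (polar g ω) 2 (surface d) := by
  have h1 := aestronglyMeasurable_polar hd g
  have h2 := (memLp_two_iff_lintegral.1 (memLp_polar hd g)).2
  have h3 : AEMeasurable (fun p : ℝ × Sphere d => ‖polar g p.1 p.2‖ₑ ^ 2) (polarMeasure d) :=
    h1.enorm.pow_const 2
  rw [lintegral_prod _ h3] at h2
  filter_upwards [h1.prodMk_left, ae_lt_top' h3.lintegral_prod_right' h2.ne] with ω ha hb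
  exact memLp_two_iff_lintegral.2 ⟨ha, hb⟩

theorem lintegral_enorm_sphereClass {d : ℕ} (hd : 1 ≤ d) (g : L2Space d) :
    ∫⁻ ω in Ioi (0 : ℝ), ‖sphereClass (polar g ω)‖ₑ ^ 2 = ‖g‖ₑ ^ 2 := by
  have h3 : AEMeasurable (fun p : ℝ × Sphere d => ‖polar g p.1 p.2‖ₑ ^ 2) (polarMeasure d) :=
    (aestronglyMeasurable_polar hd g).enorm.pow_const 2
  rw [enorm_sq_eq_lintegral g, ← lintegral_enorm_polar hd, lintegral_prod _ h3]
  refine lintegral_congr_ae ?_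
  filter_upwards [ae_memLp_polar hd g] with ω hω
  rw [sphereClass, dif_pos hω, enorm_sq_eq_lintegral]
  refine lintegral_congr_ae ?_
  filter_upwards [hω.coeFn_toLp] with s hs
  rw [hs]

/-! ### Slices, lifts and test functions -/

/-- The coefficient of the slices of `J g` along `Y ∈ L²(S^{d-1})`. -/
def sliceCoeff {d : ℕ} (g : L2Space d) (Y : L2Sphere d) (ω : ℝ) : ℂ :=
  inner ℂ Y (sphereClass (polar g ω))

theorem sliceCoeff_ae_eq {d : ℕ} (hd : 1 ≤ d) (g : L2Space d) (Y : L2Sphere d) :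
    ∀ᵐ ω ∂(volume.restrict (Ioi (0 : ℝ))),
      sliceCoeff g Y ω = ∫ s, conj (Y s) * polar g ω s ∂(surface d) := by
  filter_upwards [ae_memLp_polar hd g] with ω hω
  rw [sliceCoeff, L2.inner_def, sphereClass, dif_pos hω]
  refine integral_congr_ae ?_
  filter_upwards [hω.coeFn_toLp] with s hs
  rw [hs, RCLike.inner_apply, mul_comm]

theorem memLp_sliceCoeff {d : ℕ} (hd : 1 ≤ d) (g : L2Space d) (Y : L2Sphere d) :
    MemLp (sliceCoeff g Y) 2 (volume.restrict (Ioi (0 : ℝ))) := by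
  have hm : AEStronglyMeasurable (fun p : ℝ × Sphere d => conj (Y p.2) * polar g p.1 p.2)
      (polarMeasure d) := by
    refine AEStronglyMeasurable.mul ?_ (aestronglyMeasurable_polar hd g)
    exact Complex.continuous_conj.comp_aestronglyMeasurable
      ((Lp.aestronglyMeasurable Y).comp_quasiMeasurePreserving
        Measure.quasiMeasurePreserving_snd)
  refine memLp_two_iff_lintegral.2 ⟨?_, ?_⟩
  · exact hm.integral_prod_right'.congr
      (Filter.EventuallyEq.symm (sliceCoeff_ae_eq hd g Y))
  · have hle : ∀ ω, ‖sliceCoeff g Y ω‖ₑ ^ 2 ≤ ‖Y‖ₑ ^ 2 * ‖sphereClass (polar g ω)‖ₑ ^ 2 := by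
      intro ω
      rw [← mul_pow]
      gcongr
      rw [← ofReal_norm, ← ofReal_norm, ← ofReal_norm, ← ENNReal.ofReal_mul (norm_nonneg _)]
      exact ENNReal.ofReal_le_ofReal (norm_inner_le_norm _ _)
    refine (lintegral_mono hle).trans_lt ?_
    rw [lintegral_const_mul' _ _ (by finiteness), lintegral_enorm_sphereClass hd]
    finiteness

/-- The function on `ℝ^d` whose image under `J` is `h ⊗ Y`. -/
def liftFun {d : ℕ} (h : ℝ → ℂ) (Y : Sphere d → ℂ) (x : Space d) : ℂ :=
  ((polarWeight d (‖x‖ ^ 2) : ℂ))⁻¹ * h (‖x‖ ^ 2) *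
    -- The default value `0` is used only at the origin, the one point whose normalization is off
    -- the sphere.
    Function.extend ((↑) : Sphere d → Space d) Y 0 (‖x‖⁻¹ • x)

theorem measurable_liftFun {d : ℕ} {h : ℝ → ℂ} {Y : Sphere d → ℂ} (hh : Measurable h)
    (hY : Measurable Y) : Measurable (liftFun h Y) := by
  have h1 : Measurable (Function.extend ((↑) : Sphere d → Space d) Y 0) :=
    (MeasurableEmbedding.subtype_coe Metric.isClosed_sphere.measurableSet).measurable_extend hY
      measurable_const
  have h2 := measurable_polarWeight d
  unfold liftFun
  fun_prop

theorem liftFun_polarMap {d : ℕ} (h : ℝ → ℂ) (Y : Sphere d → ℂ) {p : ℝ × Sphere d}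
    (hp : 0 < p.1) : liftFun h Y (polarMap d p) = (polarWeight d p.1 : ℂ)⁻¹ * h p.1 * Y p.2 := by
  have hs : ‖(p.2 : Space d)‖ = 1 := mem_sphere_zero_iff_norm.1 p.2.2
  have hsq := Real.sqrt_pos.2 hp
  have hn : ‖polarMap d p‖ = Real.sqrt p.1 := by
    rw [polarMap, norm_smul, hs, mul_one, Real.norm_eq_abs, abs_of_pos hsq]
  rw [liftFun, hn, Real.sq_sqrt hp.le, polarMap, inv_smul_smul₀ hsq.ne',
    Subtype.val_injective.extend_apply]

theorem memLp_liftFun {d : ℕ} (hd : 1 ≤ d) (h : L2Pos) (Y : L2Sphere d) :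
    MemLp (liftFun h Y) 2 (volume : Measure (Space d)) := by
  have hm : Measurable (liftFun h Y) := measurable_liftFun (Lp.stronglyMeasurable h).measurable
    (Lp.stronglyMeasurable Y).measurable
  refine memLp_two_iff_lintegral.2 ⟨hm.aestronglyMeasurable, ?_⟩
  rw [lintegral_polarMap hd (by fun_prop)]
  have h1 : ∫⁻ p, ENNReal.ofReal (polarWeight d p.1 ^ 2) * ‖liftFun h Y (polarMap d p)‖ₑ ^ 2
      ∂(polarMeasure d) = ∫⁻ p, ‖h p.1‖ₑ ^ 2 * ‖Y p.2‖ₑ ^ 2 ∂(polarMeasure d) := by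
    refine lintegral_congr_ae ?_
    filter_upwards [ae_polarMeasure_pos d] with p hp
    have hc := polarWeight_pos d hp
    rw [liftFun_polarMap _ _ hp, enorm_mul, enorm_mul, mul_pow, mul_pow, ← mul_assoc, ← mul_assoc,
      ← Complex.ofReal_inv, ← ofReal_norm (((polarWeight d p.1)⁻¹ : ℝ) : ℂ), Complex.norm_real,
      Real.norm_eq_abs, abs_of_pos (inv_pos.2 hc), ← ENNReal.ofReal_pow (inv_pos.2 hc).le,
      ← ENNReal.ofReal_mul (by positivity), ← mul_pow, mul_inv_cancel₀ hc.ne']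
    simp
  have hhm := (Lp.stronglyMeasurable h).measurable
  have hYm := (Lp.stronglyMeasurable Y).measurable
  rw [h1, polarMeasure, lintegral_prod_mul (f := fun ω => ‖h ω‖ₑ ^ 2) (g := fun s => ‖Y s‖ₑ ^ 2)
    (by fun_prop) (by fun_prop)]
  exact ENNReal.mul_lt_top (memLp_two_iff_lintegral.1 (Lp.memLp h)).2
    (memLp_two_iff_lintegral.1 (Lp.memLp Y)).2

/-- The element of `L²(ℝ^d)` whose image under `J` is `h ⊗ Y`. -/
def sphericalLift {d : ℕ} (hd : 1 ≤ d) (h : L2Pos) (Y : L2Sphere d) : L2Space d :=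
  (memLp_liftFun hd h Y).toLp _

theorem polar_sphericalLift {d : ℕ} (hd : 1 ≤ d) (h : L2Pos) (Y : L2Sphere d) :
    ∀ᵐ p ∂(polarMeasure d), polar (sphericalLift hd h Y) p.1 p.2 = h p.1 * Y p.2 := by
  filter_upwards [(quasiMeasurePreserving_polarMap hd).ae (memLp_liftFun hd h Y).coeFn_toLp,
    ae_polarMeasure_pos d] with p hp1 hp
  have hc : (polarWeight d p.1 : ℂ) ≠ 0 := Complex.ofReal_ne_zero.2 (polarWeight_pos d hp).ne'
  have : polar (sphericalLift hd h Y) p.1 p.2 =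
      (polarWeight d p.1 : ℂ) * sphericalLift hd h Y (polarMap d p) := rfl
  rw [this, sphericalLift, hp1, liftFun_polarMap _ _ hp]
  field_simp

/-- Fubini: taking the slice coefficient along `Y` is adjoint to `h ↦ h ⊗ Y`. Slices can thus be
identified weakly, through inner products in `L²(ℝ^d)`. -/
theorem inner_sphericalLift {d : ℕ} (hd : 1 ≤ d) (h : L2Pos) (Y : L2Sphere d) (g : L2Space d) :
    inner ℂ (sphericalLift hd h Y) g =
      ∫ ω in Ioi (0 : ℝ), conj (h ω) * sliceCoeff g Y ω := by
  have hint : Integrable (fun p : ℝ × Sphere d =>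
      conj (polar (sphericalLift hd h Y) p.1 p.2) * polar g p.1 p.2) (polarMeasure d) :=
    (memLp_polar hd (sphericalLift hd h Y)).star.integrable_mul (memLp_polar hd g)
  have hae : (fun p : ℝ × Sphere d =>
      conj (polar (sphericalLift hd h Y) p.1 p.2) * polar g p.1 p.2) =ᵐ[polarMeasure d]
      fun p => conj (h p.1) * (conj (Y p.2) * polar g p.1 p.2) := by
    filter_upwards [polar_sphericalLift hd h Y] with p hp
    rw [hp, map_mul, mul_assoc]
  rw [← integral_conj_polar_mul_polar hd, integral_congr_ae hae,
    integral_prod _ (hint.congr hae)]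
  refine integral_congr_ae ?_
  filter_upwards [sliceCoeff_ae_eq hd g Y] with ω hω
  rw [integral_const_mul, hω]

theorem inner_sphericalLift_sphericalLift {d : ℕ} (hd : 1 ≤ d) (h h' : L2Pos)
    (Y Y' : L2Sphere d) :
    inner ℂ (sphericalLift hd h Y) (sphericalLift hd h' Y') = inner ℂ h h' * inner ℂ Y Y' := by
  rw [← integral_conj_polar_mul_polar hd, L2.inner_def, L2.inner_def, ← integral_prod_mul]
  refine integral_congr_ae ?_
  filter_upwards [polar_sphericalLift hd h Y, polar_sphericalLift hd h' Y'] with p hp hp'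
  rw [hp, hp', map_mul, RCLike.inner_apply, RCLike.inner_apply]
  ring

/-- Countability of the total family gives one null set outside which every coefficient of the slice
vanishes. -/
theorem eq_zero_of_sliceCoeff {d : ℕ} (hd : 1 ≤ d) {ι : Type*} [Countable ι]
    (Y : ι → L2Sphere d) (hY : ∀ v, (∀ i, inner ℂ (Y i) v = 0) → v = 0) (g : L2Space d)
    (hg : ∀ i, ∀ᵐ ω ∂(volume.restrict (Ioi (0 : ℝ))), sliceCoeff g (Y i) ω = 0) : g = 0 := by
  have h1 : ∀ᵐ ω ∂(volume.restrict (Ioi (0 : ℝ))), sphereClass (polar g ω) = 0 := by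
    filter_upwards [ae_all_iff.2 hg] with ω hω
    exact hY _ hω
  have h2 := lintegral_enorm_sphereClass hd g
  rw [lintegral_congr_ae (g := fun _ => 0) (by
    filter_upwards [h1] with ω hω
    simp [hω])] at h2
  simpa using h2.symm

theorem volume_dyadicBlock_ne_top (M : ℕ) : volume (dyadicBlock M) ≠ ∞ := by
  rw [dyadicBlock]; simp

theorem iUnion_dyadicBlock : ⋃ M, dyadicBlock M = Ioi 0 := by
  ext x
  simp only [mem_iUnion, mem_Ioi]
  constructor
  · rintro ⟨M, hM⟩
    exact pos_of_mem_dyadicBlock hM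
  · intro hx
    obtain ⟨n, hn1, hn2⟩ := exists_mem_Ico_zpow hx (one_lt_two (α := ℝ))
    refine ⟨(|n| + 1).toNat, ?_, ?_⟩
    · refine le_trans (zpow_le_zpow_right₀ one_le_two ?_) hn1
      have := neg_abs_le n; omega
    · refine hn2.le.trans (zpow_le_zpow_right₀ one_le_two ?_)
      have := le_abs_self n; omega

theorem volume_restrict_ne_top {M : ℕ} {A : Set ℝ} (hA : A ⊆ dyadicBlock M) :
    volume.restrict (Ioi (0 : ℝ)) A ≠ ∞ :=
  ne_top_of_le_ne_top (volume_dyadicBlock_ne_top M)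
    ((Measure.restrict_apply_le _ _).trans (measure_mono hA))

/-- The indicator function of a subset of `[2^{-M}, 2^M]`, as an element of `L²(ℝ_+)`. -/
def indicatorPos {M : ℕ} {A : Set ℝ} (hAm : MeasurableSet A) (hA : A ⊆ dyadicBlock M) : L2Pos :=
  indicatorConstLp 2 hAm (volume_restrict_ne_top hA) 1

theorem inner_indicatorPos {M M' : ℕ} {A B : Set ℝ} (hAm : MeasurableSet A)
    (hA : A ⊆ dyadicBlock M) (hBm : MeasurableSet B) (hB : B ⊆ dyadicBlock M') :
    inner ℂ (indicatorPos hAm hA) (indicatorPos hBm hB) = (volume.real (A ∩ B) : ℂ) := by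
  rw [indicatorPos, indicatorPos, L2.inner_indicatorConstLp_indicatorConstLp hAm hBm
      (volume_restrict_ne_top hA) (volume_restrict_ne_top hB),
    measureReal_restrict_apply (hAm.inter hBm), inter_eq_left.2]
  · simp
  · exact fun x hx => pos_of_mem_dyadicBlock (hA hx.1)

theorem inner_sphericalLift_indicatorPos {d : ℕ} (hd : 1 ≤ d) {M : ℕ} {A : Set ℝ}
    (hAm : MeasurableSet A) (hA : A ⊆ dyadicBlock M) (Y : L2Sphere d) (g : L2Space d) :
    inner ℂ (sphericalLift hd (indicatorPos hAm hA) Y) g = ∫ ω in A, sliceCoeff g Y ω := by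
  have hsub : A ⊆ Ioi 0 := fun x hx => pos_of_mem_dyadicBlock (hA hx)
  rw [inner_sphericalLift]
  have : (fun ω => conj (indicatorPos hAm hA ω) * sliceCoeff g Y ω)
      =ᵐ[volume.restrict (Ioi (0 : ℝ))] A.indicator (sliceCoeff g Y) := by
    filter_upwards [indicatorConstLp_coeFn (p := 2) (hs := hAm)
      (hμs := volume_restrict_ne_top hA) (c := (1 : ℂ))] with ω hω
    rw [indicatorPos, hω]
    by_cases h : ω ∈ A <;> simp [h]
  rw [integral_congr_ae this, integral_indicator hAm, Measure.restrict_restrict hAm,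
    inter_eq_left.2 hsub]

/-- On a block of finite measure the slice coefficient is integrable, and the hypothesis says that
its integral over every measurable subset is zero. The blocks exhaust `(0, ∞)`. -/
theorem sliceCoeff_eq_zero_of_inner {d : ℕ} (hd : 1 ≤ d) (Y : L2Sphere d) (g : L2Space d)
    (h : ∀ (M : ℕ) (A : Set ℝ) (hAm : MeasurableSet A) (hA : A ⊆ dyadicBlock M),
      inner ℂ (sphericalLift hd (indicatorPos hAm hA) Y) g = 0) :
    ∀ᵐ ω ∂(volume.restrict (Ioi (0 : ℝ))), sliceCoeff g Y ω = 0 := by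
  rw [← iUnion_dyadicBlock, ae_restrict_iUnion_iff]
  intro M
  have hsub : dyadicBlock M ⊆ Ioi 0 := fun x hx => pos_of_mem_dyadicBlock hx
  have hL : MemLp (sliceCoeff g Y) 2 (volume.restrict (dyadicBlock M)) :=
    (memLp_sliceCoeff hd g Y).mono_measure (Measure.restrict_mono hsub le_rfl)
  have : IsFiniteMeasure (volume.restrict (dyadicBlock M)) :=
    ⟨by rw [Measure.restrict_apply_univ]; exact (volume_dyadicBlock_ne_top M).lt_top⟩
  refine (hL.integrable one_le_two).ae_eq_zero_of_forall_setIntegral_eq_zero fun s hs _ => ?_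
  rw [Measure.restrict_restrict hs, ← inner_sphericalLift_indicatorPos hd
    (hs.inter (measurableSet_dyadicBlock M)) inter_subset_right]
  exact h M _ _ _

/-! ### The Schrödinger representation on slices -/

theorem map_dilate {d : ℕ} {c : ℝ} (hc : 0 < c) (R : SO d) :
    Measure.map (fun x : Space d => c • (rotation R).symm x) volume =
      ENNReal.ofReal (c ^ d)⁻¹ • (volume : Measure (Space d)) := by
  have h1 : Measure.map (fun x : Space d => c • (rotation R).symm x) volume =
      Measure.map (fun x : Space d => c • x)
        (Measure.map (rotation R).symm (volume : Measure (Space d))) :=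
    (Measure.map_map (by fun_prop) (by fun_prop)).symm
  rw [h1, (rotation R).symm.measurePreserving.map_eq, Measure.map_addHaar_smul volume hc.ne',
    finrank_euclideanSpace_fin, abs_of_pos (by positivity)]

theorem quasiMeasurePreserving_dilate {d : ℕ} {c : ℝ} (hc : 0 < c) (R : SO d) :
    Measure.QuasiMeasurePreserving (fun x : Space d => c • (rotation R).symm x) volume volume :=
  ⟨by fun_prop, by rw [map_dilate hc]; exact Measure.smul_absolutelyContinuous⟩

theorem dilation_coeFn {d : ℕ} {a : ℝ} (ha : 0 < a) (R : SO d) (f : L2Space d) :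
    ∀ᵐ x, dilation a ha R f x = ((a ^ (-(d : ℝ) / 4) : ℝ) : ℂ) *
      f ((a ^ (-1 / 2 : ℝ)) • (rotation R).symm x) := by
  have h := memLp_dilate (Real.rpow_pos_of_pos ha (-1 / 2)) R f
  filter_upwards [Lp.coeFn_smul ((a ^ (-(d : ℝ) / 4) : ℝ) : ℂ) (h.toLp _), h.coeFn_toLp]
    with x h1 h2
  rw [dilation, h1, Pi.smul_apply, h2, smul_eq_mul]

theorem rpow_neg_half_pow {d : ℕ} {a : ℝ} (ha : 0 < a) :
    ((a ^ (-1 / 2 : ℝ)) ^ d)⁻¹ = a ^ ((d : ℝ) / 2) := by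
  rw [← Real.rpow_natCast, ← Real.rpow_mul ha.le, ← Real.rpow_neg ha.le]
  congr 1; ring

theorem enorm_dilation {d : ℕ} {a : ℝ} (ha : 0 < a) (R : SO d) (f : L2Space d) :
    ‖dilation a ha R f‖ₑ ^ 2 = ‖f‖ₑ ^ 2 := by
  have hc := Real.rpow_pos_of_pos ha (-1 / 2)
  rw [enorm_sq_eq_lintegral, enorm_sq_eq_lintegral]
  have h1 : ∫⁻ x, ‖dilation a ha R f x‖ₑ ^ 2 = ∫⁻ x : Space d,
      ENNReal.ofReal (a ^ (-(d : ℝ) / 4)) ^ 2 *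
        ‖f ((a ^ (-1 / 2 : ℝ)) • (rotation R).symm x)‖ₑ ^ 2 := by
    refine lintegral_congr_ae ?_
    filter_upwards [dilation_coeFn ha R f] with x hx
    rw [hx, enorm_mul, mul_pow, ← ofReal_norm ((a ^ (-(d : ℝ) / 4) : ℝ) : ℂ), Complex.norm_real,
      Real.norm_eq_abs, abs_of_pos (Real.rpow_pos_of_pos ha _)]
  have h2 : ∫⁻ x : Space d, ‖f ((a ^ (-1 / 2 : ℝ)) • (rotation R).symm x)‖ₑ ^ 2 =
      ENNReal.ofReal (a ^ ((d : ℝ) / 2)) * ∫⁻ x, ‖f x‖ₑ ^ 2 := by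
    have hm := (Lp.stronglyMeasurable f).measurable
    rw [← lintegral_map (f := fun x => ‖f x‖ₑ ^ 2) (by fun_prop) (by fun_prop), map_dilate hc,
      lintegral_smul_measure, rpow_neg_half_pow ha, smul_eq_mul]
  rw [h1, lintegral_const_mul' _ _ (by finiteness), h2, ← mul_assoc,
    ← ENNReal.ofReal_pow (by positivity), ← ENNReal.ofReal_mul (by positivity),
    ← Real.rpow_natCast, ← Real.rpow_mul ha.le, ← Real.rpow_add ha]
  have : -(d : ℝ) / 4 * (2 : ℕ) + d / 2 = 0 := by push_cast; ring
  rw [this, Real.rpow_zero, ENNReal.ofReal_one, one_mul]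

theorem dilation_sub {d : ℕ} {a : ℝ} (ha : 0 < a) (R : SO d) (f g : L2Space d) :
    dilation a ha R (f - g) = dilation a ha R f - dilation a ha R g := by
  have hq := quasiMeasurePreserving_dilate (Real.rpow_pos_of_pos ha (-1 / 2)) R
  refine Lp.ext ?_
  filter_upwards [dilation_coeFn ha R (f - g), dilation_coeFn ha R f, dilation_coeFn ha R g,
    Lp.coeFn_sub (dilation a ha R f) (dilation a ha R g), hq.ae (Lp.coeFn_sub f g)]
    with x h1 h2 h3 h4 h5
  rw [h1, h4, Pi.sub_apply, h2, h3, h5, Pi.sub_apply, mul_sub]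

theorem isometry_dilation {d : ℕ} {a : ℝ} (ha : 0 < a) (R : SO d) :
    Isometry (dilation (d := d) a ha R) := by
  refine Isometry.of_dist_eq fun f g => ?_
  rw [dist_eq_norm, dist_eq_norm, ← dilation_sub]
  have h := enorm_dilation ha R (f - g)
  rw [← ofReal_norm, ← ofReal_norm, ← ENNReal.ofReal_pow (norm_nonneg _),
    ← ENNReal.ofReal_pow (norm_nonneg _),
    ENNReal.ofReal_eq_ofReal_iff (by positivity) (by positivity)] at h
  exact (pow_left_inj₀ (norm_nonneg _) (norm_nonneg _) two_ne_zero).1 h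

/-- The linear map `x ↦ c R⁻¹ x`. -/
def dilateEquiv {d : ℕ} {c : ℝ} (hc : 0 < c) (R : SO d) : Space d ≃L[ℝ] Space d :=
  (rotation R).symm.toContinuousLinearEquiv.trans
    (LinearEquiv.smulOfNeZero ℝ (Space d) c hc.ne').toContinuousLinearEquiv

theorem fourier_comp_dilate {d : ℕ} {c : ℝ} (hc : 0 < c) (R : SO d) (f : Space d → ℂ)
    (ξ : Space d) : 𝓕 (fun x => f (c • (rotation R).symm x)) ξ =
      ((c ^ d)⁻¹ : ℝ) • 𝓕 f (c⁻¹ • (rotation R).symm ξ) := by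
  have h1 : 𝓕 (fun x => f (c • (rotation R).symm x)) ξ =
      𝓕 (fun x => f (c • x)) ((rotation R).symm ξ) :=
    Real.fourier_comp_linearIsometry (rotation R).symm (fun x => f (c • x)) ξ
  rw [h1, Real.fourier_eq, Real.fourier_eq]
  have h2 := Measure.integral_comp_smul (volume : Measure (Space d))
    (fun v => Real.fourierChar (-inner ℝ v (c⁻¹ • (rotation R).symm ξ)) • f v) c
  rw [finrank_euclideanSpace_fin, abs_of_pos (by positivity)] at h2
  rw [← h2]
  refine integral_congr_ae (Filter.Eventually.of_forall fun v => ?_)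
  simp only [inner_smul_left, inner_smul_right]
  congr 3
  simp [hc.ne']

/-- The Fourier transform intertwines dilations. -/
theorem fourier_dilation {d : ℕ} {a : ℝ} (ha : 0 < a) (R : SO d) (f : L2Space d) :
    𝓕 (dilation a ha R f) = dilation a⁻¹ (inv_pos.2 ha) R (𝓕 f) := by
  have hc := Real.rpow_pos_of_pos ha (-1 / 2)
  have hc' := Real.rpow_pos_of_pos (inv_pos.2 ha) (-1 / 2)
  have hcont1 : Continuous fun f : L2Space d => 𝓕 (dilation a ha R f) :=
    (Lp.fourierTransformₗᵢ (Space d) ℂ).continuous.comp (isometry_dilation ha R).continuous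
  have hcont2 : Continuous fun f : L2Space d => dilation a⁻¹ (inv_pos.2 ha) R (𝓕 f) :=
    (isometry_dilation (inv_pos.2 ha) R).continuous.comp
      (Lp.fourierTransformₗᵢ (Space d) ℂ).continuous
  have hd : DenseRange (SchwartzMap.toLpCLM ℝ ℂ 2 (volume : Measure (Space d))) :=
    SchwartzMap.denseRange_toLpCLM ENNReal.ofNat_ne_top
  -- Both sides are continuous in `f`, so it is enough to check Schwartz functions, where the
  -- Fourier transform is an integral.
  refine congrFun (hd.equalizer hcont1 hcont2 (funext fun u => ?_)) f
  simp only [Function.comp_apply, SchwartzMap.toLpCLM_apply]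
  set v : SchwartzMap (Space d) ℂ := ((a ^ (-(d : ℝ) / 4) : ℝ) : ℂ) •
    SchwartzMap.compCLMOfContinuousLinearEquiv ℂ (dilateEquiv hc R) u with hv
  have e1 : dilation a ha R (u.toLp 2 volume) = v.toLp 2 volume := by
    refine Lp.ext ?_
    filter_upwards [dilation_coeFn ha R (u.toLp 2 volume), v.coeFn_toLp 2 volume,
      (quasiMeasurePreserving_dilate hc R).ae (u.coeFn_toLp 2 volume)] with x h1 h2 h3
    rw [h1, h2, h3]
    rfl
  rw [e1, SchwartzMap.toLp_fourier_eq, SchwartzMap.toLp_fourier_eq]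
  refine Lp.ext ?_
  filter_upwards [dilation_coeFn (inv_pos.2 ha) R ((𝓕 u).toLp 2 volume),
    (𝓕 v).coeFn_toLp 2 volume,
    (quasiMeasurePreserving_dilate hc' R).ae ((𝓕 u).coeFn_toLp 2 volume)] with ξ h1 h2 h3
  rw [h1, h2, h3, hv, FourierTransform.fourier_smul, smul_apply,
    SchwartzMap.fourier_coe, SchwartzMap.fourier_coe]
  have h4 := fourier_comp_dilate hc R u ξ
  have h5 : 𝓕 (⇑(SchwartzMap.compCLMOfContinuousLinearEquiv ℂ (dilateEquiv hc R) u)) ξ =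
    𝓕 (fun x => u ((a ^ (-1 / 2 : ℝ)) • (rotation R).symm x)) ξ := rfl
  have h6 : (a ^ (-1 / 2 : ℝ))⁻¹ = a⁻¹ ^ (-1 / 2 : ℝ) := by rw [Real.inv_rpow ha.le]
  have h7 : a⁻¹ ^ (-(d : ℝ) / 4) = a ^ (-(d : ℝ) / 4) * a ^ ((d : ℝ) / 2) := by
    rw [Real.inv_rpow ha.le, ← Real.rpow_neg ha.le, ← Real.rpow_add ha]
    congr 1; ring
  rw [h5, h4, h6, h7, rpow_neg_half_pow ha, Complex.real_smul, smul_eq_mul, ← mul_assoc,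
    ← Complex.ofReal_mul]

theorem fourier_evolution {d : ℕ} (b : ℝ) (f : L2Space d) :
    ∀ᵐ ξ, 𝓕 (evolution b f) ξ =
      Complex.exp (-(2 * Real.pi * b * ‖ξ‖ ^ 2 : ℝ) * Complex.I) * 𝓕 f ξ := by
  rw [evolution, FourierTransform.fourier_fourierInv_eq]
  exact (memLp_phase b (𝓕 f)).coeFn_toLp

theorem fourier_schrodingerRep {d : ℕ} (b : ℝ) {a : ℝ} (ha : 0 < a) (R : SO d) (f : L2Space d) :
    ∀ᵐ ξ, 𝓕 (schrodingerRep b a ha R f) ξ =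
      Complex.exp (-(2 * Real.pi * b * ‖ξ‖ ^ 2 : ℝ) * Complex.I) *
        (((a ^ ((d : ℝ) / 4) : ℝ) : ℂ) * 𝓕 f (Real.sqrt a • (rotation R).symm ξ)) := by
  filter_upwards [fourier_evolution b (dilation a ha R f),
    dilation_coeFn (inv_pos.2 ha) R (𝓕 f)] with ξ h1 h2
  have h3 : a⁻¹ ^ (-(d : ℝ) / 4) = a ^ ((d : ℝ) / 4) := by
    rw [Real.inv_rpow ha.le, ← Real.rpow_neg ha.le]
    congr 1; ring
  have h4 : a⁻¹ ^ (-1 / 2 : ℝ) = Real.sqrt a := by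
    rw [Real.inv_rpow ha.le, ← Real.rpow_neg ha.le, Real.sqrt_eq_rpow]
    norm_num
  rw [schrodingerRep, h1, fourier_dilation, h2, h3, h4]

/-- Since `‖√ω s‖² = ω`, the phase is purely radial. The normalization splits as `a^{d/4} = √a ·
a^{(d-2)/4}`; the second factor turns the weight at `ω` into the weight at `aω`, and `√a` is the
one-dimensional normalization. -/
theorem polar_fourier_schrodingerRep {d : ℕ} (hd : 1 ≤ d) (b : ℝ) {a : ℝ} (ha : 0 < a) (R : SO d)
    (f : L2Space d) : ∀ᵐ p ∂(polarMeasure d), polar (𝓕 (schrodingerRep b a ha R f)) p.1 p.2 =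
      Complex.exp (-(2 * Real.pi * b * p.1 : ℝ) * Complex.I) * (Real.sqrt a : ℂ) *
        polar (𝓕 f) (a * p.1) (sphereAct R p.2) := by
  filter_upwards [(quasiMeasurePreserving_polarMap hd).ae (fourier_schrodingerRep b ha R f),
    ae_polarMeasure_pos d] with p h hp
  have hs : ‖(p.2 : Space d)‖ = 1 := mem_sphere_zero_iff_norm.1 p.2.2
  have hn : ‖polarMap d p‖ ^ 2 = p.1 := by
    rw [polarMap, norm_smul, hs, mul_one, Real.norm_eq_abs, sq_abs, Real.sq_sqrt hp.le]
  have h' : polar (𝓕 (schrodingerRep b a ha R f)) p.1 p.2 =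
      ((p.1 ^ (((d : ℝ) - 2) / 4) / Real.sqrt 2 : ℝ) : ℂ) *
        𝓕 (schrodingerRep b a ha R f) (polarMap d p) := rfl
  have e1 : Real.sqrt a • (rotation R).symm (polarMap d p) =
      Real.sqrt (a * p.1) • (sphereAct R p.2 : Space d) := by
    rw [polarMap, map_smul, smul_smul, Real.sqrt_mul ha.le]
    rfl
  have e2 : a ^ ((d : ℝ) / 4) = Real.sqrt a * a ^ (((d : ℝ) - 2) / 4) := by
    rw [Real.sqrt_eq_rpow, ← Real.rpow_add ha]
    congr 1; ring
  rw [h', h, hn, e1, polar, Real.mul_rpow ha.le hp.le, e2]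
  push_cast
  ring

theorem sphereClass_fourier_schrodingerRep {d : ℕ} (hd : 1 ≤ d) (b : ℝ) {a : ℝ} (ha : 0 < a)
    (R : SO d) (f : L2Space d) : ∀ᵐ ω ∂(volume.restrict (Ioi (0 : ℝ))),
      sphereClass (polar (𝓕 (schrodingerRep b a ha R f)) ω) =
      (Complex.exp (-(2 * Real.pi * b * ω : ℝ) * Complex.I) * (Real.sqrt a : ℂ)) •
        regularRep R (sphereClass (polar (𝓕 f) (a * ω))) := by
  filter_upwards [Measure.ae_ae_of_ae_prod (polar_fourier_schrodingerRep hd b ha R f),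
    ae_memLp_polar hd (𝓕 (schrodingerRep b a ha R f)), ae_restrict_of_ae (ae_comp_mul_left
      (ae_memLp_polar hd (𝓕 f)) ha), ae_restrict_mem measurableSet_Ioi] with ω h1 h2 h3 hω
  have h4 := h3 hω
  rw [sphereClass, dif_pos h2, sphereClass, dif_pos h4]
  refine Lp.ext ?_
  filter_upwards [h1, h2.coeFn_toLp, Lp.coeFn_smul (Complex.exp
      (-(2 * Real.pi * b * ω : ℝ) * Complex.I) * (Real.sqrt a : ℂ)) (regularRep R (h4.toLp _)),
    Lp.coeFn_compMeasurePreserving (h4.toLp _) (measurePreserving_sphereAct R),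
    (measurePreserving_sphereAct R).quasiMeasurePreserving.ae h4.coeFn_toLp] with s g1 g2 g3 g4 g5
  rw [g2, g1, g3, Pi.smul_apply, smul_eq_mul, regularRep, g4, Function.comp_apply, g5]

theorem inner_regularRep {d : ℕ} (R : SO d) (u v : L2Sphere d) :
    inner ℂ (regularRep R u) (regularRep R v) = inner ℂ u v :=
  (Lp.compMeasurePreservingₗᵢ ℂ (sphereAct R) (measurePreserving_sphereAct R)).inner_map_map u v

/-! ### Schur orthogonality -/

section Schur

variable {G : Type*} [Group G]
  {V : Type*} [NormedAddCommGroup V] [InnerProductSpace ℂ V]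
  {W : Type*} [NormedAddCommGroup W] [InnerProductSpace ℂ W]

/-- The average over the group of the conjugates of a linear map. -/
def averageIntertwiner [Fintype G] (ρ : Representation ℂ G V) (σ : Representation ℂ G W)
    (A : W →ₗ[ℂ] V) :
    Representation.IntertwiningMap σ ρ where
  toLinearMap := ∑ g : G, ρ g ∘ₗ A ∘ₗ σ g⁻¹
  isIntertwining' h := by
    ext x
    simp only [LinearMap.comp_apply, LinearMap.sum_apply, map_sum]
    rw [← (Equiv.mulLeft h).sum_comp]
    refine Finset.sum_congr rfl fun g _ => ?_
    simp only [Equiv.coe_mulLeft, ← Module.End.mul_apply, ← map_mul, mul_inv_rev,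
      inv_mul_cancel_right]
    simp

theorem averageIntertwiner_apply [Fintype G] (ρ : Representation ℂ G V) (σ : Representation ℂ G W)
    (A : W →ₗ[ℂ] V) (x : W) :
    averageIntertwiner ρ σ A x = ∑ g : G, ρ g (A (σ g⁻¹ x)) := by
  change (∑ g : G, ρ g ∘ₗ A ∘ₗ σ g⁻¹) x = _
  simp

/-- The rank one operator `x ↦ ⟨w', x⟩ w`. -/
def rankOneMap (w : V) (w' : W) : W →ₗ[ℂ] V :=
  (innerSL ℂ w').toLinearMap.smulRight w

theorem unitary_inner_inv {σ : Representation ℂ G W} (hσ : ∀ g v, ‖σ g v‖ = ‖v‖) (g : G)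
    (x y : W) : inner ℂ x (σ g⁻¹ y) = inner ℂ (σ g x) y := by
  have h := (LinearMap.norm_map_iff_inner_map_map (σ g)).1 (hσ g) x (σ g⁻¹ y)
  rw [← h, ← Module.End.mul_apply, ← map_mul]
  simp

/-- Averaging a rank one operator over the group makes the sum a single matrix coefficient of an
intertwiner, to which Schur's lemma applies. -/
theorem sum_inner_mul_conj_inner [Fintype G] (ρ : Representation ℂ G V) {σ : Representation ℂ G W}
    (hσ : ∀ g v, ‖σ g v‖ = ‖v‖) (e w : V) (e' w' : W) :
    ∑ g : G, inner ℂ e (ρ g w) * conj (inner ℂ e' (σ g w')) =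
      inner ℂ e (averageIntertwiner ρ σ (rankOneMap w w') e') := by
  rw [averageIntertwiner_apply, inner_sum]
  refine Finset.sum_congr rfl fun g _ => ?_
  rw [inner_conj_symm]
  simp only [rankOneMap, LinearMap.smulRight_apply, ContinuousLinearMap.coe_coe,
    innerSL_apply_apply, map_smul, inner_smul_right]
  rw [unitary_inner_inv hσ, mul_comm]

/-- Schur orthogonality for inequivalent representations. -/
theorem schur_orthogonality_ne [Fintype G] (ρ : Representation ℂ G V) {σ : Representation ℂ G W}
    (hσ : ∀ g v, ‖σ g v‖ = ‖v‖) (hρi : ρ.IsIrreducible) (hσi : σ.IsIrreducible)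
    (hne : IsEmpty (σ.Equiv ρ)) (e w : V) (e' w' : W) :
    ∑ g : G, inner ℂ e (ρ g w) * conj (inner ℂ e' (σ g w')) = 0 := by
  rw [sum_inner_mul_conj_inner ρ hσ]
  -- Schur's lemma: between inequivalent irreducibles the space of intertwiners is a singleton.
  have : averageIntertwiner ρ σ (rankOneMap w w') = 0 := Subsingleton.elim _ _
  rw [this]
  simp

theorem trace_rankOneMap [FiniteDimensional ℂ V] (w w' : V) :
    LinearMap.trace ℂ V (rankOneMap w w') = inner ℂ w' w := by
  rw [LinearMap.trace_eq_sum_inner _ (stdOrthonormalBasis ℂ V),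
    ← (stdOrthonormalBasis ℂ V).sum_inner_mul_inner w' w]
  refine Finset.sum_congr rfl fun i _ => ?_
  simp [rankOneMap, inner_smul_right]

/-- Schur orthogonality for the matrix coefficients of an irreducible representation. -/
theorem schur_orthogonality [Fintype G] [FiniteDimensional ℂ V] (ρ : Representation ℂ G V)
    (hρ : ∀ g v, ‖ρ g v‖ = ‖v‖)
    (hρi : ρ.IsIrreducible) (e w e' w' : V) :
    (Module.finrank ℂ V : ℂ) * ∑ g : G, inner ℂ e (ρ g w) * conj (inner ℂ e' (ρ g w')) =
      Fintype.card G * inner ℂ w' w * inner ℂ e e' := by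
  rw [sum_inner_mul_conj_inner ρ hρ]
  obtain ⟨c, hc⟩ := (Representation.IsIrreducible.algebraMap_intertwiningMap_bijective_of_isAlgClosed
    (ρ := ρ) (k := ℂ)).2 (averageIntertwiner ρ ρ (rankOneMap w w'))
  have hlin : (averageIntertwiner ρ ρ (rankOneMap w w')).toLinearMap = c • LinearMap.id := by
    rw [← hc]; rfl
  -- The scalar `c` is read off from the trace: each conjugate of the rank one map has trace `⟨w',
  -- w⟩`, while `c • id` has trace `c · dim V`.
  have htr : LinearMap.trace ℂ V (averageIntertwiner ρ ρ (rankOneMap w w')).toLinearMap =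
      Fintype.card G * inner ℂ w' w := by
    change LinearMap.trace ℂ V (∑ g : G, ρ g ∘ₗ rankOneMap w w' ∘ₗ ρ g⁻¹) = _
    rw [map_sum]
    have : ∀ g : G, LinearMap.trace ℂ V (ρ g ∘ₗ rankOneMap w w' ∘ₗ ρ g⁻¹) = inner ℂ w' w := by
      intro g
      rw [LinearMap.trace_comp_comm', LinearMap.comp_assoc, ← Module.End.mul_eq_comp (ρ g⁻¹),
        ← map_mul, inv_mul_cancel, map_one]
      exact trace_rankOneMap w w'
    simp [this]
  rw [hlin, map_smul, LinearMap.trace_id, smul_eq_mul] at htr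
  have happ : averageIntertwiner ρ ρ (rankOneMap w w') e' = c • e' := by
    rw [← Representation.IntertwiningMap.toLinearMap_apply, hlin]; rfl
  rw [happ, inner_smul_right, ← htr]
  ring

end Schur

/-! ### Totality of the spherical harmonics -/

open MvPolynomial in
/-- The Laplace operator on polynomials. -/
def laplacian (d : ℕ) : MvPolynomial (Fin d) ℂ →ₗ[ℂ] MvPolynomial (Fin d) ℂ :=
  ∑ k : Fin d, (pderiv k).toLinearMap ∘ₗ (pderiv (R := ℂ) k).toLinearMap

open MvPolynomial in
/-- The polynomial `|x|²`. -/
def radiusSq (d : ℕ) : MvPolynomial (Fin d) ℂ := ∑ k : Fin d, X k ^ 2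

open MvPolynomial in
theorem laplacian_apply {d : ℕ} (p : MvPolynomial (Fin d) ℂ) :
    laplacian d p = ∑ k, pderiv k (pderiv k p) := by
  simp [laplacian]

open MvPolynomial in
theorem pderiv_radiusSq {d : ℕ} (k : Fin d) : pderiv k (radiusSq d) = 2 * X k := by
  classical
  simp [radiusSq, pderiv_X, Pi.single_apply, mul_comm]

open MvPolynomial in
theorem isHomogeneous_radiusSq (d : ℕ) : (radiusSq d).IsHomogeneous 2 :=
  IsHomogeneous.sum _ _ _ fun k _ => by simpa using (isHomogeneous_X ℂ k).pow 2

open MvPolynomial in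
theorem isHomogeneous_laplacian {d n : ℕ} {p : MvPolynomial (Fin d) ℂ} (hp : p.IsHomogeneous n) :
    (laplacian d p).IsHomogeneous (n - 2) := by
  rw [laplacian_apply]
  exact IsHomogeneous.sum _ _ _ fun k _ => by simpa [Nat.sub_sub] using hp.pderiv.pderiv

open MvPolynomial in
theorem laplacian_eq_zero_of_lt_two {d n : ℕ} (hn : n < 2) {p : MvPolynomial (Fin d) ℂ}
    (hp : p.IsHomogeneous n) : laplacian d p = 0 := by
  rw [laplacian_apply]
  refine Finset.sum_eq_zero fun k _ => ?_
  have h : (pderiv k p).IsHomogeneous 0 := by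
    have := hp.pderiv (i := k)
    rwa [show n - 1 = 0 by omega] at this
  rw [← totalDegree_zero_iff_isHomogeneous, totalDegree_eq_zero_iff_eq_C] at h
  rw [h, pderiv_C]

open MvPolynomial in
-- Leibniz' rule; the mixed terms `4 ∑ x_k ∂_k q` equal `4n q` by Euler's identity.
theorem laplacian_radiusSq_mul {d n : ℕ} {q : MvPolynomial (Fin d) ℂ} (hq : q.IsHomogeneous n) :
    laplacian d (radiusSq d * q) = radiusSq d * laplacian d q + ((2 * d + 4 * n : ℕ) : ℂ) • q := by
  have h : ∀ k, pderiv k (pderiv k (radiusSq d * q)) =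
      2 * q + 4 * (X k * pderiv k q) + radiusSq d * pderiv k (pderiv k q) := by
    intro k
    have h2 : pderiv k (2 : MvPolynomial (Fin d) ℂ) = 0 := by
      exact_mod_cast (pderiv k).map_natCast 2
    simp only [pderiv_mul, map_add, pderiv_radiusSq, pderiv_X_self, h2]
    ring
  rw [laplacian_apply, laplacian_apply, Finset.sum_congr rfl fun k _ => h k,
    Finset.sum_add_distrib, Finset.sum_add_distrib, ← Finset.mul_sum, ← Finset.mul_sum,
    ← Finset.mul_sum, hq.sum_X_mul_pderiv, Nat.cast_smul_eq_nsmul]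
  simp only [Finset.sum_const, Finset.card_univ, Fintype.card_fin, nsmul_eq_mul]
  push_cast
  ring

open MvPolynomial in
-- Applying `Δ` to `|x|² Δq = -c q` shows that `Δq` solves an equation of the same form in degree `n
-- - 2`, with `c + 2d + 4(n - 2)` in place of `c`. By induction `Δq = 0`, and then `c q = 0`.
-- Allowing every positive integer `c` is what lets the induction close.
theorem eq_zero_of_radiusSq_mul_laplacian {d : ℕ} (n : ℕ) :
    ∀ (c : ℕ), c ≠ 0 → ∀ q : MvPolynomial (Fin d) ℂ, q.IsHomogeneous n →
      radiusSq d * laplacian d q = -((c : ℂ) • q) → q = 0 := by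
  induction n using Nat.strong_induction_on with
  | _ n ih =>
    intro c hc q hq h
    have hlap : laplacian d q = 0 := by
      rcases lt_or_ge n 2 with hn | hn
      · exact laplacian_eq_zero_of_lt_two hn hq
      · refine ih (n - 2) (by omega) (c + (2 * d + 4 * (n - 2))) (by omega) _
          (isHomogeneous_laplacian hq) ?_
        have h1 := congrArg (laplacian d) h
        rw [laplacian_radiusSq_mul (isHomogeneous_laplacian hq), map_neg, map_smul] at h1
        rw [Nat.cast_add, add_smul, neg_add, ← h1]
        abel
    rw [hlap, mul_zero, eq_comm, neg_eq_zero, smul_eq_zero] at h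
    exact h.resolve_left (by exact_mod_cast hc)

open MvPolynomial in
-- `q ↦ Δ(|x|² q)` is an endomorphism of the finite-dimensional space of homogeneous polynomials of
-- degree `n`, so injectivity suffices. On its kernel `|x|² Δq = -(2d + 4n) q`, with a nonzero
-- constant because `d ≥ 1`.
theorem exists_laplacian_radiusSq_mul_eq {d : ℕ} (hd : 1 ≤ d) (n : ℕ)
    {p : MvPolynomial (Fin d) ℂ} (hp : p.IsHomogeneous n) :
    ∃ q : MvPolynomial (Fin d) ℂ, q.IsHomogeneous n ∧ laplacian d (radiusSq d * q) = p := by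
  have hfin : FiniteDimensional ℂ (homogeneousSubmodule (Fin d) ℂ n) :=
    Module.Finite.of_fg (homogeneousSubmodule_fg (Fin d) ℂ n)
  let A : MvPolynomial (Fin d) ℂ →ₗ[ℂ] MvPolynomial (Fin d) ℂ :=
    laplacian d ∘ₗ LinearMap.mulLeft ℂ (radiusSq d)
  have hA : ∀ q ∈ homogeneousSubmodule (Fin d) ℂ n, A q ∈ homogeneousSubmodule (Fin d) ℂ n := by
    intro q hq
    have := isHomogeneous_laplacian ((isHomogeneous_radiusSq d).mul hq)
    rwa [Nat.add_sub_cancel_left] at this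
  have hinj : Function.Injective (A.restrict hA) := by
    rw [injective_iff_map_eq_zero]
    rintro ⟨q, hq⟩ h
    have h' : laplacian d (radiusSq d * q) = 0 := congrArg Subtype.val h
    rw [laplacian_radiusSq_mul hq] at h'
    exact Subtype.ext (eq_zero_of_radiusSq_mul_laplacian n _ (by omega) q hq
      (eq_neg_of_add_eq_zero_left h'))
  obtain ⟨⟨q, hq⟩, h⟩ := LinearMap.injective_iff_surjective.1 hinj ⟨p, hp⟩
  exact ⟨q, hq, congrArg Subtype.val h⟩

theorem mem_harmonicPolynomials {d i : ℕ} {p : MvPolynomial (Fin d) ℂ} :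
    p ∈ harmonicPolynomials d i ↔ p.IsHomogeneous i ∧ laplacian d p = 0 := Iff.rfl

open MvPolynomial in
theorem polyOnSphere_radiusSq_mul {d : ℕ} (q : MvPolynomial (Fin d) ℂ) :
    polyOnSphere d (radiusSq d * q) = polyOnSphere d q := by
  ext s
  have h : ∑ k, ((s : Space d) k : ℂ) ^ 2 = 1 := by
    have h1 := mem_sphere_zero_iff_norm.1 s.2
    have h2 := EuclideanSpace.norm_sq_eq (s : Space d)
    rw [h1] at h2
    simp only [Real.norm_eq_abs, sq_abs, one_pow] at h2
    exact_mod_cast h2.symm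
  simp [polyOnSphere, radiusSq, h]

/-- The class in `L²(S^{d-1})` of a polynomial. -/
def polyClass (d : ℕ) : MvPolynomial (Fin d) ℂ →ₗ[ℂ] L2Sphere d :=
  (ContinuousMap.toLp 2 (surface d) ℂ).toLinearMap ∘ₗ polyOnSphere d

theorem polyClass_mem_sphericalHarmonics {d i : ℕ} {p : MvPolynomial (Fin d) ℂ}
    (hp : p ∈ harmonicPolynomials d i) : polyClass d p ∈ sphericalHarmonics d i :=
  Submodule.mem_map_of_mem hp

open MvPolynomial in
-- Choose `q` of degree `n - 2` with `Δ(|x|² q) = Δp`; then `p = (p - |x|² q) + |x|² q` with the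
-- first term harmonic. On the sphere `|x|² q` equals `q`, so induction on the degree applies.
theorem inner_polyClass_eq_zero {d : ℕ} (hd : 1 ≤ d) {v : L2Sphere d}
    (hv : ∀ i, ∀ y ∈ sphericalHarmonics d i, inner ℂ y v = 0) (p : MvPolynomial (Fin d) ℂ) :
    inner ℂ (polyClass d p) v = 0 := by
  have key : ∀ n : ℕ, ∀ p : MvPolynomial (Fin d) ℂ, p.IsHomogeneous n →
      inner ℂ (polyClass d p) v = 0 := by
    intro n
    induction n using Nat.strong_induction_on with
    | _ n ih =>
      intro p hp
      rcases lt_or_ge n 2 with hn | hn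
      · exact hv n _ (polyClass_mem_sphericalHarmonics
          (mem_harmonicPolynomials.2 ⟨hp, laplacian_eq_zero_of_lt_two hn hp⟩))
      · obtain ⟨q, hq, hqp⟩ := exists_laplacian_radiusSq_mul_eq hd (n - 2)
          (isHomogeneous_laplacian hp)
        have h1 : p - radiusSq d * q ∈ harmonicPolynomials d n := by
          refine mem_harmonicPolynomials.2 ⟨hp.sub ?_, by rw [map_sub, hqp, sub_self]⟩
          have := (isHomogeneous_radiusSq d).mul hq
          rwa [show 2 + (n - 2) = n by omega] at this
        have h2 : polyClass d p = polyClass d (p - radiusSq d * q) + polyClass d q := by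
          rw [map_sub]
          simp [polyClass, polyOnSphere_radiusSq_mul]
        rw [h2, inner_add_left, hv n _ (polyClass_mem_sphericalHarmonics h1),
          ih (n - 2) (by omega) q hq, add_zero]
  rw [← sum_homogeneousComponent p, map_sum, sum_inner]
  exact Finset.sum_eq_zero fun n _ => key n _ (homogeneousComponent_isHomogeneous n p)

open MvPolynomial in
theorem eval_map_conj {d : ℕ} (x : Fin d → ℝ) (p : MvPolynomial (Fin d) ℂ) :
    eval (fun k => (x k : ℂ)) (map (starRingEnd ℂ) p) = conj (eval (fun k => (x k : ℂ)) p) := by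
  induction p using MvPolynomial.induction_on with
  | C a => simp
  | add p q hp hq => simp [hp, hq]
  | mul_X p k hp => simp [hp]

open MvPolynomial in
/-- The algebra of polynomial functions on the sphere. -/
def spherePolynomials (d : ℕ) : StarSubalgebra ℂ C(Sphere d, ℂ) where
  carrier := range (polyOnSphere d)
  mul_mem' := by
    rintro _ _ ⟨p, rfl⟩ ⟨q, rfl⟩
    exact ⟨p * q, by ext; simp [polyOnSphere]⟩
  one_mem' := ⟨1, by ext; simp [polyOnSphere]⟩
  add_mem' := by
    rintro _ _ ⟨p, rfl⟩ ⟨q, rfl⟩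
    exact ⟨p + q, map_add _ p q⟩
  zero_mem' := ⟨0, map_zero _⟩
  algebraMap_mem' c := ⟨C c, by ext; simp [polyOnSphere]⟩
  star_mem' := by
    rintro _ ⟨p, rfl⟩
    exact ⟨map (starRingEnd ℂ) p, by ext s; exact eval_map_conj _ p⟩

/-- Stone–Weierstrass: polynomial functions form a conjugation-invariant algebra, and the
coordinates separate points. Continuous functions are in turn dense in `L²`. -/
theorem dense_range_polyClass (d : ℕ) : DenseRange (polyClass d) := by
  have h1 : (spherePolynomials d).topologicalClosure = ⊤ := by
    apply ContinuousMap.starSubalgebra_topologicalClosure_eq_top_of_separatesPoints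
    intro s t hst
    obtain ⟨k, hk⟩ : ∃ k, (s : Space d) k ≠ (t : Space d) k := by
      by_contra! h
      exact hst (Subtype.ext (PiLp.ext h))
    refine ⟨_, ⟨polyOnSphere d (MvPolynomial.X k), ⟨MvPolynomial.X k, rfl⟩, rfl⟩, ?_⟩
    simpa [polyOnSphere] using hk
  have h2 : DenseRange (polyOnSphere d) := by
    have h := congrArg (fun A : StarSubalgebra ℂ C(Sphere d, ℂ) => (A : Set C(Sphere d, ℂ))) h1
    simp only [StarSubalgebra.topologicalClosure_coe, StarSubalgebra.coe_top] at h
    exact dense_iff_closure_eq.2 h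
  have h3 : DenseRange (ContinuousMap.toLp 2 (surface d) ℂ : C(Sphere d, ℂ) →L[ℂ] L2Sphere d) :=
    ContinuousMap.toLp_denseRange ℂ _ ℂ (by simp)
  exact h3.comp h2 (ContinuousLinearMap.continuous _)

theorem eq_zero_of_inner_sphericalHarmonics {d : ℕ} (hd : 1 ≤ d) {v : L2Sphere d}
    (hv : ∀ i, ∀ y ∈ sphericalHarmonics d i, inner ℂ y v = 0) : v = 0 :=
  (dense_range_polyClass d).eq_zero_of_inner_right ℂ fun p => inner_polyClass_eq_zero hd hv p

/-! ### Gaussian moments and orthogonality of different degrees -/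

/-- The value of a complex polynomial at a point of `ℝ^d`. -/
def polyAt {d : ℕ} (p : MvPolynomial (Fin d) ℂ) (x : Space d) : ℂ :=
  MvPolynomial.eval (fun k => (x k : ℂ)) p

theorem continuous_polyAt {d : ℕ} (p : MvPolynomial (Fin d) ℂ) : Continuous (polyAt p) :=
  (MvPolynomial.continuous_eval p).comp (by fun_prop)

theorem exists_norm_polyAt_le {d : ℕ} (p : MvPolynomial (Fin d) ℂ) :
    ∃ (C : ℝ) (N : ℕ), 0 ≤ C ∧ ∀ x : Space d, ‖polyAt p x‖ ≤ C * (1 + ‖x‖) ^ N := by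
  induction p using MvPolynomial.induction_on with
  | C a => exact ⟨‖a‖, 0, norm_nonneg a, fun x => by simp [polyAt]⟩
  | add p q hp hq =>
    obtain ⟨C, N, hC, h⟩ := hp
    obtain ⟨C', N', hC', h'⟩ := hq
    refine ⟨C + C', N + N', by positivity, fun x => ?_⟩
    have h1 : (1 : ℝ) ≤ 1 + ‖x‖ := by linarith [norm_nonneg x]
    have e : polyAt (p + q) x = polyAt p x + polyAt q x := by simp [polyAt]
    rw [e, add_mul]
    refine (norm_add_le _ _).trans (add_le_add ((h x).trans ?_) ((h' x).trans ?_))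
    · exact mul_le_mul_of_nonneg_left (pow_le_pow_right₀ h1 (by omega)) hC
    · exact mul_le_mul_of_nonneg_left (pow_le_pow_right₀ h1 (by omega)) hC'
  | mul_X p k hp =>
    obtain ⟨C, N, hC, h⟩ := hp
    refine ⟨C, N + 1, hC, fun x => ?_⟩
    have e : polyAt (p * MvPolynomial.X k) x = polyAt p x * (x k : ℂ) := by simp [polyAt]
    rw [e, norm_mul, pow_succ, ← mul_assoc]
    refine mul_le_mul (h x) ?_ (norm_nonneg _) (by positivity)
    rw [Complex.norm_real]
    exact (PiLp.norm_apply_le x k).trans (by linarith)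

/-- The Gaussian `e^{-|x|²/2}`. -/
def gauss {d : ℕ} (x : Space d) : ℂ := (Real.exp (-(‖x‖ ^ 2 / 2)) : ℝ)

theorem continuous_gauss {d : ℕ} : Continuous (gauss (d := d)) := by
  unfold gauss; fun_prop

theorem integrable_polyAt_mul_gauss {d : ℕ} (p : MvPolynomial (Fin d) ℂ) :
    Integrable (fun x : Space d => polyAt p x * gauss x) := by
  obtain ⟨C, N, hC, h⟩ := exists_norm_polyAt_le p
  have hg := (GaussianFourier.integrable_cexp_neg_mul_sq_norm_add (V := Space d)
    (b := ((1 / 4 : ℝ) : ℂ)) (by rw [Complex.ofReal_re]; norm_num) 0 0).norm.const_mul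
    (C * (N.factorial * Real.exp 2))
  refine hg.mono' ((continuous_polyAt p).mul continuous_gauss).aestronglyMeasurable
    (Filter.Eventually.of_forall fun x => ?_)
  have h1 : (1 + ‖x‖) ^ N ≤ N.factorial * Real.exp (1 + ‖x‖) := by
    have := Real.pow_div_factorial_le_exp (x := 1 + ‖x‖) (by positivity) N
    rwa [div_le_iff₀' (by positivity)] at this
  have h2 : ‖Complex.exp (-((1 / 4 : ℝ) : ℂ) * (‖x‖ : ℂ) ^ 2 + 0 * (inner ℝ (0 : Space d) x : ℝ))‖ =
      Real.exp (-(1 / 4) * ‖x‖ ^ 2) := by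
    rw [zero_mul, add_zero, ← Complex.ofReal_pow, ← Complex.ofReal_neg, ← Complex.ofReal_mul,
      ← Complex.ofReal_exp, Complex.norm_real, Real.norm_eq_abs, Real.abs_exp]
  -- With `r = ‖x‖`, the difference of the exponents, `(2 - r²/4) - (1 + r - r²/2)`, is the square
  -- `(r/2 - 1)²`.
  have h3 : Real.exp (1 + ‖x‖) * Real.exp (-(‖x‖ ^ 2 / 2)) ≤
      Real.exp 2 * Real.exp (-(1 / 4) * ‖x‖ ^ 2) := by
    rw [← Real.exp_add, ← Real.exp_add, Real.exp_le_exp]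
    nlinarith [sq_nonneg (‖x‖ / 2 - 1)]
  have h4 : ‖gauss x‖ = Real.exp (-(‖x‖ ^ 2 / 2)) := by
    rw [gauss, Complex.norm_real, Real.norm_eq_abs, Real.abs_exp]
  rw [h2, norm_mul, h4]
  calc ‖polyAt p x‖ * Real.exp (-(‖x‖ ^ 2 / 2))
      ≤ (C * (N.factorial * Real.exp (1 + ‖x‖))) * Real.exp (-(‖x‖ ^ 2 / 2)) := by
        gcongr
        exact (h x).trans (mul_le_mul_of_nonneg_left h1 hC)
    _ = C * N.factorial * (Real.exp (1 + ‖x‖) * Real.exp (-(‖x‖ ^ 2 / 2))) := by ring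
    _ ≤ C * N.factorial * (Real.exp 2 * Real.exp (-(1 / 4) * ‖x‖ ^ 2)) := by gcongr
    _ = _ := by ring

theorem hasLineDerivAt_polyAt {d : ℕ} (p : MvPolynomial (Fin d) ℂ) (k : Fin d) (x : Space d) :
    HasLineDerivAt ℝ (polyAt p) (polyAt (MvPolynomial.pderiv k p) x) x
      (EuclideanSpace.single k 1) := by
  classical
  unfold HasLineDerivAt
  induction p using MvPolynomial.induction_on with
  | C a => simpa [polyAt] using hasDerivAt_const (0 : ℝ) a
  | add p q hp hq =>
    have e : ∀ y : Space d, polyAt (p + q) y = polyAt p y + polyAt q y := by simp [polyAt]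
    simp only [e]
    convert! hp.add hq using 1
    simp [polyAt]
  | mul_X p l hp =>
    have e : ∀ y : Space d, polyAt (p * MvPolynomial.X l) y = polyAt p y * (y l : ℂ) := by
      simp [polyAt]
    have hl : HasDerivAt (fun t : ℝ => (((x + t • EuclideanSpace.single k (1 : ℝ)) l : ℝ) : ℂ))
        (if l = k then 1 else 0) 0 := by
      have h1 : HasDerivAt (fun t : ℝ => (x + t • EuclideanSpace.single k (1 : ℝ)) l)
          (if l = k then 1 else 0) 0 := by
        simp only [PiLp.add_apply, PiLp.smul_apply, PiLp.single_apply, smul_eq_mul]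
        simpa using ((hasDerivAt_id (0 : ℝ)).mul_const (if l = k then (1 : ℝ) else 0)).const_add
          (x l)
      convert! h1.ofReal_comp using 1
      split_ifs <;> simp
    simp only [e]
    convert! hp.mul hl using 1
    simp only [MvPolynomial.pderiv_mul, MvPolynomial.pderiv_X, zero_smul, add_zero, polyAt,
      map_add, map_mul, MvPolynomial.eval_X, Pi.single_apply]
    split_ifs <;> simp

theorem hasLineDerivAt_gauss {d : ℕ} (k : Fin d) (x : Space d) :
    HasLineDerivAt ℝ gauss (-((x k : ℂ) * gauss x)) x (EuclideanSpace.single k 1) := by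
  unfold HasLineDerivAt
  have h1 : ∀ t : ℝ, ‖x + t • EuclideanSpace.single k (1 : ℝ)‖ ^ 2 =
      ‖x‖ ^ 2 + 2 * (t * x k) + t ^ 2 := by
    intro t
    rw [norm_add_sq_real, inner_smul_right, EuclideanSpace.inner_single_right, norm_smul]
    simp
  have h2 : HasDerivAt (fun t : ℝ => -((‖x‖ ^ 2 + 2 * (t * x k) + t ^ 2) / 2)) (-(x k)) 0 := by
    have h := (((((hasDerivAt_id (0 : ℝ)).mul_const (x k)).const_mul 2).const_add (‖x‖ ^ 2)).add
      (hasDerivAt_pow 2 (0 : ℝ))).div_const 2 |>.neg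
    convert! h using 1
    simp
  simp only [gauss, h1]
  convert! h2.exp.ofReal_comp using 1
  simp [mul_comm]

/-- The Gaussian moment `∫ p(x) e^{-|x|²/2} dx`. -/
def gaussMoment {d : ℕ} (p : MvPolynomial (Fin d) ℂ) : ℂ := ∫ x : Space d, polyAt p x * gauss x

theorem gaussMoment_sum {d : ℕ} {ι : Type*} (s : Finset ι) (p : ι → MvPolynomial (Fin d) ℂ) :
    gaussMoment (∑ i ∈ s, p i) = ∑ i ∈ s, gaussMoment (p i) := by
  simp only [gaussMoment]
  rw [← integral_finsetSum _ fun i _ => integrable_polyAt_mul_gauss (p i)]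
  simp [polyAt, Finset.sum_mul]

theorem gaussMoment_natCast_mul {d : ℕ} (n : ℕ) (p : MvPolynomial (Fin d) ℂ) :
    gaussMoment ((n : MvPolynomial (Fin d) ℂ) * p) = n * gaussMoment p := by
  rw [gaussMoment, gaussMoment, ← integral_const_mul]
  simp [polyAt, mul_assoc]

/-- Integration by parts: `x_k e^{-|x|²/2}` is minus the `k`-th derivative of the Gaussian. -/
theorem gaussMoment_X_mul {d : ℕ} (k : Fin d) (p : MvPolynomial (Fin d) ℂ) :
    gaussMoment (MvPolynomial.X k * p) = gaussMoment (MvPolynomial.pderiv k p) := by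
  have e : ∀ x : Space d, polyAt p x * -((x k : ℂ) * gauss x) =
      -(polyAt (MvPolynomial.X k * p) x * gauss x) := by
    intro x
    simp only [polyAt, map_mul, MvPolynomial.eval_X]
    ring
  have h := integral_bilinear_hasLineDerivAt_right_eq_neg_left_of_integrable
    (μ := (volume : Measure (Space d))) (f := polyAt p) (g := gauss)
    (f' := polyAt (MvPolynomial.pderiv k p)) (g' := fun x => -((x k : ℂ) * gauss x))
    (v := EuclideanSpace.single k 1) (B := ContinuousLinearMap.mul ℝ ℂ)
    (integrable_polyAt_mul_gauss _)
    (by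
      simp only [ContinuousLinearMap.mul_apply', e]
      exact (integrable_polyAt_mul_gauss _).neg)
    (integrable_polyAt_mul_gauss _)
    (fun x _ => hasLineDerivAt_polyAt p k x) (fun x _ => hasLineDerivAt_gauss k x)
  simp only [ContinuousLinearMap.mul_apply', e, integral_neg, neg_inj] at h
  exact h

open MvPolynomial in
-- Expand `i p = ∑ x_k ∂_k p` by Euler's identity and integrate by parts; the term containing `Δp`
-- vanishes. The right-hand side is symmetric in `p` and `q`, so for two harmonic polynomials of
-- distinct degrees the moment of the product must be zero.
theorem natCast_mul_gaussMoment_mul {d i : ℕ} {p : MvPolynomial (Fin d) ℂ}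
    (hp : p ∈ harmonicPolynomials d i) (q : MvPolynomial (Fin d) ℂ) :
    i * gaussMoment (q * p) = gaussMoment (∑ k, pderiv k q * pderiv k p) := by
  obtain ⟨hp1, hp2⟩ := mem_harmonicPolynomials.1 hp
  have h1 : (i : MvPolynomial (Fin d) ℂ) * (q * p) = ∑ k, X k * (q * pderiv k p) := by
    rw [mul_left_comm, ← nsmul_eq_mul i p, ← hp1.sum_X_mul_pderiv, Finset.mul_sum]
    exact Finset.sum_congr rfl fun k _ => by ring
  rw [← gaussMoment_natCast_mul, h1, gaussMoment_sum]
  simp only [gaussMoment_X_mul]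
  rw [← gaussMoment_sum]
  simp only [pderiv_mul]
  rw [Finset.sum_add_distrib, ← Finset.mul_sum, ← laplacian_apply, hp2, mul_zero, add_zero]

theorem gaussMoment_mul_eq_zero {d i j : ℕ} (hij : i ≠ j) {p q : MvPolynomial (Fin d) ℂ}
    (hp : p ∈ harmonicPolynomials d i) (hq : q ∈ harmonicPolynomials d j) :
    gaussMoment (p * q) = 0 := by
  have h1 := natCast_mul_gaussMoment_mul hp q
  have h2 := natCast_mul_gaussMoment_mul hq p
  rw [Finset.sum_congr rfl fun k _ => mul_comm _ _, ← h2, mul_comm q p, ← sub_eq_zero,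
    ← sub_mul] at h1
  exact (mul_eq_zero.1 h1).resolve_left (sub_ne_zero.2 (by exact_mod_cast hij))

theorem polyAt_smul {d n : ℕ} {p : MvPolynomial (Fin d) ℂ} (hp : p.IsHomogeneous n) (t : ℝ)
    (x : Space d) : polyAt p (t • x) = (t : ℂ) ^ n * polyAt p x := by
  rw [polyAt, polyAt, MvPolynomial.eval_eq', MvPolynomial.eval_eq', Finset.mul_sum]
  refine Finset.sum_congr rfl fun a ha => ?_
  have h : ∑ k, a k = n := by
    have := hp (MvPolynomial.mem_support_iff.1 ha)
    rw [← this, ← Finsupp.degree_eq_sum, Finsupp.degree_eq_weight_one]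
    rfl
  simp only [PiLp.smul_apply, smul_eq_mul, Complex.ofReal_mul, mul_pow]
  rw [Finset.prod_mul_distrib, Finset.prod_pow_eq_pow_sum, h]
  ring

theorem integral_radial_pos {d : ℕ} (hd : 1 ≤ d) (n : ℕ) :
    0 < ∫ ω in Ioi (0 : ℝ), polarWeight d ω ^ 2 * (Real.sqrt ω ^ n * Real.exp (-(ω / 2))) := by
  have ha : (0 : ℝ) < (d + n) / 2 := by positivity
  have h := Real.integral_rpow_mul_exp_neg_mul_Ioi ha (by norm_num : (0 : ℝ) < 1 / 2)
  have e : ∀ ω ∈ Ioi (0 : ℝ), polarWeight d ω ^ 2 * (Real.sqrt ω ^ n * Real.exp (-(ω / 2))) =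
      1 / 2 * (ω ^ (((d + n) / 2 : ℝ) - 1) * Real.exp (-(1 / 2 * ω))) := by
    intro ω hω
    have hω : 0 < ω := hω
    rw [polarWeight, div_pow, Real.sq_sqrt zero_le_two, ← Real.rpow_natCast, ← Real.rpow_mul hω.le,
      Real.sqrt_eq_rpow, ← Real.rpow_natCast (ω ^ (1 / 2 : ℝ)), ← Real.rpow_mul hω.le,
      show ((d + n) / 2 : ℝ) - 1 = ((d : ℝ) - 2) / 4 * (2 : ℕ) + 1 / 2 * n by push_cast; ring,
      Real.rpow_add hω, show -(1 / 2 * ω) = -(ω / 2) by ring]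
    ring
  rw [setIntegral_congr_fun measurableSet_Ioi e, integral_const_mul, h]
  have := Real.Gamma_pos_of_pos ha
  positivity

/-- For a homogeneous polynomial the Gaussian moment is a radial integral times the integral over
the sphere. The radial factor is positive, so vanishing moments give vanishing sphere integrals. -/
theorem gaussMoment_eq {d n : ℕ} (hd : 1 ≤ d) {p : MvPolynomial (Fin d) ℂ}
    (hp : p.IsHomogeneous n) :
    gaussMoment p = ((∫ ω in Ioi (0 : ℝ), polarWeight d ω ^ 2 *
      (Real.sqrt ω ^ n * Real.exp (-(ω / 2))) : ℝ) : ℂ) *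
        ∫ s, polyOnSphere d p s ∂(surface d) := by
  have hpres := measurePreserving_polarMap hd
  have hlt : ∀ᵐ p ∂(polarMeasure d), polarDensity d p < ∞ :=
    Filter.Eventually.of_forall fun p => ENNReal.ofReal_lt_top
  have hmap : gaussMoment p = ∫ z, polyAt p (polarMap d z) * gauss (polarMap d z)
      ∂((polarMeasure d).withDensity (polarDensity d)) := by
    rw [gaussMoment, ← integral_map (f := fun x => polyAt p x * gauss x) hpres.aemeasurable
      (((continuous_polyAt p).mul continuous_gauss).aestronglyMeasurable), hpres.map_eq]
  rw [hmap, integral_withDensity_eq_integral_toReal_smul (measurable_polarDensity d) hlt,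
    ← integral_complex_ofReal, ← integral_prod_mul]
  refine integral_congr_ae ?_
  filter_upwards [ae_polarMeasure_pos d] with z hz
  have hs : ‖(z.2 : Space d)‖ = 1 := mem_sphere_zero_iff_norm.1 z.2.2
  rw [polarDensity, ENNReal.toReal_ofReal (sq_nonneg _), Complex.real_smul, polarMap,
    polyAt_smul hp, gauss, norm_smul, hs, mul_one, Real.norm_eq_abs, sq_abs, Real.sq_sqrt (le_of_lt hz)]
  simp only [polyOnSphere, polyAt, LinearMap.coe_mk, AddHom.coe_mk, ContinuousMap.coe_mk]
  push_cast
  ring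

theorem inner_sphericalHarmonics_eq_zero {d i j : ℕ} (hd : 1 ≤ d) (hij : i ≠ j) {u v : L2Sphere d}
    (hu : u ∈ sphericalHarmonics d i) (hv : v ∈ sphericalHarmonics d j) : inner ℂ u v = 0 := by
  obtain ⟨p, hp, rfl⟩ := hu
  obtain ⟨q, hq, rfl⟩ := hv
  -- The Laplacian has real coefficients, so conjugating the coefficients preserves harmonicity;
  -- this turns the sesquilinear inner product into a moment of a product.
  have hp' : MvPolynomial.map (starRingEnd ℂ) p ∈ harmonicPolynomials d i := by
    obtain ⟨h1, h2⟩ := mem_harmonicPolynomials.1 hp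
    refine mem_harmonicPolynomials.2 ⟨h1.map _, ?_⟩
    rw [laplacian_apply] at h2 ⊢
    simp only [MvPolynomial.pderiv_map]
    rw [← map_sum, h2, map_zero]
  have h1 := gaussMoment_mul_eq_zero hij hp' hq
  rw [gaussMoment_eq hd ((mem_harmonicPolynomials.1 hp').1.mul (mem_harmonicPolynomials.1 hq).1)]
    at h1
  have h2 := (mul_eq_zero.1 h1).resolve_left
    (Complex.ofReal_ne_zero.2 (integral_radial_pos hd _).ne')
  refine (ContinuousMap.inner_toLp (surface d) (polyOnSphere d p) (polyOnSphere d q)).trans ?_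
  rw [← h2]
  refine integral_congr_ae (Filter.Eventually.of_forall fun s => ?_)
  simp only [polyOnSphere, LinearMap.coe_mk, AddHom.coe_mk, ContinuousMap.coe_mk, map_mul,
    eval_map_conj (fun k => (s : Space d) k)]
  exact mul_comm _ _

/-! ### Parseval frames from a total set -/

section Parseval

variable {κ E : Type*} [NormedAddCommGroup E] [InnerProductSpace ℂ E] {ψ : κ → E} {S : Set E}

/-- The polarized identity is sesquilinear, so unlike the identity for squared norms it passes
directly from the generators to their span. -/
theorem hasSum_inner_mul_inner_of_mem_span
    (h : ∀ f ∈ S, ∀ g ∈ S, HasSum (fun x => inner ℂ f (ψ x) * inner ℂ (ψ x) g) (inner ℂ f g))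
    {f g : E} (hf : f ∈ Submodule.span ℂ S) (hg : g ∈ Submodule.span ℂ S) :
    HasSum (fun x => inner ℂ f (ψ x) * inner ℂ (ψ x) g) (inner ℂ f g) := by
  have key : ∀ f ∈ S, ∀ g ∈ Submodule.span ℂ S,
      HasSum (fun x => inner ℂ f (ψ x) * inner ℂ (ψ x) g) (inner ℂ f g) := by
    intro f hf g hg
    induction hg using Submodule.span_induction with
    | mem g hg => exact h f hf g hg
    | zero => simp
    | add g g' _ _ hg hg' => simpa only [inner_add_right, mul_add] using hg.add hg'
    | smul c g _ hg => simpa only [inner_smul_right, mul_left_comm] using hg.mul_left c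
  induction hf using Submodule.span_induction with
  | mem f hf => exact key f hf g hg
  | zero => simp
  | add f f' _ _ hf hf' => simpa only [inner_add_left, add_mul] using hf.add hf'
  | smul c f _ hf => simpa only [inner_smul_left, mul_assoc] using hf.mul_left (conj c)

theorem hasSum_norm_inner_sq_of_mem_span
    (h : ∀ f ∈ S, ∀ g ∈ S, HasSum (fun x => inner ℂ f (ψ x) * inner ℂ (ψ x) g) (inner ℂ f g))
    {f : E} (hf : f ∈ Submodule.span ℂ S) :
    HasSum (fun x => ‖inner ℂ f (ψ x)‖ ^ 2) (‖f‖ ^ 2) := by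
  have h1 := hasSum_inner_mul_inner_of_mem_span h hf hf
  rw [inner_self_eq_norm_sq_to_K] at h1
  rw [← Complex.hasSum_ofReal]
  have e : ∀ x, inner ℂ f (ψ x) * inner ℂ (ψ x) f = ((‖inner ℂ f (ψ x)‖ ^ 2 : ℝ) : ℂ) := by
    intro x
    rw [← inner_conj_symm (ψ x) f, Complex.mul_conj, Complex.normSq_eq_norm_sq]
  simp_rw [e] at h1
  refine hasSum_of_eq h1 ?_
  push_cast
  rfl

theorem dense_span_and_sum_norm_inner_sq_le [CompleteSpace E] (hS : ∀ v : E, (∀ f ∈ S, inner ℂ f v = 0) → v = 0)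
    (h : ∀ f ∈ S, ∀ g ∈ S, HasSum (fun x => inner ℂ f (ψ x) * inner ℂ (ψ x) g) (inner ℂ f g)) :
    Dense (Submodule.span ℂ S : Set E) ∧
      ∀ (f : E) (s : Finset κ), ∑ x ∈ s, ‖inner ℂ f (ψ x)‖ ^ 2 ≤ ‖f‖ ^ 2 := by
  have hD : Dense (Submodule.span ℂ S : Set E) := by
    rw [Submodule.dense_iff_topologicalClosure_eq_top, Submodule.topologicalClosure_eq_top_iff,
      Submodule.eq_bot_iff]
    exact fun v hv => hS v fun f hf => hv f (Submodule.subset_span hf)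
  refine ⟨hD, fun f s => ?_⟩
  -- Bessel's inequality for a fixed finite set of indices is a closed condition, so it extends from
  -- the dense span.
  have hc : IsClosed {f : E | ∑ x ∈ s, ‖inner ℂ f (ψ x)‖ ^ 2 ≤ ‖f‖ ^ 2} :=
    isClosed_le (by fun_prop) (by fun_prop)
  exact hc.closure_subset_iff.2 (fun g hg => sum_le_hasSum s (fun _ _ => sq_nonneg _)
    (hasSum_norm_inner_sq_of_mem_span h hg)) (hD f)

/-- Bessel's inequality makes the analysis operator `Θ : E → ℓ²` bounded. It is isometric on the
dense span, hence everywhere by continuity. -/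
theorem isParsevalFrame_of_total [CompleteSpace E]
    (hS : ∀ v : E, (∀ f ∈ S, inner ℂ f v = 0) → v = 0)
    (h : ∀ f ∈ S, ∀ g ∈ S, HasSum (fun x => inner ℂ f (ψ x) * inner ℂ (ψ x) g) (inner ℂ f g)) :
    IsParsevalFrame ψ := by
  obtain ⟨hD, hle⟩ := dense_span_and_sum_norm_inner_sq_le hS h
  have hmem : ∀ f : E, Memℓp (fun x => inner ℂ (ψ x) f) 2 := by
    intro f
    refine memℓp_gen ?_
    simp only [ENNReal.toReal_ofNat, Real.rpow_two, norm_inner_symm _ f]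
    exact summable_of_sum_le (fun _ => sq_nonneg _) (hle f)
  have hsum : ∀ f : E, HasSum (fun x => ‖inner ℂ f (ψ x)‖ ^ 2)
      (‖(⟨_, hmem f⟩ : lp (fun _ : κ => ℂ) 2)‖ ^ 2) := by
    intro f
    have := lp.hasSum_norm (p := 2) (by norm_num) (⟨_, hmem f⟩ : lp (fun _ : κ => ℂ) 2)
    simpa only [ENNReal.toReal_ofNat, Real.rpow_two, norm_inner_symm _ f] using this
  let Θ : E →L[ℂ] lp (fun _ : κ => ℂ) 2 := LinearMap.mkContinuous
    { toFun := fun f => ⟨_, hmem f⟩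
      map_add' := fun f g => Subtype.ext (funext fun x => inner_add_right (ψ x) f g)
      map_smul' := fun c f => Subtype.ext (funext fun x => inner_smul_right (ψ x) f c) } 1
      (fun f => by
        rw [one_mul]
        exact (sq_le_sq₀ (norm_nonneg _) (norm_nonneg _)).1
          (hasSum_le_of_sum_le (hsum f) (hle f)))
  have hΘ : ∀ f, ‖Θ f‖ ^ 2 = ‖f‖ ^ 2 := fun f => congrFun (Continuous.ext_on hD
    (f := fun f => ‖Θ f‖ ^ 2) (g := fun f => ‖f‖ ^ 2) (by fun_prop) (by fun_prop)
    fun g hg => (hsum g).unique (hasSum_norm_inner_sq_of_mem_span h hg)) f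
  intro f
  rw [← hΘ f]
  exact hsum f

end Parseval

/-! ### Functions and frames adapted to a decomposition of the sphere -/

theorem measurable_zeroExt (φ : L2Pos) : Measurable (zeroExt φ) :=
  (Lp.stronglyMeasurable φ).measurable.indicator measurableSet_Ioi

theorem zeroExt_of_pos (φ : L2Pos) {ω : ℝ} (hω : 0 < ω) : zeroExt φ ω = φ ω :=
  indicator_of_mem (mem_Ioi.2 hω) _

theorem lintegral_zeroExt_ne_top (φ : L2Pos) : ∫⁻ ω, ‖zeroExt φ ω‖ₑ ^ 2 ≠ ∞ := by
  have h1 : ∀ ω, ‖zeroExt φ ω‖ₑ ^ 2 = (Ioi (0 : ℝ)).indicator (fun ω => ‖φ ω‖ₑ ^ 2) ω := by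
    intro ω
    by_cases hω : ω ∈ Ioi (0 : ℝ)
    · rw [zeroExt, indicator_of_mem hω, indicator_of_mem hω]
    · simp [zeroExt, indicator_of_notMem hω]
  simp_rw [h1]
  rw [lintegral_indicator measurableSet_Ioi]
  exact (memLp_two_iff_lintegral.1 (Lp.memLp φ)).2.ne

theorem dyadicBlock_mono {M N : ℕ} (h : M ≤ N) : dyadicBlock M ⊆ dyadicBlock N :=
  Icc_subset_Icc (zpow_le_zpow_right₀ one_le_two (by omega))
    (zpow_le_zpow_right₀ one_le_two (by omega))

/-- If all inner products with `sphericalLift h Y` are those of `c • φ`, then the radial slice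
against `Y` is `c • φ`. -/
theorem sliceCoeff_ae_eq_of_inner {d : ℕ} (hd : 1 ≤ d) {Y : L2Sphere d} {g : L2Space d}
    {φ : L2Pos} {c : ℂ} (h : ∀ h : L2Pos, inner ℂ (sphericalLift hd h Y) g = c * inner ℂ h φ) :
    ∀ᵐ ω ∂(volume.restrict (Ioi (0 : ℝ))), sliceCoeff g Y ω = c * φ ω := by
  have hL := memLp_sliceCoeff hd g Y
  have heq : hL.toLp _ = c • φ := by
    refine ext_inner_left ℂ fun u => ?_
    rw [inner_smul_right, ← h u, inner_sphericalLift, L2.inner_def]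
    refine integral_congr_ae ?_
    filter_upwards [hL.coeFn_toLp] with ω hω
    rw [hω, RCLike.inner_apply, mul_comm]
  have h1 := hL.coeFn_toLp
  rw [heq] at h1
  filter_upwards [h1, Lp.coeFn_smul c φ] with ω h1 h2
  rw [← h1, h2, Pi.smul_apply, smul_eq_mul]

/-- A decomposition of `L²(S^{d-1})` into an orthogonal sum of isometric copies of Hilbert
spaces. -/
structure SphereDecomposition {d : ℕ} {P : Type*} (V : P → Type*)
    [∀ p, NormedAddCommGroup (V p)] [∀ p, InnerProductSpace ℂ (V p)]
    (y : ∀ p, V p →ₗ[ℂ] L2Sphere d) : Prop where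
  inner_same : ∀ p e e', inner ℂ (y p e) (y p e') = inner ℂ e e'
  inner_ne : ∀ p p', p ≠ p' → ∀ e e', inner ℂ (y p e) (y p' e') = 0
  total : ∀ v, (∀ p e, inner ℂ (y p e) v = 0) → v = 0

namespace SphereDecomposition

variable {d : ℕ} {P : Type*} {V : P → Type*}
  [∀ p, NormedAddCommGroup (V p)] [∀ p, InnerProductSpace ℂ (V p)] {y : ∀ p, V p →ₗ[ℂ] L2Sphere d}

theorem eq_zero_of_slices [Countable P] [∀ p, FiniteDimensional ℂ (V p)]
    (hy : SphereDecomposition V y) (hd : 1 ≤ d) {g : L2Space d}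
    (hg : ∀ p e, ∀ᵐ ω ∂(volume.restrict (Ioi (0 : ℝ))), sliceCoeff g (y p e) ω = 0) : g = 0 := by
  refine eq_zero_of_sliceCoeff hd
    (fun x : (Σ p, Fin (Module.finrank ℂ (V p))) => y x.1 (Module.finBasis ℂ (V x.1) x.2))
    (fun v hv => hy.total v fun p e => ?_) g (fun x => hg _ _)
  rw [← (Module.finBasis ℂ (V p)).sum_repr e, map_sum, sum_inner]
  refine Finset.sum_eq_zero fun k _ => ?_
  rw [map_smul, inner_smul_left, hv ⟨p, k⟩, mul_zero]

theorem eq_of_slices [Countable P] [∀ p, FiniteDimensional ℂ (V p)]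
    (hy : SphereDecomposition V y) (hd : 1 ≤ d) {w : ∀ p, V p} {φ : P → L2Pos}
    {g g' : L2Space d}
    (hg : ∀ p e, ∀ᵐ ω ∂(volume.restrict (Ioi (0 : ℝ))),
      sliceCoeff g (y p e) ω = inner ℂ e (w p) * φ p ω)
    (hg' : ∀ p e, ∀ᵐ ω ∂(volume.restrict (Ioi (0 : ℝ))),
      sliceCoeff g' (y p e) ω = inner ℂ e (w p) * φ p ω) : g = g' := by
  rw [← sub_eq_zero]
  refine hy.eq_zero_of_slices hd fun p e => sliceCoeff_eq_zero_of_inner hd _ _ fun M A hAm hA => ?_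
  rw [inner_sub_right, sub_eq_zero, inner_sphericalLift, inner_sphericalLift]
  refine integral_congr_ae ?_
  filter_upwards [hg p e, hg' p e] with ω h1 h2
  rw [h1, h2]

/-- The function is the sum of the lifts `φ_p ⊗ y_p(w_p)`. These are mutually orthogonal, so the
series converges exactly when the squared norms `‖w_p‖² ‖φ_p‖²` are summable. -/
theorem exists_slices (hy : SphereDecomposition V y) (hd : 1 ≤ d) (w : ∀ p, V p) (φ : P → L2Pos)
    (hs : Summable fun p => ‖w p‖ ^ 2 * ‖φ p‖ ^ 2) :
    ∃ g : L2Space d, ∀ p e, ∀ᵐ ω ∂(volume.restrict (Ioi (0 : ℝ))),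
      sliceCoeff g (y p e) ω = inner ℂ e (w p) * φ p ω := by
  let x : P → L2Space d := fun p => sphericalLift hd (φ p) (y p (w p))
  have horth : OrthogonalFamily ℂ (fun p => Submodule.span ℂ {x p})
      fun p => (Submodule.span ℂ {x p}).subtypeₗᵢ := by
    rintro p p' hp ⟨u, hu⟩ ⟨v, hv⟩
    obtain ⟨a, rfl⟩ := Submodule.mem_span_singleton.1 hu
    obtain ⟨b, rfl⟩ := Submodule.mem_span_singleton.1 hv
    simp [inner_smul_left, inner_smul_right, x, inner_sphericalLift_sphericalLift,
      hy.inner_ne p p' hp]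
  have hnorm : ∀ p, ‖x p‖ ^ 2 = ‖w p‖ ^ 2 * ‖φ p‖ ^ 2 := by
    intro p
    have h := inner_sphericalLift_sphericalLift hd (φ p) (φ p) (y p (w p)) (y p (w p))
    rw [hy.inner_same, inner_self_eq_norm_sq_to_K, inner_self_eq_norm_sq_to_K,
      inner_self_eq_norm_sq_to_K, mul_comm] at h
    exact_mod_cast h
  have hsum : Summable x := by
    refine (horth.summable_iff_norm_sq_summable
      fun p => ⟨x p, Submodule.mem_span_singleton_self _⟩).2 ?_
    simpa only [Submodule.coe_norm, hnorm] using hs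
  refine ⟨∑' p, x p, fun p e => sliceCoeff_ae_eq_of_inner hd fun h => ?_⟩
  rw [← innerSL_apply_apply ℂ, ContinuousLinearMap.map_tsum _ hsum, tsum_eq_single p]
  · rw [innerSL_apply_apply, inner_sphericalLift_sphericalLift, hy.inner_same, mul_comm]
  · intro p' hp'
    rw [innerSL_apply_apply, inner_sphericalLift_sphericalLift, hy.inner_ne p p' hp'.symm,
      mul_zero]

variable {F : Subgroup (SO d)} {σ : ∀ p, Representation ℂ F (V p)}

/-- The separation of variables: against a test function `1_A ⊗ y_p(e)` the rotation enters only
through a matrix coefficient, and `(j, k)` only through a wavelet coefficient. -/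
theorem inner_schrodingerRep (hd : 1 ≤ d)
    (hσ : ∀ p g v, ‖σ p g v‖ = ‖v‖)
    (hrep : ∀ p (R : F) e, y p (σ p R e) = regularRep (R : SO d) (y p e))
    {w : ∀ p, V p} {φ : P → L2Pos} {η : L2Space d}
    (hη : ∀ p e, ∀ᵐ ω ∂(volume.restrict (Ioi (0 : ℝ))),
      sliceCoeff (𝓕 η) (y p e) ω = inner ℂ e (w p) * φ p ω)
    {M : ℕ} {A : Set ℝ} (hAm : MeasurableSet A) (hA : A ⊆ dyadicBlock M) (p : P) (e : V p)
    (j k : ℤ) (R : F) :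
    inner ℂ (𝓕⁻ (sphericalLift hd (indicatorPos hAm hA) (y p e)))
      (schrodingerRep ((2 : ℝ) ^ j * k) ((2 : ℝ) ^ j) (zpow_pos two_pos j) (R : SO d) η) =
      inner ℂ e (σ p R (w p)) * waveletCoeff A (zeroExt (φ p)) j k := by
  have hsub : A ⊆ Ioi 0 := fun x hx => pos_of_mem_dyadicBlock (hA hx)
  have hinv : σ p R (σ p R⁻¹ e) = e := by
    rw [← Module.End.mul_apply, ← map_mul, mul_inv_cancel, map_one, Module.End.one_apply]
  have hinner : inner ℂ (σ p R⁻¹ e) (w p) = inner ℂ e (σ p R (w p)) := by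
    have := (⟨σ p R, hσ p R⟩ : V p →ₗᵢ[ℂ] V p).inner_map_map (σ p R⁻¹ e) (w p)
    rw [← this, LinearIsometry.coe_mk, hinv]
  rw [← Lp.inner_fourier_eq, FourierTransform.fourier_fourierInv_eq,
    inner_sphericalLift_indicatorPos, waveletCoeff, ← integral_const_mul]
  refine integral_congr_ae ?_
  filter_upwards [ae_restrict_of_ae_restrict_of_subset hsub
      (sphereClass_fourier_schrodingerRep hd ((2 : ℝ) ^ j * k) (zpow_pos two_pos j) (R : SO d) η),
    ae_restrict_of_ae (ae_comp_mul_left (hη p (σ p R⁻¹ e)) (zpow_pos two_pos j)),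
    ae_restrict_mem hAm] with ω h1 h2 hω
  have hpos : 0 < ω := hsub hω
  rw [sliceCoeff, h1, inner_smul_right]
  -- Writing `e = σ(R) σ(R⁻¹) e` exposes the same rotation on both sides of the inner product, where
  -- unitarity cancels it.
  nth_rewrite 1 [← hinv]
  rw [hrep, inner_regularRep, ← sliceCoeff, h2 hpos, hinner,
    zeroExt_of_pos _ (mul_pos (two_zpow_pos j) hpos), expChar,
    show 2 * Real.pi * ((2 : ℝ) ^ j * k) * ω = 2 * Real.pi * k * (2 ^ j * ω) by ring]
  ring

/-- On a pair of test functions the frame sum is the product of a wavelet sum and a group sum. For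
`p = p'` the constants `C` and `C⁻¹` cancel; for `p ≠ p'` each pair needs only one of the two sums
to vanish. -/
theorem isParsevalFrame [Countable P] [∀ p, FiniteDimensional ℂ (V p)] [Finite F]
    (hy : SphereDecomposition V y) (hd : 1 ≤ d)
    (hσ : ∀ p g v, ‖σ p g v‖ = ‖v‖)
    (hrep : ∀ p (R : F) e, y p (σ p R e) = regularRep (R : SO d) (y p e))
    {w : ∀ p, V p} {φ : P → L2Pos} {η : L2Space d}
    (hη : ∀ p e, ∀ᵐ ω ∂(volume.restrict (Ioi (0 : ℝ))),
      sliceCoeff (𝓕 η) (y p e) ω = inner ℂ e (w p) * φ p ω)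
    {C : ℝ} (hC : ∀ p, CalderonPair (zeroExt (φ p)) (zeroExt (φ p)) C)
    (hschur : ∀ p e e', HasSum (fun R : F => inner ℂ e (σ p R (w p)) *
      conj (inner ℂ e' (σ p R (w p)))) ((C : ℂ)⁻¹ * inner ℂ e e'))
    (hC0 : C ≠ 0)
    (hcross : ∀ p p', p ≠ p' → CalderonPair (zeroExt (φ p)) (zeroExt (φ p')) 0 ∨
      ∀ e e', HasSum (fun R : F => inner ℂ e (σ p R (w p)) *
        conj (inner ℂ e' (σ p' R (w p')))) 0) :
    IsParsevalFrame (fun x : ℤ × ℤ × F =>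
      schrodingerRep ((2 : ℝ) ^ x.1 * x.2.1) ((2 : ℝ) ^ x.1) (zpow_pos two_pos x.1)
        (x.2.2 : SO d) η) := by
  let S : Set (L2Space d) := {f | ∃ (p : P) (e : V p) (M : ℕ) (A : Set ℝ) (hAm : MeasurableSet A)
    (hA : A ⊆ dyadicBlock M), f = 𝓕⁻ (sphericalLift hd (indicatorPos hAm hA) (y p e))}
  refine isParsevalFrame_of_total (S := S) (fun v hv => ?_) ?_
  · have h0 : 𝓕 v = 0 := hy.eq_zero_of_slices hd fun p e =>
      sliceCoeff_eq_zero_of_inner hd _ _ fun M A hAm hA => by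
        have := hv _ ⟨p, e, M, A, hAm, hA, rfl⟩
        rwa [← Lp.inner_fourier_eq, FourierTransform.fourier_fourierInv_eq] at this
    rw [← norm_eq_zero, ← Lp.norm_fourier_eq, h0, norm_zero]
  · rintro _ ⟨p, e, M, A, hAm, hA', rfl⟩ _ ⟨p', e', M', B, hBm, hB', rfl⟩
    have hA : A ⊆ dyadicBlock (max M M') := hA'.trans (dyadicBlock_mono (le_max_left _ _))
    have hB : B ⊆ dyadicBlock (max M M') := hB'.trans (dyadicBlock_mono (le_max_right _ _))
    let a : ℤ × ℤ → ℂ := fun x => waveletCoeff A (zeroExt (φ p)) x.1 x.2 *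
      conj (waveletCoeff B (zeroExt (φ p')) x.1 x.2)
    let b : F → ℂ := fun R => inner ℂ e (σ p R (w p)) * conj (inner ℂ e' (σ p' R (w p')))
    have hterm : ∀ x : ℤ × ℤ × F,
        inner ℂ (𝓕⁻ (sphericalLift hd (indicatorPos hAm hA') (y p e)))
          (schrodingerRep ((2 : ℝ) ^ x.1 * x.2.1) ((2 : ℝ) ^ x.1) (zpow_pos two_pos x.1)
            (x.2.2 : SO d) η) *
        inner ℂ (schrodingerRep ((2 : ℝ) ^ x.1 * x.2.1) ((2 : ℝ) ^ x.1) (zpow_pos two_pos x.1)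
            (x.2.2 : SO d) η) (𝓕⁻ (sphericalLift hd (indicatorPos hBm hB') (y p' e'))) =
        a (x.1, x.2.1) * b x.2.2 := by
      intro x
      rw [← inner_conj_symm (schrodingerRep _ _ _ _ η),
        inner_schrodingerRep hd hσ hrep hη, inner_schrodingerRep hd hσ hrep hη, map_mul]
      ring
    have hprod : ∀ {s t : ℂ}, HasSum a s → HasSum b t →
        HasSum (fun x : ℤ × ℤ × F => a (x.1, x.2.1) * b x.2.2) (s * t) := by
      intro s t hs ht
      have h := hs.mul ht (summable_mul_of_summable_norm hs.summable.norm ht.summable.norm)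
      exact (Equiv.prodAssoc ℤ ℤ F).symm.hasSum_iff.2 h
    have hval : inner ℂ (𝓕⁻ (sphericalLift hd (indicatorPos hAm hA') (y p e)))
        (𝓕⁻ (sphericalLift hd (indicatorPos hBm hB') (y p' e'))) =
        (volume.real (A ∩ B) : ℂ) * inner ℂ (y p e) (y p' e') := by
      rw [← Lp.inner_fourier_eq, FourierTransform.fourier_fourierInv_eq,
        FourierTransform.fourier_fourierInv_eq, inner_sphericalLift_sphericalLift,
        inner_indicatorPos]
    have hm := fun p => measurable_zeroExt (φ p)
    have hl := fun p => lintegral_zeroExt_ne_top (φ p)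
    simp_rw [hterm]
    rw [hval]
    by_cases hp : p = p'
    · subst hp
      refine hasSum_of_eq (hprod ((hC p).hasSum_waveletCoeff (hC p) (hC p) (hm p) (hl p) (hm p)
        (hl p) hAm hBm hA hB) (hschur p e e')) ?_
      have : (C : ℂ) ≠ 0 := Complex.ofReal_ne_zero.2 hC0
      rw [hy.inner_same]
      field_simp
    · rw [hy.inner_ne p p' hp, mul_zero]
      -- One factor sums to zero; of the other only convergence is needed.
      rcases hcross p p' hp with h | h
      · have hsum : Summable b := Summable.of_finite
        refine hasSum_of_eq (hprod (h.hasSum_waveletCoeff (hC p) (hC p') (hm p) (hl p) (hm p')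
          (hl p') hAm hBm hA hB) hsum.hasSum) ?_
        rw [zero_mul, zero_mul]
      · refine hasSum_of_eq (hprod ((hC p).summable_waveletCoeff (hC p') (hm p) (hl p) (hm p')
          (hl p') hAm hBm hA hB).hasSum (h e e')) ?_
        rw [mul_zero]

end SphereDecomposition

/-! ### The isotypic decomposition of the spherical harmonics -/

namespace Isotypic

variable {X : Type*} {H : X → Type*} [∀ χ, NormedAddCommGroup (H χ)] {m : X → ℕ}

theorem tensor_apply_same (χ : X) (μ : Fin (m χ)) (e : H χ) :
    (tensor χ μ e : Isotypic H m) ⟨χ, μ⟩ = e := by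
  simp [tensor]

theorem tensor_apply_of_ne (χ : X) (μ : Fin (m χ)) (e : H χ) {p : Σ χ : X, Fin (m χ)}
    (hp : p ≠ ⟨χ, μ⟩) : (tensor χ μ e : Isotypic H m) p = 0 := by
  simp [tensor, hp]

theorem sum_tensor [Fintype X] (x : Isotypic H m) : ∑ χ, ∑ μ, tensor χ μ (x ⟨χ, μ⟩) = x := by
  rw [← Fintype.sum_sigma (fun p : (Σ χ : X, Fin (m χ)) => tensor (m := m) p.1 p.2 (x p))]
  ext p
  rw [WithLp.ofLp_sum, Finset.sum_apply, Finset.sum_eq_single p]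
  · exact tensor_apply_same _ _ _
  · exact fun q _ hq => tensor_apply_of_ne _ _ _ hq.symm
  · exact fun h => absurd (Finset.mem_univ p) h

variable [∀ χ, InnerProductSpace ℂ (H χ)]

theorem inner_tensor_left [Fintype X] (χ : X) (μ : Fin (m χ)) (e : H χ) (x : Isotypic H m) :
    inner ℂ (tensor χ μ e) x = inner ℂ e (x ⟨χ, μ⟩) := by
  rw [PiLp.inner_apply, Finset.sum_eq_single (⟨χ, μ⟩ : Σ χ : X, Fin (m χ)), tensor_apply_same]
  · intro q _ hq
    rw [tensor_apply_of_ne _ _ _ hq, inner_zero_left]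
  · exact fun h => absurd (Finset.mem_univ _) h

theorem act_tensor {G : Type*} [Group G] (τ : ∀ χ, Representation ℂ G (H χ)) (g : G) (χ : X)
    (μ : Fin (m χ)) (e : H χ) : act τ g (tensor χ μ e : Isotypic H m) = tensor χ μ (τ χ g e) := by
  ext p
  by_cases hp : p = ⟨χ, μ⟩
  · subst hp
    simp only [act, tensor_apply_same]
  · simp only [act, tensor_apply_of_ne _ _ _ hp, map_zero]

/-- The isometric embedding `w ↦ w ⊗ ε_μ`, as a linear map. -/
def tensorₗ (χ : X) (μ : Fin (m χ)) : H χ →ₗ[ℂ] Isotypic H m where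
  toFun := tensor χ μ
  map_add' e e' := by
    ext p
    by_cases hp : p = ⟨χ, μ⟩
    · subst hp
      simp only [PiLp.add_apply, tensor_apply_same]
    · simp only [PiLp.add_apply, tensor_apply_of_ne _ _ _ hp, add_zero]
  map_smul' c e := by
    ext p
    by_cases hp : p = ⟨χ, μ⟩
    · subst hp
      simp only [PiLp.smul_apply, tensor_apply_same, RingHom.id_apply]
    · simp only [PiLp.smul_apply, tensor_apply_of_ne _ _ _ hp, smul_zero]

end Isotypic

section Harmonics

variable {d : ℕ} {X : Type*} [Fintype X] {H : X → Type*} [∀ χ, NormedAddCommGroup (H χ)]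
  [∀ χ, InnerProductSpace ℂ (H χ)] {m : ℕ → X → ℕ}

/-- The copy of `H χ` in `L²(S^{d-1})` which corresponds to `H χ ⊗ ε_μ` in the spherical harmonics
of degree `i`. -/
def harmonicEmbedding (T : ∀ i, Isotypic H (m i) ≃ₗᵢ[ℂ] sphericalHarmonics d i)
    (p : Σ i : ℕ, Σ χ : X, Fin (m i χ)) : H p.2.1 →ₗ[ℂ] L2Sphere d :=
  (sphericalHarmonics d p.1).subtype ∘ₗ (T p.1).toLinearEquiv.toLinearMap ∘ₗ
    Isotypic.tensorₗ p.2.1 p.2.2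

variable {T : ∀ i, Isotypic H (m i) ≃ₗᵢ[ℂ] sphericalHarmonics d i}

theorem harmonicEmbedding_apply (p : Σ i : ℕ, Σ χ : X, Fin (m i χ)) (e : H p.2.1) :
    harmonicEmbedding T p e = T p.1 (Isotypic.tensor p.2.1 p.2.2 e) := rfl

/-- Within one degree orthogonality is that of the summands of `Isotypic`, carried over by the
isometry `T i`; across degrees it is that of spherical harmonics. Totality holds because the copies
in degree `i` span all of `sphericalHarmonics d i`. -/
theorem sphereDecomposition_harmonicEmbedding (hd : 1 ≤ d) :
    SphereDecomposition (fun p : (Σ i : ℕ, Σ χ : X, Fin (m i χ)) => H p.2.1)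
      (harmonicEmbedding T) where
  inner_same p e e' := by
    rw [harmonicEmbedding_apply, harmonicEmbedding_apply, ← Submodule.coe_inner,
      LinearIsometryEquiv.inner_map_map, Isotypic.inner_tensor_left, Isotypic.tensor_apply_same]
  inner_ne p p' hp e e' := by
    obtain ⟨i, q⟩ := p
    obtain ⟨i', q'⟩ := p'
    by_cases hi : i = i'
    · subst hi
      have hq : q ≠ q' := fun h => hp (by rw [h])
      rw [harmonicEmbedding_apply, harmonicEmbedding_apply, ← Submodule.coe_inner,
        LinearIsometryEquiv.inner_map_map, Isotypic.inner_tensor_left,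
        Isotypic.tensor_apply_of_ne _ _ _ hq, inner_zero_right]
    · exact inner_sphericalHarmonics_eq_zero hd hi (Subtype.coe_prop _) (Subtype.coe_prop _)
  total v hv := by
    refine eq_zero_of_inner_sphericalHarmonics hd fun i u hu => ?_
    obtain ⟨x, hx⟩ := (T i).surjective ⟨u, hu⟩
    have hu' : u = ∑ χ, ∑ μ, harmonicEmbedding T ⟨i, χ, μ⟩ (x ⟨χ, μ⟩) := by
      have hx' : (T i x : L2Sphere d) = u := congrArg Subtype.val hx
      rw [← hx']
      conv_lhs => rw [← Isotypic.sum_tensor x]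
      simp [harmonicEmbedding_apply]
    simp [hu', sum_inner, hv]

theorem harmonicEmbedding_rep {F : Subgroup (SO d)} {τ : ∀ χ, Representation ℂ F (H χ)}
    (hT : ∀ (i : ℕ) (R : F) (x : Isotypic H (m i)),
      (T i (Isotypic.act τ R x) : L2Sphere d) = regularRep (R : SO d) (T i x))
    (p : Σ i : ℕ, Σ χ : X, Fin (m i χ)) (R : F) (e : H p.2.1) :
    harmonicEmbedding T p (τ p.2.1 R e) = regularRep (R : SO d) (harmonicEmbedding T p e) := by
  rw [harmonicEmbedding_apply, harmonicEmbedding_apply, ← hT, Isotypic.act_tensor]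

theorem inner_harmonicEmbedding_sphereClass (η : L2Space d) (i : ℕ) (χ : X) (μ : Fin (m i χ))
    (e : H χ) (ω : ℝ) :
    inner ℂ (T i (Isotypic.tensor χ μ e)) (radialComponent η i ω) =
      sliceCoeff (𝓕 η) (harmonicEmbedding T ⟨i, χ, μ⟩ e) ω := by
  rw [radialComponent, sliceCoeff, harmonicEmbedding_apply]
  exact Submodule.inner_orthogonalProjectionOnto_eq_of_mem_left _ _

theorem sum_smul_tensor (i : ℕ) (c : ∀ χ, Fin (m i χ) → ℂ) (v : ∀ χ, Fin (m i χ) → H χ) :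
    ∑ χ, ∑ μ, c χ μ • T i (Isotypic.tensor χ μ (v χ μ)) =
      T i (WithLp.toLp 2 fun q => c q.1 q.2 • v q.1 q.2) := by
  rw [← Isotypic.sum_tensor (WithLp.toLp 2 fun q => c q.1 q.2 • v q.1 q.2), map_sum]
  refine Finset.sum_congr rfl fun χ _ => ?_
  rw [map_sum]
  refine Finset.sum_congr rfl fun μ _ => ?_
  rw [← map_smul]
  exact congrArg _ ((Isotypic.tensorₗ χ μ).map_smul _ _).symm

/-- A finite basis of `V` lets the quantifier over the uncountably many `e` move inside a single
null set. -/
theorem ae_forall_slices {V : Type*} [NormedAddCommGroup V] [InnerProductSpace ℂ V]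
    [FiniteDimensional ℂ V] {Y : V →ₗ[ℂ] L2Sphere d} {g : L2Space d} {w : V} {c : ℝ → ℂ}
    (h : ∀ e, ∀ᵐ ω ∂(volume.restrict (Ioi (0 : ℝ))), sliceCoeff g (Y e) ω = inner ℂ e w * c ω) :
    ∀ᵐ ω ∂(volume.restrict (Ioi (0 : ℝ))), ∀ e, sliceCoeff g (Y e) ω = inner ℂ e w * c ω := by
  filter_upwards [ae_all_iff.2 fun k => h (Module.finBasis ℂ V k)] with ω hω
  intro e
  rw [← (Module.finBasis ℂ V).sum_repr e, map_sum, sliceCoeff, sum_inner, sum_inner,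
    Finset.sum_mul]
  refine Finset.sum_congr rfl fun k _ => ?_
  rw [map_smul, inner_smul_left, inner_smul_left, ← sliceCoeff, hω k, mul_assoc]

/-- The prescription of `(S η)_i`, an identity between vectors of `H_i`, is tested against the
vectors `e ⊗ ε_μ`, giving the scalar identities in which existence, uniqueness and the frame
property are handled. -/
theorem radialComponent_iff_slices [∀ χ, FiniteDimensional ℂ (H χ)]
    (v : ∀ i χ, Fin (m i χ) → H χ) (φ : ∀ i χ, Fin (m i χ) → L2Pos) (η : L2Space d) :
    (∀ i, ∀ᵐ ω ∂(volume.restrict (Ioi (0 : ℝ))), radialComponent η i ω =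
        ∑ χ, ∑ μ : Fin (m i χ), φ i χ μ ω • T i (Isotypic.tensor χ μ (v i χ μ))) ↔
      ∀ (p : Σ i : ℕ, Σ χ : X, Fin (m i χ)) (e : H p.2.1),
        ∀ᵐ ω ∂(volume.restrict (Ioi (0 : ℝ))), sliceCoeff (𝓕 η) (harmonicEmbedding T p e) ω =
          inner ℂ e (v p.1 p.2.1 p.2.2) * φ p.1 p.2.1 p.2.2 ω := by
  constructor
  · rintro h ⟨i, χ, μ⟩ e
    filter_upwards [h i] with ω hω
    rw [← inner_harmonicEmbedding_sphereClass, hω,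
      sum_smul_tensor i (fun χ μ => φ i χ μ ω) (v i), LinearIsometryEquiv.inner_map_map,
      Isotypic.inner_tensor_left, inner_smul_right, mul_comm]
  · intro h i
    filter_upwards [ae_all_iff.2 fun q : (Σ χ : X, Fin (m i χ)) =>
      ae_forall_slices (h ⟨i, q⟩)] with ω hω
    refine ext_inner_left ℂ fun u => ?_
    obtain ⟨x, rfl⟩ := (T i).surjective u
    rw [sum_smul_tensor i (fun χ μ => φ i χ μ ω) (v i), ← Isotypic.sum_tensor x]
    simp only [map_sum, sum_inner]
    refine Finset.sum_congr rfl fun χ _ => Finset.sum_congr rfl fun μ _ => ?_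
    rw [inner_harmonicEmbedding_sphereClass, hω ⟨χ, μ⟩, LinearIsometryEquiv.inner_map_map,
      Isotypic.inner_tensor_left, inner_smul_right, mul_comm]

end Harmonics

end Schrodingerlet

end

/-! ### The main theorem -/

open Schrodingerlet in
theorem theorem3 {d : ℕ} (hd : 1 ≤ d)
    -- a finite subgroup `F` of `SO(d)`, of cardinality `L = Nat.card F`
    (F : Subgroup (SO d)) [Finite F]
    -- representatives `τ χ` of the classes of irreducible unitary representations of `F`
    {X : Type*} [Fintype X] (H : X → Type*)
    [∀ χ, NormedAddCommGroup (H χ)] [∀ χ, InnerProductSpace ℂ (H χ)]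
    [∀ χ, FiniteDimensional ℂ (H χ)]
    (τ : ∀ χ, Representation ℂ F (H χ)) (hτ : IsUnitaryDual τ)
    -- the decomposition of each space of spherical harmonics into irreducibles under `F`
    (m : ℕ → X → ℕ)
    (T : ∀ i, Isotypic H (m i) ≃ₗᵢ[ℂ] sphericalHarmonics d i)
    (hT : ∀ (i : ℕ) (R : F) (x : Isotypic H (m i)),
      (T i (Isotypic.act τ R x) : L2Sphere d) = regularRep (R : SO d) (T i x))
    -- orthogonal bases of the spaces `H χ`, and the choices of indices in them
    (w : ∀ χ, Fin (Module.finrank ℂ (H χ)) → H χ)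
    (hw_orth : ∀ χ δ δ', δ ≠ δ' → inner ℂ (w χ δ) (w χ δ') = 0)
    (hw_norm : ∀ χ δ, ‖w χ δ‖ ^ 2 = Module.finrank ℂ (H χ))
    (δ : ∀ i χ, Fin (m i χ) → Fin (Module.finrank ℂ (H χ)))
    -- the one-dimensional functions
    (φ : ∀ i χ, Fin (m i χ) → L2Pos)
    (h_summable : Summable fun p : (Σ i : ℕ, Σ χ : X, Fin (m i χ)) =>
      (Module.finrank ℂ (H p.2.1) : ℝ) * ‖φ p.1 p.2.1 p.2.2‖ ^ 2)
    (h_diag : ∀ i χ (μ : Fin (m i χ)), ∀ᵐ ω ∂(volume.restrict (Ioi (0 : ℝ))),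
      HasSum (fun j : ℤ => ‖zeroExt (φ i χ μ) (2 ^ j * ω)‖ ^ 2) (1 / (Nat.card F : ℝ)))
    (h_diag_odd : ∀ i χ (μ : Fin (m i χ)) (n : ℤ), Odd n →
      ∀ᵐ ω ∂(volume.restrict (Ioi (0 : ℝ))),
        HasSum (fun j : ℕ => zeroExt (φ i χ μ) (2 ^ j * ω) *
          conj (zeroExt (φ i χ μ) (2 ^ j * (ω + n)))) 0)
    (h_cross : ∀ χ i i' (μ : Fin (m i χ)) (μ' : Fin (m i' χ)),
      (⟨i, μ⟩ : Σ i, Fin (m i χ)) ≠ ⟨i', μ'⟩ → w χ (δ i χ μ) = w χ (δ i' χ μ') →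
      ∀ᵐ ω ∂(volume.restrict (Ioi (0 : ℝ))),
        HasSum (fun j : ℤ => zeroExt (φ i χ μ) (2 ^ j * ω) *
          conj (zeroExt (φ i' χ μ') (2 ^ j * ω))) 0)
    (h_cross_odd : ∀ χ i i' (μ : Fin (m i χ)) (μ' : Fin (m i' χ)),
      (⟨i, μ⟩ : Σ i, Fin (m i χ)) ≠ ⟨i', μ'⟩ → w χ (δ i χ μ) = w χ (δ i' χ μ') →
      ∀ n : ℤ, Odd n → ∀ᵐ ω ∂(volume.restrict (Ioi (0 : ℝ))),
        HasSum (fun j : ℕ => zeroExt (φ i χ μ) (2 ^ j * ω) *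
          conj (zeroExt (φ i' χ μ') (2 ^ j * (ω + n)))) 0) :
    -- there is exactly one `η` with the prescribed components `(S η)_i`
    (∃! η : L2Space d, ∀ i, ∀ᵐ ω ∂(volume.restrict (Ioi (0 : ℝ))),
      radialComponent η i ω =
        ∑ χ, ∑ μ : Fin (m i χ), φ i χ μ ω • T i (Isotypic.tensor χ μ (w χ (δ i χ μ)))) ∧
    -- and it generates a Parseval frame
    ∀ η : L2Space d, (∀ i, ∀ᵐ ω ∂(volume.restrict (Ioi (0 : ℝ))),
      radialComponent η i ω =
        ∑ χ, ∑ μ : Fin (m i χ), φ i χ μ ω • T i (Isotypic.tensor χ μ (w χ (δ i χ μ)))) →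
      IsParsevalFrame (fun x : ℤ × ℤ × F =>
        schrodingerRep ((2 : ℝ) ^ x.1 * x.2.1) ((2 : ℝ) ^ x.1) (zpow_pos two_pos x.1)
          (x.2.2 : SO d) η) := by
  have hd0 : (Nat.card F : ℂ) ≠ 0 := Nat.cast_ne_zero.2 Nat.card_pos.ne'
  -- The dimension is positive because the index `δ` chosen for `p` is an element of `Fin` of it.
  have hfin : ∀ p : (Σ i : ℕ, Σ χ : X, Fin (m i χ)),
      (Module.finrank ℂ (H p.2.1) : ℂ) ≠ 0 := fun p =>
    Nat.cast_ne_zero.2 (Fin.pos (δ p.1 p.2.1 p.2.2)).ne'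
  have hdec : SphereDecomposition (fun p : (Σ i : ℕ, Σ χ : X, Fin (m i χ)) => H p.2.1)
      (harmonicEmbedding T) := sphereDecomposition_harmonicEmbedding hd
  refine ⟨?_, fun η hη => ?_⟩
  · obtain ⟨g, hg⟩ := hdec.exists_slices hd (fun p => w p.2.1 (δ p.1 p.2.1 p.2.2))
      (fun p => φ p.1 p.2.1 p.2.2) (by simpa only [hw_norm] using h_summable)
    refine ⟨𝓕⁻ g, (radialComponent_iff_slices (fun i χ μ => w χ (δ i χ μ)) φ _).2 ?_,
      fun η hη => ?_⟩
    · simpa only [FourierTransform.fourier_fourierInv_eq] using hg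
    · rw [← hdec.eq_of_slices hd
        ((radialComponent_iff_slices (fun i χ μ => w χ (δ i χ μ)) φ η).1 hη) hg,
        FourierTransform.fourierInv_fourier_eq]
  · refine hdec.isParsevalFrame hd (σ := fun p => τ p.2.1) (C := 1 / (Nat.card F : ℝ))
      (w := fun p => w p.2.1 (δ p.1 p.2.1 p.2.2)) (φ := fun p => φ p.1 p.2.1 p.2.2)
      (fun p => hτ.unitary p.2.1) (harmonicEmbedding_rep hT)
      ((radialComponent_iff_slices (fun i χ μ => w χ (δ i χ μ)) φ η).1 hη) ?_ ?_ ?_ ?_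
    · refine fun p => ⟨?_, fun n hn => h_diag_odd _ _ _ n hn⟩
      filter_upwards [h_diag p.1 p.2.1 p.2.2] with ω hω
      rw [← Complex.hasSum_ofReal] at hω
      simpa only [Complex.mul_conj, Complex.normSq_eq_norm_sq] using hω
    · intro p e e'
      have := Fintype.ofFinite F
      have h := schur_orthogonality (τ p.2.1) (hτ.unitary _) (hτ.irreducible _) e
        (w p.2.1 (δ p.1 p.2.1 p.2.2)) e' (w p.2.1 (δ p.1 p.2.1 p.2.2))
      -- Schur gives `d_χ · ∑ = L ‖w‖² ⟨e, e'⟩`. Since `‖w‖² = d_χ`, the dimension cancels and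
      -- leaves `L ⟨e, e'⟩`, where `L = C⁻¹`.
      refine hasSum_of_eq (hasSum_fintype _) (mul_left_cancel₀ (hfin p) (h.trans ?_))
      have hn : inner ℂ (w p.2.1 (δ p.1 p.2.1 p.2.2)) (w p.2.1 (δ p.1 p.2.1 p.2.2)) =
          (Module.finrank ℂ (H p.2.1) : ℂ) := by
        rw [inner_self_eq_norm_sq_to_K, ← RCLike.ofReal_pow, hw_norm, RCLike.ofReal_natCast]
      rw [hn, ← Nat.card_eq_fintype_card]
      push_cast
      field_simp
    · exact one_div_ne_zero (Nat.cast_ne_zero.2 Nat.card_pos.ne')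
    · rintro ⟨i, χ, μ⟩ ⟨i', χ', μ'⟩ hp
      have := Fintype.ofFinite F
      by_cases hχ : χ = χ'
      · subst hχ
        have hne : (⟨i, μ⟩ : Σ i, Fin (m i χ)) ≠ ⟨i', μ'⟩ := by
          rintro ⟨⟩
          exact hp rfl
        -- For equal vectors the wavelet sum vanishes by (c); for different ones the group sum
        -- vanishes, as they are orthogonal members of the basis.
        by_cases hδ : w χ (δ i χ μ) = w χ (δ i' χ μ')
        · exact Or.inl ⟨h_cross χ i i' μ μ' hne hδ, h_cross_odd χ i i' μ μ' hne hδ⟩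
        · refine Or.inr fun e e' => ?_
          have h := schur_orthogonality (τ χ) (hτ.unitary _) (hτ.irreducible _) e
            (w χ (δ i χ μ)) e' (w χ (δ i' χ μ'))
          rw [hw_orth χ _ _ fun h => hδ (congrArg (w χ) h.symm), mul_zero, zero_mul] at h
          exact hasSum_of_eq (hasSum_fintype _) ((mul_eq_zero.1 h).resolve_left (hfin ⟨i, χ, μ⟩))
      · refine Or.inr fun e e' => hasSum_of_eq (hasSum_fintype _) ?_
        exact schur_orthogonality_ne (τ χ) (hτ.unitary χ') (hτ.irreducible _) (hτ.irreducible _)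
          (hτ.inequivalent χ' χ (Ne.symm hχ)) e _ e' _
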